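/- Let $\nu>-1$ and $0<\tau<1$. Let $L_n^{(\nu)}$ be the generalised Laguerre polynomials and $I_\nu$, $K_\nu$ the modified Bessel functions of the first and second kind. Consider on $\mathbb{C}$ the measure $$d\mu(z)=\frac{1}{\pi(1-\tau^2)^2\,\Gamma(\nu+2)}\,|z|^{\nu}K_\nu\!\Big(\tfrac{2|z|}{1-\tau^2}\Big)\,e^{\frac{2\tau}{1-\tau^2}\mathrm{Re}\,z}\,d^2z,$$ where $d^2z$ is the area measure, and the skew-symmetric form $\langle f,g\rangle=\int_{\mathbb{C}}\big(f(z)g(\bar z)-g(z)f(\bar z)\big)(z-\bar z)\,d\mu(z)$ on $\mathbb{C}[z]$. Polynomials $(q_n)_{n\ge0}$ with $\deg q_n=n$ are called skew-orthogonal, with skew-norms $r_k>0$, if for all $k,l\ge0$ $$\langle q_{2k},q_{2l}\rangle=\langle q_{2k+1},q_{2l+1}\rangle=0,\qquad \langle q_{2k},q_{2l+1}\rangle=-\langle q_{2l+1},q_{2k}\rangle=r_k\delta_{k,l}.$$ Such families exist, and can be chosen monic. For every such family the pre-kernel $$\sigma_{\tau,N}(z,u)=\sum_{k=0}^{N-1}\frac{q_{2k+1}(z)q_{2k}(u)-q_{2k}(z)q_{2k+1}(u)}{r_k}$$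 is, for every $N$, equal to the partial sum $\sum_{k=0}^{N-1}T_k(z,u)$, where (with $(-1)!!=1$) $$T_k(z,u)=-\frac{\sqrt{\pi}\,\Gamma(\nu+2)(2k)!!\,\tau^{2k+1}}{2^{k+\nu+1}\Gamma(k+\frac{\nu}{2}+\frac32)}\sum_{l=0}^{k}\frac{(2l-1)!!\,\tau^{2l}}{2^l\,\Gamma(l+\frac{\nu}{2}+1)}\Big[L^{(\nu)}_{2k+1}\big(\tfrac z\tau\big)L^{(\nu)}_{2l}\big(\tfrac u\tau\big)-L^{(\nu)}_{2l}\big(\tfrac z\tau\big)L^{(\nu)}_{2k+1}\big(\tfrac u\tau\big)\Big].$$ As $N\to\infty$, $\sigma_{\tau,N}(z,u)$ converges, uniformly for $(z,u)$ in compact subsets of $\mathbb{C}^2$, to the function $S_\tau(z,u)=\sum_{k=0}^\infty T_k(z,u)$. This series converges absolutely for all $z,u\in\mathbb{C}$, $S_\tau$ is continuous on $\mathbb{C}^2$, and for $zu\neq0$ (with principal branches of $\sqrt{zu}$, $(zu)^{\nu/2}$ and $I_\nu$) $$S_\tau(z,u)=\frac{\Gamma(\nu+2)\,e^{-\frac{\tau}{1-\tau^2}(z+u)}}{(1-\tau^2)\,(zu)^{\nu/2}}\int_0^{\pi/2}\sinh\!\Big(\frac{(z-u)\cos\alpha}{1-\tau^2}\Big)\,I_\nu\!\Big(\frac{2\sqrt{zu}\,\sin\alpha}{1-\tau^2}\Big)\,d\alpha,$$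 the integral being absolutely convergent. (For $zu=0$ the right-hand side is understood as its continuous extension, so that the formula holds for all $z,u\in\mathbb{C}$.) -/

import Mathlib

open MeasureTheory Filter Topology
open scoped Nat

/-- Modified Bessel function of the first kind of real order `ν`, principal branch:
`I_ν(z) = (z/2)^ν ∑ₙ (z/2)^(2n) / (n! Γ(n+ν+1))`. -/
noncomputable def besselI (ν : ℝ) (z : ℂ) : ℂ :=
  (z / 2) ^ (ν : ℂ) *
    ∑' n : ℕ, (z / 2) ^ (2 * n) / ((n ! : ℂ) * ((Real.Gamma (n + ν + 1) : ℝ) : ℂ))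

/-- Modified Bessel function of the second kind (Macdonald function) of real order `ν` at a
positive real argument:
`K_ν(x) = (1/2) (x/2)^ν ∫₀^∞ exp(-t - x²/(4t)) t^(-ν-1) dt`. -/
noncomputable def besselK (ν x : ℝ) : ℝ :=
  (1 / 2) * (x / 2) ^ ν *
    ∫ t in Set.Ioi (0 : ℝ), Real.exp (-t - x ^ 2 / (4 * t)) * t ^ (-ν - 1)

/-- Generalised Laguerre polynomial `L_n^(ν)`, for `ν > -1`:
`L_n^(ν)(x) = ∑_{k=0}^n (-1)^k Γ(n+ν+1) / (Γ(k+ν+1) (n-k)!) x^k / k!`. -/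
noncomputable def laguerreL (ν : ℝ) (n : ℕ) (x : ℂ) : ℂ :=
  ∑ k ∈ Finset.range (n + 1),
    (-1 : ℂ) ^ k *
      ((Real.Gamma (n + ν + 1) / (Real.Gamma (k + ν + 1) * ((n - k)! : ℝ) * (k ! : ℝ)) : ℝ) : ℂ)
      * x ^ k

/-- The chiral elliptic weight
`w(z) = |z|^ν K_ν(2|z|/(1-τ²)) exp(2τ Re z/(1-τ²))` on the complex plane. -/
noncomputable def chiralEllipticWeight (ν τ : ℝ) (z : ℂ) : ℝ :=
  ‖z‖ ^ ν * besselK ν (2 / (1 - τ ^ 2) * ‖z‖) * Real.exp (2 * τ / (1 - τ ^ 2) * z.re)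

/-- The measure with density `w` with respect to the area measure on `ℂ` times the normalising
factor `1/(π (1-τ²)² Γ(ν+2))`. -/
noncomputable def chiralEllipticMeasure (ν τ : ℝ) : Measure ℂ :=
  (volume : Measure ℂ).withDensity fun z =>
    ENNReal.ofReal
      (chiralEllipticWeight ν τ z / (Real.pi * (1 - τ ^ 2) ^ 2 * Real.Gamma (ν + 2)))

/-- The skew-symmetric form
`⟨f, g⟩ = ∫ (f(z) g(z̄) - g(z) f(z̄)) (z - z̄) dμ(z)` on polynomials. -/
noncomputable def skewProduct (μ : Measure ℂ) (f g : Polynomial ℂ) : ℂ :=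
  ∫ z : ℂ, (f.eval z * g.eval (starRingEnd ℂ z) - g.eval z * f.eval (starRingEnd ℂ z))
    * (z - starRingEnd ℂ z) ∂μ

/-- `(q_n)` is a family of skew-orthogonal polynomials of `μ`, with skew-norms `r_k > 0`.
The polynomials need not be monic. -/
structure IsSkewOrthogonalFamily (μ : Measure ℂ) (q : ℕ → Polynomial ℂ) (r : ℕ → ℝ) : Prop where
  degree_eq : ∀ n : ℕ, (q n).degree = (n : WithBot ℕ)
  even_even : ∀ k l : ℕ, skewProduct μ (q (2 * k)) (q (2 * l)) = 0
  odd_odd : ∀ k l : ℕ, skewProduct μ (q (2 * k + 1)) (q (2 * l + 1)) = 0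
  even_odd : ∀ k l : ℕ,
    skewProduct μ (q (2 * k)) (q (2 * l + 1)) = if k = l then (r k : ℂ) else 0
  odd_even : ∀ k l : ℕ,
    skewProduct μ (q (2 * l + 1)) (q (2 * k)) = -(if k = l then (r k : ℂ) else 0)
  norm_pos : ∀ k : ℕ, 0 < r k

/-- The pre-kernel
`σ_N(z,u) = ∑_{k<N} (q_{2k+1}(z) q_{2k}(u) - q_{2k}(z) q_{2k+1}(u)) / r_k`. -/
noncomputable def preKernel (q : ℕ → Polynomial ℂ) (r : ℕ → ℝ) (N : ℕ) (z u : ℂ) : ℂ :=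
  ∑ k ∈ Finset.range N,
    ((q (2 * k + 1)).eval z * (q (2 * k)).eval u - (q (2 * k)).eval z * (q (2 * k + 1)).eval u)
      / (r k : ℂ)

/-- The `k`-th term, sign included, of the Laguerre double sum. Truncated subtraction is harmless:
at `l = 0` the factor is `(-1)!! = 1 = 0‼`. -/
noncomputable def laguerreKernelTerm (ν τ : ℝ) (k : ℕ) (z u : ℂ) : ℂ :=
  -(((Real.sqrt Real.pi * Real.Gamma (ν + 2) * ((2 * k)‼ : ℝ) * τ ^ (2 * k + 1)
      / ((2 : ℝ) ^ ((k : ℝ) + ν + 1) * Real.Gamma (k + ν / 2 + 3 / 2)) : ℝ) : ℂ) *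
    ∑ l ∈ Finset.range (k + 1),
      (((((2 * l - 1)‼ : ℕ) : ℝ) * τ ^ (2 * l)
        / ((2 : ℝ) ^ l * Real.Gamma (l + ν / 2 + 1)) : ℝ) : ℂ) *
        (laguerreL ν (2 * k + 1) (z / (τ : ℂ)) * laguerreL ν (2 * l) (u / (τ : ℂ))
          - laguerreL ν (2 * l) (z / (τ : ℂ)) * laguerreL ν (2 * k + 1) (u / (τ : ℂ))))

/-- The infinite Laguerre double sum `S_τ(z,u)`. -/
noncomputable def laguerreKernel (ν τ : ℝ) (z u : ℂ) : ℂ :=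
  ∑' k : ℕ, laguerreKernelTerm ν τ k z u

/-- The integrand
`sinh((z-u) cos α/(1-τ²)) I_ν(2 √(zu) sin α/(1-τ²))`, with the principal square root. -/
noncomputable def laguerreKernelIntegrand (ν τ : ℝ) (z u : ℂ) (α : ℝ) : ℂ :=
  Complex.sinh ((z - u) * (Real.cos α : ℂ) / ((1 - τ ^ 2 : ℝ) : ℂ)) *
    besselI ν (2 * (z * u) ^ (1 / 2 : ℂ) * (Real.sin α : ℂ) / ((1 - τ ^ 2 : ℝ) : ℂ))

/-! Let `p_n(z) = (-τ)^n n! L_n^(ν)(z/τ)`, which is monic (`monicLaguerre`).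

Skew-orthogonality. Writing `K_ν` as an integral over `x > 0` shows that the measure is, up to a
constant, the image of a gamma weight in `x` times a complex Gaussian in `w` under `τx + √((1-τ²)x)
w` (`chiralEllipticMeasure_eq_map`). Taylor expansion about `τx` reduces `∫ f(z) g(z̄) dμ` to
half-line integrals of products of derivatives, and Laguerre polynomials stay orthogonal under
differentiation; hence the `p_n` are orthogonal for this bilinear form (`polyForm_monicLaguerre`).
The skew form is `2(⟨Xf, g⟩ - ⟨f, Xg⟩)`, so by the three-term recurrence it vanishes on `p_m`, `p_n`
unless `|m - n| = 1`. Solving this system gives `q_{2k+1} = p_{2k+1}` and `q_{2k} = ∑_{l ≤ k}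
(a_{2l}/a_{2k}) p_{2l}` with `a` = `skewCoeff`. The pre-kernel reproduces polynomials of degree
below `2N` under the skew form, hence does not depend on the family (`preKernel_unique`), and for
this one it is the Laguerre sum.

Limit. An explicit majorant (`summable_majorant`) gives locally uniform convergence and allows
rearrangement into a power series in `z`, `u`. For the closed form, `τ` is replaced by a complex `t`
in the unit disc. With `B = z∂² + (ν+1)∂` one has `∂_t p_n = -B p_n`, so the kernel solves `∂_t S =
-(B_z + B_u) S`. Its value `S_0` at `t = 0` satisfies `(B_z + B_u) S_0 = (z + u) S_0`, and for such
data the flow is explicit: `S_t(z,u) = (1-t²)^(-ν-1) e^{-t(z+u)/(1-t²)} S_0(z/(1-t²), u/(1-t²))`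
(`kernelMoment_eq`).

It remains to find `S_0`. With `F` = `besselSeries`, the function `sinh((z-u) cos α) F(zu sin²α)`
solves the same equation for each `α`, because `cos² + sin² = 1`; so does its average against `sin^ν
α`. A solution is determined by its restriction to `u = 0`, where the comparison is an elementary
trigonometric integral (`kernelCoeff_eq_integral`). -/

/-- The coefficient `binom n k * Γ(n+ν+1) / Γ(k+ν+1)` of the monic Laguerre polynomials. -/
noncomputable def laguerreCoeff (ν : ℝ) (n k : ℕ) : ℝ :=
  n.choose k * (Real.Gamma (n + ν + 1) / Real.Gamma (k + ν + 1))

/-- The coefficient of `z ^ k` in the monic rescaled Laguerre polynomial of degree `n`. -/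
noncomputable def scaledLaguerreCoeff (ν : ℝ) (t : ℂ) (n k : ℕ) : ℂ :=
  (-t) ^ (n - k) * (laguerreCoeff ν n k : ℂ)

/-- The monic rescaled Laguerre polynomial `(-t)^n n! L_n^(ν)(z/t)`. -/
noncomputable def monicLaguerre (ν : ℝ) (t : ℂ) (n : ℕ) : Polynomial ℂ :=
  ∑ k ∈ Finset.range (n + 1), Polynomial.monomial k (scaledLaguerreCoeff ν t n k)

/-- The sequence with `a 0 = a 1 = 1` and `a (n+2) = a n / ((n+2) (n+2+ν))`. -/
noncomputable def skewCoeff (ν : ℝ) : ℕ → ℝ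
  | 0 => 1
  | 1 => 1
  | n + 2 => skewCoeff ν n / (((n : ℝ) + 2) * (n + 2 + ν))

/-! ### Rescaled monic Laguerre polynomials. -/

section Coefficients

variable {ν : ℝ}

lemma gamma_nat_pos (hν : -1 < ν) (n : ℕ) : 0 < Real.Gamma (n + ν + 1) :=
  Real.Gamma_pos_of_pos (by have : (0 : ℝ) ≤ n := n.cast_nonneg; linarith)

lemma gamma_nat_succ (hν : -1 < ν) (n : ℕ) :
    Real.Gamma ((n + 1 : ℕ) + ν + 1) = (n + ν + 1) * Real.Gamma (n + ν + 1) := by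
  have : (0 : ℝ) ≤ n := n.cast_nonneg
  rw [← Real.Gamma_add_one (by linarith)]
  push_cast; congr 1; ring

lemma laguerreCoeff_of_lt {n k : ℕ} (h : n < k) : laguerreCoeff ν n k = 0 := by
  simp [laguerreCoeff, Nat.choose_eq_zero_of_lt h]

lemma laguerreCoeff_self (hν : -1 < ν) (n : ℕ) : laguerreCoeff ν n n = 1 := by
  simp [laguerreCoeff, (gamma_nat_pos hν n).ne']

lemma laguerreCoeff_nonneg (hν : -1 < ν) (n k : ℕ) : 0 ≤ laguerreCoeff ν n k :=
  mul_nonneg (Nat.cast_nonneg _) (div_pos (gamma_nat_pos hν n) (gamma_nat_pos hν k)).le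

lemma choose_succ_mul {n k : ℕ} (h : k ≤ n) :
    ((n.choose (k + 1) : ℕ) : ℝ) * (k + 1) = n.choose k * (n - k) := by
  have := Nat.choose_succ_right_eq n k
  rw [← Nat.cast_sub h]
  exact_mod_cast this

/-- The coefficient form of `∂_t p_n = -B p_n`, up to powers of `-t`. -/
lemma sub_mul_laguerreCoeff (hν : -1 < ν) {n k : ℕ} (h : k ≤ n) :
    ((n : ℝ) - k) * laguerreCoeff ν n k
      = (k + 1) * (k + 1 + ν) * laguerreCoeff ν n (k + 1) := by
  have hk : (0 : ℝ) ≤ k := k.cast_nonneg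
  have h1 : (k : ℝ) + ν + 1 ≠ 0 := by linarith
  have h2 := (gamma_nat_pos hν k).ne'
  have h3 := choose_succ_mul h
  unfold laguerreCoeff
  rw [gamma_nat_succ hν k]
  field_simp
  linear_combination (-(k + ν + 1 : ℝ) * Real.Gamma (n + ν + 1)) * h3

lemma laguerreCoeff_zero_rec (hν : -1 < ν) (n : ℕ) :
    laguerreCoeff ν (n + 2) 0 - (2 * n + ν + 3) * laguerreCoeff ν (n + 1) 0
      + (n + 1) * (n + 1 + ν) * laguerreCoeff ν n 0 = 0 := by
  unfold laguerreCoeff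
  rw [gamma_nat_succ hν (n + 1), gamma_nat_succ hν n]
  simp only [Nat.choose_zero_right]
  push_cast
  ring

/-- The three-term recurrence read off at `z^(k+1)`, with the powers of `-t` divided out. -/
lemma laguerreCoeff_succ_rec (hν : -1 < ν) {n k : ℕ} (h : k ≤ n) :
    laguerreCoeff ν (n + 1) k - laguerreCoeff ν (n + 2) (k + 1)
      + (2 * n + ν + 3) * laguerreCoeff ν (n + 1) (k + 1)
      - (n + 1) * (n + 1 + ν) * laguerreCoeff ν n (k + 1) = 0 := by
  have hk : (0 : ℝ) ≤ k := k.cast_nonneg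
  have h1 : (k : ℝ) + ν + 1 ≠ 0 := by linarith
  have h2 := (gamma_nat_pos hν k).ne'
  have h3 := choose_succ_mul (n := n + 1) (k := k) (by omega)
  have h4 : ((n + 1 : ℕ) : ℝ) * (n.choose (k + 1))
      = ((n + 1).choose (k + 1) : ℕ) * (n - k) := by
    have := Nat.choose_mul_succ_eq n (k + 1)
    rw [← Nat.cast_sub h]
    have e : n + 1 - (k + 1) = n - k := by omega
    rw [e] at this
    rw [mul_comm]
    exact_mod_cast this
  have h5 : (((n + 2).choose (k + 1) : ℕ) : ℝ)
      = (n + 1).choose k + (n + 1).choose (k + 1) := by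
    exact_mod_cast Nat.choose_succ_succ (n + 1) k
  unfold laguerreCoeff
  rw [gamma_nat_succ hν (n + 1), gamma_nat_succ hν n, gamma_nat_succ hν k, h5]
  push_cast at h3 h4 ⊢
  field_simp
  linear_combination ((n + 1 + ν : ℝ) * Real.Gamma (n + ν + 1)) * (h3 - h4)

lemma scaledLaguerreCoeff_of_lt {n k : ℕ} (t : ℂ) (h : n < k) :
    scaledLaguerreCoeff ν t n k = 0 := by
  simp [scaledLaguerreCoeff, laguerreCoeff_of_lt h]

lemma scaledLaguerreCoeff_self (hν : -1 < ν) (t : ℂ) (n : ℕ) :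
    scaledLaguerreCoeff ν t n n = 1 := by
  simp [scaledLaguerreCoeff, laguerreCoeff_self hν]

lemma coeff_monicLaguerre (t : ℂ) (n k : ℕ) :
    (monicLaguerre ν t n).coeff k = scaledLaguerreCoeff ν t n k := by
  rw [monicLaguerre, Polynomial.finsetSum_coeff]
  simp only [Polynomial.coeff_monomial]
  rw [Finset.sum_ite_eq']
  split_ifs with h
  · rfl
  · rw [scaledLaguerreCoeff_of_lt]
    simpa [Nat.lt_succ_iff] using h

lemma eval_monicLaguerre (t z : ℂ) (n : ℕ) :
    (monicLaguerre ν t n).eval z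
      = ∑ k ∈ Finset.range (n + 1), scaledLaguerreCoeff ν t n k * z ^ k := by
  simp [monicLaguerre, Polynomial.eval_finsetSum, Polynomial.eval_monomial]

lemma monicLaguerre_monic (hν : -1 < ν) (t : ℂ) (n : ℕ) : (monicLaguerre ν t n).Monic := by
  refine Polynomial.monic_of_natDegree_le_of_coeff_eq_one n ?_ ?_
  · rw [Polynomial.natDegree_le_iff_coeff_eq_zero]
    intro k hk
    rw [coeff_monicLaguerre, scaledLaguerreCoeff_of_lt t hk]
  · rw [coeff_monicLaguerre, scaledLaguerreCoeff_self hν]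

lemma monicLaguerre_degree (hν : -1 < ν) (t : ℂ) (n : ℕ) :
    (monicLaguerre ν t n).degree = n := by
  apply le_antisymm
  · rw [Polynomial.degree_le_iff_coeff_zero]
    intro k hk
    rw [coeff_monicLaguerre, scaledLaguerreCoeff_of_lt t (by exact_mod_cast hk)]
  · apply Polynomial.le_degree_of_ne_zero
    rw [coeff_monicLaguerre, scaledLaguerreCoeff_self hν]
    exact one_ne_zero

lemma X_mul_monicLaguerre_zero (hν : -1 < ν) (t : ℂ) :
    Polynomial.X * monicLaguerre ν t 0
      = monicLaguerre ν t 1 + Polynomial.C (t * (ν + 1)) * monicLaguerre ν t 0 := by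
  have h1 : laguerreCoeff ν 1 0 = ν + 1 := by
    have := gamma_nat_succ hν 0
    have h2 := (gamma_nat_pos hν 0).ne'
    simp only [laguerreCoeff]
    rw [show ((1 : ℕ) : ℝ) = ((0 + 1 : ℕ) : ℝ) by simp, this]
    field_simp
    simp
  ext k
  rcases k with _ | _ | k
  · simp [coeff_monicLaguerre, scaledLaguerreCoeff, laguerreCoeff_self hν, h1]
  · simp only [Polynomial.coeff_X_mul, Polynomial.coeff_add, Polynomial.coeff_C_mul,
      coeff_monicLaguerre, zero_add, scaledLaguerreCoeff_self hν]
    rw [scaledLaguerreCoeff_of_lt t Nat.zero_lt_one, mul_zero, add_zero]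
  · simp only [Polynomial.coeff_X_mul, Polynomial.coeff_add, Polynomial.coeff_C_mul,
      coeff_monicLaguerre]
    rw [scaledLaguerreCoeff_of_lt t (show 0 < k + 1 by omega),
      scaledLaguerreCoeff_of_lt t (show 1 < k + 1 + 1 by omega),
      scaledLaguerreCoeff_of_lt t (show 0 < k + 1 + 1 by omega)]
    simp

lemma X_mul_monicLaguerre_succ (hν : -1 < ν) (t : ℂ) (n : ℕ) :
    Polynomial.X * monicLaguerre ν t (n + 1)
      = monicLaguerre ν t (n + 2) + Polynomial.C (t * (2 * n + ν + 3)) * monicLaguerre ν t (n + 1)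
        + Polynomial.C (t ^ 2 * ((n + 1) * (n + 1 + ν))) * monicLaguerre ν t n := by
  ext k
  rcases k with _ | k
  · simp only [Polynomial.mul_coeff_zero, Polynomial.coeff_X_zero, zero_mul, Polynomial.coeff_add,
      coeff_monicLaguerre, scaledLaguerreCoeff, Polynomial.coeff_C_zero]
    have h := congrArg (fun x : ℝ => (x : ℂ)) (laguerreCoeff_zero_rec hν n)
    push_cast at h
    simp only [Nat.sub_zero, pow_succ]
    linear_combination -((-t) ^ n * t ^ 2) * h
  · simp only [Polynomial.coeff_X_mul, Polynomial.coeff_add,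
      Polynomial.coeff_C_mul, coeff_monicLaguerre]
    rcases le_or_gt k n with hk | hk
    · have h := congrArg (fun x : ℝ => (x : ℂ)) (laguerreCoeff_succ_rec hν hk)
      push_cast at h
      obtain ⟨j, rfl⟩ := Nat.exists_eq_add_of_le hk
      -- For `k = n` the coefficient of `p_n` at `k + 1` vanishes and its exponent `n - (k + 1)`
      -- would truncate, so this case is separate.
      rcases j with _ | j
      · simp only [Nat.add_zero] at h ⊢
        rw [scaledLaguerreCoeff_of_lt t (Nat.lt_succ_self k), scaledLaguerreCoeff,
          scaledLaguerreCoeff, scaledLaguerreCoeff]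
        rw [laguerreCoeff_of_lt (Nat.lt_succ_self k)] at h
        simp only [show k + 1 - k = 1 by omega, show k + 2 - (k + 1) = 1 by omega, Nat.sub_self]
        push_cast at h ⊢
        linear_combination (-t) * h
      · simp only [scaledLaguerreCoeff, show k + (j + 1) + 1 - k = j + 2 by omega,
          show k + (j + 1) + 2 - (k + 1) = j + 2 by omega,
          show k + (j + 1) + 1 - (k + 1) = j + 1 by omega,
          show k + (j + 1) - (k + 1) = j by omega]
        push_cast at h ⊢
        linear_combination (-t) ^ (j + 2) * h
    · rcases Nat.lt_or_ge (n + 1) k with h1 | h1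
      · simp [scaledLaguerreCoeff_of_lt t h1, scaledLaguerreCoeff_of_lt t (show n + 2 < k + 1 by omega),
          scaledLaguerreCoeff_of_lt t (show n + 1 < k + 1 by omega),
          scaledLaguerreCoeff_of_lt t (show n < k + 1 by omega)]
      · obtain rfl : k = n + 1 := by omega
        simp [scaledLaguerreCoeff_self hν, scaledLaguerreCoeff_of_lt t (show n + 1 < n + 2 by omega),
          scaledLaguerreCoeff_of_lt t (show n < n + 2 by omega)]

/-- Differentiation lowers the degree and raises the parameter `ν` by the same amount; this is what
fits the shifted gamma weights in `polyForm_eq`. -/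
lemma hasseDeriv_monicLaguerre (t : ℂ) {n i : ℕ} (h : i ≤ n) :
    Polynomial.hasseDeriv i (monicLaguerre ν t n)
      = Polynomial.C (n.choose i : ℂ) * monicLaguerre (ν + i) t (n - i) := by
  ext k
  rw [Polynomial.hasseDeriv_coeff, Polynomial.coeff_C_mul, coeff_monicLaguerre,
    coeff_monicLaguerre, scaledLaguerreCoeff, scaledLaguerreCoeff]
  rcases Nat.lt_or_ge n (k + i) with hk | hk
  · rw [laguerreCoeff_of_lt hk, laguerreCoeff_of_lt (show n - i < k by omega)]
    simp
  · rw [show n - (k + i) = n - i - k by omega]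
    have hc : ((k + i).choose i : ℂ) * (n.choose (k + i)) = n.choose i * (n - i).choose k := by
      have := Nat.choose_mul (n := n) (k := k + i) (s := i) (Nat.le_add_left i k)
      rw [Nat.add_sub_cancel] at this
      rw [mul_comm]
      exact_mod_cast this
    unfold laguerreCoeff
    rw [show ((n - i : ℕ) : ℝ) + (ν + i) + 1 = n + ν + 1 by rw [Nat.cast_sub h]; ring,
      show (k : ℝ) + (ν + i) + 1 = ((k + i : ℕ) : ℝ) + ν + 1 by push_cast; ring]
    push_cast
    linear_combination ((-t) ^ (n - i - k) *
      ((Real.Gamma (n + ν + 1) : ℂ) / (Real.Gamma (k + i + ν + 1) : ℂ))) * hc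

lemma hasseDeriv_monicLaguerre_of_lt (hν : -1 < ν) (t : ℂ) {n i : ℕ} (h : n < i) :
    Polynomial.hasseDeriv i (monicLaguerre ν t n) = 0 := by
  apply Polynomial.hasseDeriv_eq_zero_of_lt_natDegree
  rwa [Polynomial.natDegree_eq_of_degree_eq_some (monicLaguerre_degree hν t n)]

lemma eval_mul_monicLaguerre (t x : ℂ) (n : ℕ) :
    (monicLaguerre ν t n).eval (t * x) = t ^ n * (monicLaguerre ν 1 n).eval x := by
  rw [eval_monicLaguerre, eval_monicLaguerre, Finset.mul_sum]
  refine Finset.sum_congr rfl fun k hk => ?_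
  obtain ⟨j, rfl⟩ := Nat.exists_eq_add_of_le (Nat.lt_succ_iff.mp (Finset.mem_range.mp hk))
  simp only [scaledLaguerreCoeff, Nat.add_sub_cancel_left]
  rw [neg_pow t, mul_pow, pow_add]
  ring

lemma laguerreL_div {t : ℂ} (ht : t ≠ 0) (z : ℂ) (n : ℕ) :
    t ^ n * laguerreL ν n (z / t) = (-1) ^ n / (n ! : ℂ) * (monicLaguerre ν t n).eval z := by
  rw [eval_monicLaguerre, laguerreL, Finset.mul_sum, Finset.mul_sum]
  refine Finset.sum_congr rfl fun k hk => ?_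
  have hkn := Nat.lt_succ_iff.mp (Finset.mem_range.mp hk)
  have hc : ((n.choose k : ℕ) : ℂ) = (n ! : ℂ) / ((k ! : ℂ) * ((n - k)! : ℂ)) := by
    rw [Nat.cast_choose ℂ hkn]
  have hn : ((n ! : ℕ) : ℂ) ≠ 0 := Nat.cast_ne_zero.mpr n.factorial_ne_zero
  have hk0 : ((k ! : ℕ) : ℂ) ≠ 0 := Nat.cast_ne_zero.mpr k.factorial_ne_zero
  have hnk : (((n - k)! : ℕ) : ℂ) ≠ 0 := Nat.cast_ne_zero.mpr (n - k).factorial_ne_zero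
  simp only [scaledLaguerreCoeff, laguerreCoeff]
  push_cast
  rw [hc]
  obtain ⟨j, rfl⟩ := Nat.exists_eq_add_of_le hkn
  rw [Nat.add_sub_cancel_left] at *
  rw [neg_pow t j, div_pow, pow_add, pow_add]
  have h1 : ((-1 : ℂ) ^ j) * (-1) ^ j = 1 := by rw [← mul_pow]; simp
  field_simp
  generalize (Real.Gamma ((k + j : ℕ) + ν + 1) : ℂ) = G
  linear_combination (-(G * z ^ k / (Real.Gamma (k + ν + 1) : ℂ))) * h1

end Coefficients

/-! ### The constants of the Laguerre double sum. -/

section SkewCoeff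

variable {ν : ℝ}

lemma skewCoeff_pos (hν : -1 < ν) : ∀ n : ℕ, 0 < skewCoeff ν n
  | 0 => by simp [skewCoeff]
  | 1 => by simp [skewCoeff]
  | n + 2 => by
    have := skewCoeff_pos hν n
    have hn : (0 : ℝ) ≤ n := n.cast_nonneg
    rw [skewCoeff]
    apply div_pos this
    apply mul_pos <;> linarith

lemma skewCoeff_rec (hν : -1 < ν) (n : ℕ) :
    ((n : ℝ) + 2) * (n + 2 + ν) * skewCoeff ν (n + 2) = skewCoeff ν n := by
  have hn : (0 : ℝ) ≤ n := n.cast_nonneg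
  rw [skewCoeff, mul_div_cancel₀]
  have h1 : (n : ℝ) + 2 ≠ 0 := by linarith
  have h2 : (n : ℝ) + 2 + ν ≠ 0 := by linarith
  exact mul_ne_zero h1 h2

/-- Both sides obey the same recursion in `k`, and the case `k = 0` is Legendre's duplication
formula. The factor `Γ(ν/2 + 1)` cancels against the one in `even_prefactor_eq`. -/
lemma odd_prefactor_eq (hν : -1 < ν) (k : ℕ) :
    Real.sqrt Real.pi * Real.Gamma (ν + 2) * ((2 * k)‼ : ℝ)
      / ((2 : ℝ) ^ ((k : ℝ) + ν + 1) * Real.Gamma (k + ν / 2 + 3 / 2))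
      = Real.Gamma (ν / 2 + 1) * ((2 * k + 1)! : ℝ) * skewCoeff ν (2 * k + 1) := by
  induction k with
  | zero =>
    have h := Real.Gamma_mul_Gamma_add_half (ν / 2 + 1)
    rw [show 2 * (ν / 2 + 1) = ν + 2 by ring, show 1 - (ν + 2) = -(ν + 1) by ring,
      Real.rpow_neg (by norm_num)] at h
    rw [show ν / 2 + 1 + 1 / 2 = ν / 2 + 3 / 2 by ring] at h
    have h1 : (0 : ℝ) < Real.Gamma (ν / 2 + 3 / 2) := Real.Gamma_pos_of_pos (by linarith)
    have h2 : (0 : ℝ) < 2 ^ (ν + 1) := by positivity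
    simp only [skewCoeff, Nat.cast_zero, mul_zero, zero_add, Nat.doubleFactorial, Nat.cast_one,
      mul_one, Nat.factorial_one]
    rw [div_eq_iff (by positivity)]
    generalize Real.Gamma (ν / 2 + 1) = G1 at *
    generalize Real.Gamma (ν / 2 + 3 / 2) = G2 at *
    field_simp at h
    linear_combination -h
  | succ k ih =>
    have hk : (0 : ℝ) ≤ k := k.cast_nonneg
    have h0 : (0 : ℝ) < k + ν / 2 + 3 / 2 := by linarith
    have h1 : (0 : ℝ) < Real.Gamma (k + ν / 2 + 3 / 2) := Real.Gamma_pos_of_pos h0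
    have h2 : (0 : ℝ) < 2 ^ ((k : ℝ) + ν + 1) := by positivity
    have h3 : Real.Gamma (((k + 1 : ℕ) : ℝ) + ν / 2 + 3 / 2)
        = (k + ν / 2 + 3 / 2) * Real.Gamma (k + ν / 2 + 3 / 2) := by
      rw [← Real.Gamma_add_one h0.ne']; push_cast; congr 1; ring
    have h4 : (2 : ℝ) ^ (((k + 1 : ℕ) : ℝ) + ν + 1) = 2 * 2 ^ ((k : ℝ) + ν + 1) := by
      rw [show ((k + 1 : ℕ) : ℝ) + ν + 1 = (k + ν + 1) + 1 by push_cast; ring,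
        Real.rpow_add_one (by norm_num)]
      ring
    have h5 := skewCoeff_rec hν (2 * k + 1)
    rw [h3, h4]
    rw [show 2 * (k + 1) + 1 = 2 * k + 1 + 2 by ring]
    rw [show 2 * (k + 1) = 2 * k + 2 by ring, Nat.doubleFactorial_add_two]
    rw [Nat.factorial_succ, Nat.factorial_succ]
    rw [div_eq_iff (by positivity)] at ih ⊢
    rw [← h5] at ih
    push_cast at ih ⊢
    linear_combination (2 * (k : ℝ) + 2) * ih

lemma even_prefactor_eq (hν : -1 < ν) (l : ℕ) :
    (((2 * l - 1)‼ : ℕ) : ℝ) / ((2 : ℝ) ^ l * Real.Gamma (l + ν / 2 + 1))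
      = ((2 * l)! : ℝ) * skewCoeff ν (2 * l) / Real.Gamma (ν / 2 + 1) := by
  induction l with
  | zero => simp [skewCoeff]
  | succ l ih =>
    have hk : (0 : ℝ) ≤ l := l.cast_nonneg
    have h0 : (0 : ℝ) < l + ν / 2 + 1 := by linarith
    have h1 : (0 : ℝ) < Real.Gamma (l + ν / 2 + 1) := Real.Gamma_pos_of_pos h0
    have h2 : (0 : ℝ) < Real.Gamma (ν / 2 + 1) := Real.Gamma_pos_of_pos (by linarith)
    have h3 : Real.Gamma (((l + 1 : ℕ) : ℝ) + ν / 2 + 1)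
        = (l + ν / 2 + 1) * Real.Gamma (l + ν / 2 + 1) := by
      rw [← Real.Gamma_add_one h0.ne']; push_cast; congr 1; ring
    have h5 := skewCoeff_rec hν (2 * l)
    have h6 : ((2 * (l + 1) - 1)‼ : ℕ) = (2 * l + 1) * (2 * l - 1)‼ := by
      rcases l with _ | l
      · simp
      · rw [show 2 * (l + 1 + 1) - 1 = (2 * l + 1) + 2 by omega, Nat.doubleFactorial_add_two]
        rfl
    rw [h3, h6, pow_succ, show 2 * (l + 1) = 2 * l + 2 by ring, Nat.factorial_succ,
      Nat.factorial_succ]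
    rw [div_eq_div_iff (by positivity) (by positivity)] at ih ⊢
    rw [← h5] at ih
    push_cast at ih ⊢
    linear_combination (2 * (l : ℝ) + 1) * ih

/-- The overall minus sign disappears because `L_{2k+1}` has negative leading coefficient. -/
lemma laguerreKernelTerm_eq (hν : -1 < ν) {τ : ℝ} (hτ : τ ≠ 0) (k : ℕ) (z u : ℂ) :
    laguerreKernelTerm ν τ k z u = ∑ l ∈ Finset.range (k + 1),
      ((skewCoeff ν (2 * k + 1) * skewCoeff ν (2 * l) : ℝ) : ℂ) *
        ((monicLaguerre ν τ (2 * k + 1)).eval z * (monicLaguerre ν τ (2 * l)).eval u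
          - (monicLaguerre ν τ (2 * l)).eval z * (monicLaguerre ν τ (2 * k + 1)).eval u) := by
  have hτ' : (τ : ℂ) ≠ 0 := by exact_mod_cast hτ
  have hg : (0 : ℝ) < Real.Gamma (ν / 2 + 1) := Real.Gamma_pos_of_pos (by linarith)
  unfold laguerreKernelTerm
  rw [Finset.mul_sum, ← Finset.sum_neg_distrib]
  refine Finset.sum_congr rfl fun l _ => ?_
  rw [show Real.sqrt Real.pi * Real.Gamma (ν + 2) * ((2 * k)‼ : ℝ) * τ ^ (2 * k + 1)
      / ((2 : ℝ) ^ ((k : ℝ) + ν + 1) * Real.Gamma (k + ν / 2 + 3 / 2))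
      = τ ^ (2 * k + 1) * (Real.Gamma (ν / 2 + 1) * ((2 * k + 1)! : ℝ) * skewCoeff ν (2 * k + 1)) by
    rw [← odd_prefactor_eq hν k]; ring]
  rw [show (((2 * l - 1)‼ : ℕ) : ℝ) * τ ^ (2 * l) / ((2 : ℝ) ^ l * Real.Gamma (l + ν / 2 + 1))
      = τ ^ (2 * l) * (((2 * l)! : ℝ) * skewCoeff ν (2 * l) / Real.Gamma (ν / 2 + 1)) by
    rw [← even_prefactor_eq hν l]; ring]
  have e1 := fun w => laguerreL_div (ν := ν) hτ' w (2 * k + 1)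
  have e2 := fun w => laguerreL_div (ν := ν) hτ' w (2 * l)
  rw [Odd.neg_one_pow ⟨k, rfl⟩] at e1
  rw [Even.neg_one_pow ⟨l, by ring⟩] at e2
  have f1 : (((2 * k + 1)! : ℕ) : ℂ) ≠ 0 := Nat.cast_ne_zero.mpr (Nat.factorial_ne_zero _)
  have f2 : (((2 * l)! : ℕ) : ℂ) ≠ 0 := Nat.cast_ne_zero.mpr (Nat.factorial_ne_zero _)
  have g' : ((Real.Gamma (ν / 2 + 1) : ℝ) : ℂ) ≠ 0 := by exact_mod_cast hg.ne'
  have e1' : ∀ w, (monicLaguerre ν τ (2 * k + 1)).eval w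
      = -(((2 * k + 1)! : ℕ) : ℂ) * (τ ^ (2 * k + 1) * laguerreL ν (2 * k + 1) (w / τ)) := by
    intro w; rw [e1]; field_simp
  have e2' : ∀ w, (monicLaguerre ν τ (2 * l)).eval w
      = (((2 * l)! : ℕ) : ℂ) * (τ ^ (2 * l) * laguerreL ν (2 * l) (w / τ)) := by
    intro w; rw [e2]; field_simp
  simp only [e1', e2']
  push_cast
  generalize (Real.Gamma (ν / 2 + 1) : ℂ) = G at *
  field_simp
  ring

end SkewCoeff

/-! ### Laguerre orthogonality on the half-line. -/

/-- The measure `x^α e^{-x} dx` on `(0, ∞)`. -/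
noncomputable def gammaWeight (α : ℝ) : Measure ℝ :=
  (volume.restrict (Set.Ioi 0)).withDensity fun x => ENNReal.ofReal (Real.exp (-x) * x ^ α)

section GammaWeight

variable {α : ℝ}

lemma measurable_gammaWeight_density (α : ℝ) :
    Measurable fun x : ℝ => ENNReal.ofReal (Real.exp (-x) * x ^ α) := by
  fun_prop

lemma integrable_gammaWeight_iff {E : Type*} [NormedAddCommGroup E] [NormedSpace ℝ E]
    {f : ℝ → E} :
    Integrable f (gammaWeight α)
      ↔ IntegrableOn (fun x => (Real.exp (-x) * x ^ α) • f x) (Set.Ioi 0) := by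
  rw [gammaWeight, integrable_withDensity_iff_integrable_smul' (measurable_gammaWeight_density α)
    (Eventually.of_forall fun _ => ENNReal.ofReal_lt_top)]
  refine integrable_congr ?_
  filter_upwards [ae_restrict_mem measurableSet_Ioi] with x hx
  have hx : (0 : ℝ) < x := hx
  rw [ENNReal.toReal_ofReal (by positivity)]

lemma integral_gammaWeight {E : Type*} [NormedAddCommGroup E] [NormedSpace ℝ E] (f : ℝ → E) :
    ∫ x, f x ∂gammaWeight α = ∫ x in Set.Ioi 0, (Real.exp (-x) * x ^ α) • f x := by
  rw [gammaWeight, integral_withDensity_eq_integral_toReal_smul (measurable_gammaWeight_density α)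
    (Eventually.of_forall fun _ => ENNReal.ofReal_lt_top)]
  refine integral_congr_ae ?_
  filter_upwards [ae_restrict_mem measurableSet_Ioi] with x hx
  have hx : (0 : ℝ) < x := hx
  rw [ENNReal.toReal_ofReal (by positivity)]

lemma integrable_rpow_gammaWeight (hα : -1 < α) {s : ℝ} (hs : 0 ≤ s) :
    Integrable (fun x : ℝ => x ^ s) (gammaWeight α) := by
  rw [integrable_gammaWeight_iff]
  refine (Real.GammaIntegral_convergent (s := α + s + 1) (by linarith)).congr_fun ?_
    measurableSet_Ioi
  intro x hx
  have hx : (0 : ℝ) < x := hx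
  simp only [smul_eq_mul]
  rw [mul_assoc, ← Real.rpow_add hx]
  congr 2; ring

lemma integral_rpow_gammaWeight (hα : -1 < α) {s : ℝ} (hs : 0 ≤ s) :
    ∫ x, x ^ s ∂gammaWeight α = Real.Gamma (s + α + 1) := by
  rw [integral_gammaWeight, Real.Gamma_eq_integral (by linarith)]
  refine setIntegral_congr_fun measurableSet_Ioi ?_
  intro x hx
  have hx : (0 : ℝ) < x := hx
  simp only [smul_eq_mul]
  rw [mul_assoc, ← Real.rpow_add hx]
  congr 2; ring

lemma integrable_pow_gammaWeight (hα : -1 < α) (k : ℕ) :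
    Integrable (fun x : ℝ => (x : ℂ) ^ k) (gammaWeight α) := by
  have := (integrable_rpow_gammaWeight hα (Nat.cast_nonneg k)).ofReal (𝕜 := ℂ)
  simpa [Real.rpow_natCast] using this

lemma integral_pow_gammaWeight (hα : -1 < α) (k : ℕ) :
    ∫ x, (x : ℂ) ^ k ∂gammaWeight α = (Real.Gamma (k + α + 1) : ℂ) := by
  rw [← integral_rpow_gammaWeight hα (Nat.cast_nonneg k), ← integral_complex_ofReal]
  simp [Real.rpow_natCast]

lemma integrable_eval_gammaWeight (hα : -1 < α) (f : Polynomial ℂ) :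
    Integrable (fun x : ℝ => f.eval (x : ℂ)) (gammaWeight α) := by
  simp only [Polynomial.eval_eq_sum_range]
  exact integrable_finsetSum _ fun k _ => (integrable_pow_gammaWeight hα k).const_mul _

lemma integral_pow_mul_gammaWeight (j : ℕ) (f : ℝ → ℂ) :
    ∫ x, (x : ℂ) ^ j * f x ∂gammaWeight α = ∫ x, f x ∂gammaWeight (α + j) := by
  rw [integral_gammaWeight, integral_gammaWeight]
  refine setIntegral_congr_fun measurableSet_Ioi ?_
  intro x hx
  have hx : (0 : ℝ) < x := hx
  simp only [Real.rpow_add hx, Real.rpow_natCast, Complex.real_smul]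
  push_cast
  ring

/-- Makes the ratio of Gamma values a monic polynomial of degree `j` in `k`, ready for finite
differences. -/
lemma gamma_add_nat (hα : -1 < α) (k j : ℕ) :
    Real.Gamma (k + j + α + 1)
      = Real.Gamma (k + α + 1) * ((ascPochhammer ℝ j).comp (Polynomial.X + Polynomial.C (α + 1))).eval
          (k : ℝ) := by
  induction j with
  | zero => simp
  | succ j ih =>
    have hk : (0 : ℝ) ≤ k := k.cast_nonneg
    have hj : (0 : ℝ) ≤ j := j.cast_nonneg
    rw [show (k : ℝ) + (j + 1 : ℕ) + α + 1 = (k + j + α + 1) + 1 by push_cast; ring,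
      Real.Gamma_add_one (by linarith), ih]
    simp only [Polynomial.eval_comp, Polynomial.eval_add, Polynomial.eval_X, Polynomial.eval_C,
      ascPochhammer_succ_eval]
    ring


/-- Once `Γ(k+α+1)` cancels, the sum is `Γ(n+α+1)` times the `n`-th finite difference at `0` of a
monic polynomial of degree `j ≤ n`: `0` for `j < n`, and `n!` for `j = n`. -/
lemma sum_laguerreCoeff_mul_gamma (hα : -1 < α) {n j : ℕ} (h : j ≤ n) :
    ∑ k ∈ Finset.range (n + 1),
        (-1 : ℝ) ^ (n - k) * laguerreCoeff α n k * Real.Gamma (k + j + α + 1)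
      = if j = n then (n ! : ℝ) * Real.Gamma (n + α + 1) else 0 := by
  set P := (ascPochhammer ℝ j).comp (Polynomial.X + Polynomial.C (α + 1)) with hP
  have hdeg : P.natDegree = j := by
    rw [hP, Polynomial.natDegree_comp, ascPochhammer_natDegree, Polynomial.natDegree_X_add_C,
      mul_one]
  have hmon : P.Monic := (monic_ascPochhammer ℝ j).comp_X_add_C _
  have key := fwdDiff_iter_eq_sum_shift (1 : ℝ) P.eval n 0
  have h1 : (fwdDiff (1 : ℝ))^[n] P.eval 0 = if j = n then (n ! : ℝ) else 0 := by
    split_ifs with hj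
    · have := congrFun (Polynomial.fwdDiff_iter_degree_eq_factorial P) 0
      rw [hdeg, hmon.leadingCoeff, hj] at this
      simpa using this
    · have := congrFun (Polynomial.fwdDiff_iter_eq_zero_of_degree_lt (P := P) (n := n)
        (by rw [hdeg]; omega)) 0
      simpa using this
  rw [h1] at key
  have h2 : (if j = n then (n ! : ℝ) * Real.Gamma (n + α + 1) else 0)
      = Real.Gamma (n + α + 1) * (if j = n then (n ! : ℝ) else 0) := by
    split_ifs <;> ring
  rw [h2, key, Finset.mul_sum]
  refine Finset.sum_congr rfl fun k _ => ?_
  rw [gamma_add_nat hα, ← hP, laguerreCoeff]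
  have := (gamma_nat_pos hα k).ne'
  simp only [zsmul_eq_mul, nsmul_eq_mul, mul_one, zero_add]
  push_cast
  field_simp

lemma integral_monicLaguerre_mul_pow (hα : -1 < α) {n j : ℕ} (h : j ≤ n) :
    ∫ x : ℝ, (monicLaguerre α 1 n).eval (x : ℂ) * (x : ℂ) ^ j ∂gammaWeight α
      = if j = n then ((n ! : ℝ) * Real.Gamma (n + α + 1) : ℝ) else 0 := by
  rw [← sum_laguerreCoeff_mul_gamma hα h]
  simp only [eval_monicLaguerre, Finset.sum_mul]
  have hi : ∀ k : ℕ, (fun x : ℝ => scaledLaguerreCoeff α 1 n k * (x : ℂ) ^ k * (x : ℂ) ^ j)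
      = fun x : ℝ => scaledLaguerreCoeff α 1 n k * (x : ℂ) ^ (k + j) := by
    intro k; ext x; ring
  rw [integral_finsetSum]
  · push_cast
    refine Finset.sum_congr rfl fun k _ => ?_
    rw [hi, integral_const_mul, integral_pow_gammaWeight hα, scaledLaguerreCoeff]
    push_cast
    rfl
  · intro k _
    rw [hi]
    exact (integrable_pow_gammaWeight hα _).const_mul _

lemma integral_monicLaguerre_mul_of_le (hα : -1 < α) {m n : ℕ} (h : m ≤ n) :
    ∫ x : ℝ, (monicLaguerre α 1 n).eval (x : ℂ) * (monicLaguerre α 1 m).eval (x : ℂ) ∂gammaWeight α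
      = if m = n then ((n ! : ℝ) * Real.Gamma (n + α + 1) : ℝ) else 0 := by
  have hi : ∀ k : ℕ, Integrable (fun x : ℝ => (monicLaguerre α 1 n).eval (x : ℂ) *
      (scaledLaguerreCoeff α 1 m k * (x : ℂ) ^ k)) (gammaWeight α) := by
    intro k
    have := integrable_eval_gammaWeight hα
      (monicLaguerre α 1 n * Polynomial.monomial k (scaledLaguerreCoeff α 1 m k))
    simpa [Polynomial.eval_monomial] using this
  simp only [eval_monicLaguerre _ _ m, Finset.mul_sum]
  rw [integral_finsetSum _ fun k _ => hi k]
  have hk : ∀ k ∈ Finset.range (m + 1), ∫ x : ℝ, (monicLaguerre α 1 n).eval (x : ℂ) *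
      (scaledLaguerreCoeff α 1 m k * (x : ℂ) ^ k) ∂gammaWeight α
      = if k = n then (if m = n then ((n ! : ℝ) * Real.Gamma (n + α + 1) : ℝ) else 0 : ℂ) else 0 := by
    intro k hk
    have hkm : k ≤ m := Nat.lt_succ_iff.mp (Finset.mem_range.mp hk)
    have : (fun x : ℝ => (monicLaguerre α 1 n).eval (x : ℂ) *
        (scaledLaguerreCoeff α 1 m k * (x : ℂ) ^ k))
        = fun x : ℝ => scaledLaguerreCoeff α 1 m k *
          ((monicLaguerre α 1 n).eval (x : ℂ) * (x : ℂ) ^ k) := by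
      ext x; ring
    rw [this, integral_const_mul, integral_monicLaguerre_mul_pow hα (hkm.trans h)]
    by_cases hkn : k = n
    · obtain rfl : m = n := by omega
      subst hkn
      simp [scaledLaguerreCoeff_self hα]
    · simp [hkn]
  rw [Finset.sum_congr rfl hk, Finset.sum_ite_eq']
  by_cases hmn : m = n
  · simp [hmn]
  · simp [hmn]

lemma integral_monicLaguerre_mul (hα : -1 < α) (m n : ℕ) :
    ∫ x : ℝ, (monicLaguerre α 1 m).eval (x : ℂ) * (monicLaguerre α 1 n).eval (x : ℂ) ∂gammaWeight α
      = if m = n then ((n ! : ℝ) * Real.Gamma (n + α + 1) : ℝ) else 0 := by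
  rcases le_total m n with h | h
  · rw [← integral_monicLaguerre_mul_of_le hα h]
    simp only [mul_comm]
  · rw [integral_monicLaguerre_mul_of_le hα h]
    by_cases e : n = m
    · simp [e]
    · simp [e, Ne.symm e]

end GammaWeight

/-! ### The planar measure as a Gaussian mixture. -/

/-- The measure `e^{-|w|²} d²w` on the complex plane. -/
noncomputable def gaussWeight : Measure ℂ :=
  (volume : Measure ℂ).withDensity fun w => ENNReal.ofReal (Real.exp (-‖w‖ ^ 2))

/-- The map `(x, w) ↦ τ x + √((1-τ²) x) w`. -/
noncomputable def mixtureMap (τ : ℝ) (p : ℝ × ℂ) : ℂ :=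
  ((τ * p.1 : ℝ) : ℂ) + ((Real.sqrt (p.1 * (1 - τ ^ 2)) : ℝ) : ℂ) * p.2

section BesselK

lemma integral_Ioi_div_comp (g : ℝ → ℝ) {b : ℝ} (hb : 0 < b) :
    ∫ t in Set.Ioi (0 : ℝ), g t = ∫ x in Set.Ioi (0 : ℝ), b * x ^ (-2 : ℝ) * g (b / x) := by
  have h1 := integral_comp_mul_left_Ioi g 0 hb
  have h2 := integral_comp_rpow_Ioi (fun y => g (b * y)) (p := -1) (by norm_num)
  rw [mul_zero] at h1
  have h3 : ∫ t in Set.Ioi (0 : ℝ), g t = b * ∫ x in Set.Ioi (0 : ℝ), g (b * x) := by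
    rw [h1, smul_eq_mul, mul_inv_cancel_left₀ hb.ne']
  rw [h3, ← h2, ← integral_const_mul]
  refine setIntegral_congr_fun measurableSet_Ioi fun x hx => ?_
  have hx : (0 : ℝ) < x := hx
  simp only [smul_eq_mul, abs_neg, abs_one, one_mul, Real.rpow_neg_one, div_eq_mul_inv]
  rw [show (-1 : ℝ) - 1 = -2 by norm_num]
  ring

/-- The substitution `t = κr²/x` makes the exponent linear in `r²`, so that the Bessel weight
becomes a superposition of Gaussians. -/
lemma rpow_mul_besselK (ν : ℝ) {κ r : ℝ} (hκ : 0 < κ) (hr : 0 < r) :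
    r ^ ν * besselK ν (2 * κ * r)
      = 1 / 2 * ∫ x in Set.Ioi (0 : ℝ), x ^ (ν - 1) * Real.exp (-(κ * x) - κ * r ^ 2 / x) := by
  have hb : 0 < κ * r ^ 2 := by positivity
  unfold besselK
  rw [integral_Ioi_div_comp _ hb, show 2 * κ * r / 2 = κ * r by ring]
  rw [show r ^ ν * (1 / 2 * (κ * r) ^ ν *
      ∫ x in Set.Ioi (0 : ℝ), κ * r ^ 2 * x ^ (-2 : ℝ) *
        (Real.exp (-(κ * r ^ 2 / x) - (2 * κ * r) ^ 2 / (4 * (κ * r ^ 2 / x))) *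
          (κ * r ^ 2 / x) ^ (-ν - 1)))
      = 1 / 2 * ((r ^ ν * (κ * r) ^ ν) * ∫ x in Set.Ioi (0 : ℝ), κ * r ^ 2 * x ^ (-2 : ℝ) *
        (Real.exp (-(κ * r ^ 2 / x) - (2 * κ * r) ^ 2 / (4 * (κ * r ^ 2 / x))) *
          (κ * r ^ 2 / x) ^ (-ν - 1))) by ring]
  rw [← integral_const_mul]
  congr 1
  refine setIntegral_congr_fun measurableSet_Ioi fun x hx => ?_
  have hx : (0 : ℝ) < x := hx
  have e1 : -(κ * r ^ 2 / x) - (2 * κ * r) ^ 2 / (4 * (κ * r ^ 2 / x))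
      = -(κ * x) - κ * r ^ 2 / x := by
    field_simp
    ring
  have e2 : r ^ ν * (κ * r) ^ ν = (κ * r ^ 2) ^ ν := by
    rw [← Real.mul_rpow hr.le (by positivity)]; congr 1; ring
  have e3 : (κ * r ^ 2 / x) ^ (-ν - 1) = (κ * r ^ 2) ^ (-ν) * (κ * r ^ 2)⁻¹ * (x ^ ν * x) := by
    rw [Real.div_rpow hb.le hx.le, Real.rpow_sub_one hb.ne', Real.rpow_sub_one hx.ne',
      Real.rpow_neg hx.le]
    field_simp
  have e4 : x ^ (-2 : ℝ) = (x ^ 2)⁻¹ := by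
    rw [Real.rpow_neg hx.le]; norm_num
  have e5 : x ^ (ν - 1) = x ^ ν / x := Real.rpow_sub_one hx.ne' ν
  rw [e1, e2, e3, e4, e5, Real.rpow_neg hb.le]
  have := (Real.rpow_pos_of_pos hb ν).ne'
  field_simp

/-- Near `0` the power `x^(ν-1)` alone need not be integrable; the bound `exp(-c/x) ≤ x/c` gains one
power of `x`. -/
lemma integrableOn_besselK_integrand {ν κ c : ℝ} (hν : -1 < ν) (hκ : 0 < κ) (hc : 0 < c) :
    IntegrableOn (fun x : ℝ => x ^ (ν - 1) * Real.exp (-(κ * x) - c / x)) (Set.Ioi 0) := by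
  have h := (integrableOn_rpow_mul_exp_neg_mul_rpow (p := 1) (s := ν) (b := κ) hν (zero_lt_one) hκ).const_mul c⁻¹
  refine Integrable.mono' h (by fun_prop) ?_
  filter_upwards [ae_restrict_mem measurableSet_Ioi] with x hx
  have hx : (0 : ℝ) < x := hx
  rw [Real.norm_of_nonneg (by positivity), Real.rpow_one, Real.rpow_sub_one hx.ne', sub_eq_add_neg,
    Real.exp_add]
  have h1 : Real.exp (-(c / x)) ≤ x / c := by
    rw [Real.exp_neg, show x / c = (c / x)⁻¹ by rw [inv_div]]
    have : c / x < Real.exp (c / x) := by linarith [Real.add_one_le_exp (c / x)]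
    exact inv_anti₀ (by positivity) this.le
  calc x ^ ν / x * (Real.exp (-(κ * x)) * Real.exp (-(c / x)))
      ≤ x ^ ν / x * (Real.exp (-(κ * x)) * (x / c)) := by gcongr
    _ = c⁻¹ * (x ^ ν * Real.exp (-κ * x)) := by
      rw [neg_mul]; field_simp

lemma measurable_besselK (ν : ℝ) : Measurable (besselK ν) := by
  unfold besselK
  refine Measurable.mul (by fun_prop) ?_
  refine StronglyMeasurable.measurable ?_
  refine StronglyMeasurable.integral_prod_right (f := fun x t =>
    Real.exp (-t - x ^ 2 / (4 * t)) * t ^ (-ν - 1)) ?_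
  refine Measurable.stronglyMeasurable ?_
  unfold Function.uncurry
  fun_prop

end BesselK

section Mixture

instance sFinite_gammaWeight (α : ℝ) : SFinite (gammaWeight α) := by
  unfold gammaWeight; infer_instance

instance sFinite_gaussWeight : SFinite gaussWeight := by
  unfold gaussWeight; infer_instance

lemma measurable_mixtureMap (τ : ℝ) : Measurable (mixtureMap τ) := by
  unfold mixtureMap; fun_prop

lemma measurable_gaussWeight_density :
    Measurable fun w : ℂ => ENNReal.ofReal (Real.exp (-‖w‖ ^ 2)) := by fun_prop

lemma lintegral_comp_affine (g : ℂ → ENNReal) (hg : Measurable g) (m : ℂ) {c : ℝ} (hc : 0 < c) :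
    ∫⁻ w : ℂ, g (m + (c : ℂ) * w) = ENNReal.ofReal ((c ^ 2)⁻¹) * ∫⁻ z : ℂ, g z := by
  have h1 : ∫⁻ w : ℂ, g (m + (c : ℂ) * w)
      = ∫⁻ z : ℂ, g (m + z) ∂(Measure.map (fun w : ℂ => c • w) volume) := by
    rw [lintegral_map (by fun_prop) (by fun_prop)]
    simp [Complex.real_smul]
  rw [h1, Measure.map_addHaar_smul volume hc.ne', lintegral_smul_measure,
    lintegral_add_left_eq_self, Complex.finrank_real_complex, abs_of_pos (by positivity),
    smul_eq_mul]

/-- For fixed `x` the point is Gaussian with mean `τx` and scale `(1-τ²)x`. In the exponent, `x +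
|z-τx|²/((1-τ²)x) = (x + |z|²/x - 2τ Re z)/(1-τ²)`; integrating out `x` then produces `K_ν`. -/
lemma chiralEllipticMeasure_eq_map {ν τ : ℝ} (hν : -1 < ν) (hτ0 : 0 < τ) (hτ1 : τ < 1) :
    chiralEllipticMeasure ν τ
      = ENNReal.ofReal (1 / (2 * Real.pi * (1 - τ ^ 2) * Real.Gamma (ν + 2))) •
        ((gammaWeight ν).prod gaussWeight).map (mixtureMap τ) := by
  have hδ : 0 < 1 - τ ^ 2 := by nlinarith
  have hG : 0 < Real.Gamma (ν + 2) := Real.Gamma_pos_of_pos (by linarith)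
  have hC : 0 ≤ 1 / (2 * Real.pi * (1 - τ ^ 2) * Real.Gamma (ν + 2)) := by positivity
  refine Measure.ext_of_lintegral _ fun f hf => ?_
  have hK := measurable_besselK ν
  have hw : Measurable (chiralEllipticWeight ν τ) := by
    unfold chiralEllipticWeight
    exact ((by fun_prop : Measurable fun z : ℂ => ‖z‖ ^ ν).mul
      (hK.comp (by fun_prop))).mul (by fun_prop)
  -- the joint density of `(x, z)`
  set D : ℝ → ℂ → ℝ := fun x z => (1 - τ ^ 2)⁻¹ *
    (x ^ (ν - 1) * Real.exp (-((1 - τ ^ 2)⁻¹ * x) - (1 - τ ^ 2)⁻¹ * ‖z‖ ^ 2 / x)) *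
      Real.exp (2 * τ / (1 - τ ^ 2) * z.re) with hD
  have hDm : Measurable (Function.uncurry D) := by
    simp only [hD]; unfold Function.uncurry; fun_prop
  have inner : ∀ x ∈ Set.Ioi (0 : ℝ),
      ENNReal.ofReal (Real.exp (-x) * x ^ ν) *
        (∫⁻ w : ℂ, f (mixtureMap τ (x, w)) ∂gaussWeight)
      = ∫⁻ z : ℂ, ENNReal.ofReal (D x z) * f z := by
    intro x hx
    have hx : (0 : ℝ) < x := hx
    set c := Real.sqrt (x * (1 - τ ^ 2)) with hc
    have hc0 : 0 < c := Real.sqrt_pos.mpr (by positivity)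
    have hc2 : c ^ 2 = x * (1 - τ ^ 2) := Real.sq_sqrt (by positivity)
    have hm : Measurable fun w : ℂ => f (mixtureMap τ (x, w)) :=
      hf.comp ((measurable_mixtureMap τ).comp (by fun_prop))
    rw [gaussWeight, lintegral_withDensity_eq_lintegral_mul _ measurable_gaussWeight_density hm]
    set g : ℂ → ENNReal := fun z =>
      ENNReal.ofReal (Real.exp (-(‖z - ((τ * x : ℝ) : ℂ)‖ ^ 2 / c ^ 2))) * f z with hg
    have hgm : Measurable g := by fun_prop
    have e1 : ∀ w : ℂ, ((fun w : ℂ => ENNReal.ofReal (Real.exp (-‖w‖ ^ 2))) *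
        fun w => f (mixtureMap τ (x, w))) w = g (((τ * x : ℝ) : ℂ) + (c : ℂ) * w) := by
      intro w
      simp only [hg, Pi.mul_apply, mixtureMap, add_sub_cancel_left, norm_mul, ← hc]
      rw [Complex.norm_real, Real.norm_of_nonneg hc0.le, mul_pow,
        mul_div_cancel_left₀ _ (by positivity)]
    simp only [e1]
    rw [lintegral_comp_affine g hgm _ hc0, ← mul_assoc, ← ENNReal.ofReal_mul (by positivity),
      ← lintegral_const_mul _ hgm]
    refine lintegral_congr fun z => ?_
    simp only [hg, ← mul_assoc]
    rw [← ENNReal.ofReal_mul (by positivity)]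
    congr 2
    have hn : ‖z - ((τ * x : ℝ) : ℂ)‖ ^ 2 = ‖z‖ ^ 2 - 2 * τ * x * z.re + τ ^ 2 * x ^ 2 := by
      rw [← Complex.normSq_eq_norm_sq, ← Complex.normSq_eq_norm_sq, Complex.normSq_apply,
        Complex.normSq_apply]
      simp
      ring
    rw [hn, hc2]
    simp only [hD]
    rw [Real.rpow_sub_one hx.ne']
    have e2 : Real.exp (-x) * x ^ ν * (x * (1 - τ ^ 2))⁻¹ *
        Real.exp (-((‖z‖ ^ 2 - 2 * τ * x * z.re + τ ^ 2 * x ^ 2) / (x * (1 - τ ^ 2))))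
        = (1 - τ ^ 2)⁻¹ * (x ^ ν / x) * (Real.exp (-x) *
        Real.exp (-((‖z‖ ^ 2 - 2 * τ * x * z.re + τ ^ 2 * x ^ 2) / (x * (1 - τ ^ 2))))) := by
      field_simp
    have e3 : ∀ a b c d : ℝ, a * (b * Real.exp c) * Real.exp d
        = a * b * Real.exp (c + d) := fun a b c d => by rw [Real.exp_add]; ring
    rw [e2, ← Real.exp_add, e3]
    congr 2
    field_simp
    ring
  -- The Bessel representation needs `|z| > 0`; the origin is a null set.
  have outer : ∀ z : ℂ, z ≠ 0 →
      ENNReal.ofReal (1 / (2 * Real.pi * (1 - τ ^ 2) * Real.Gamma (ν + 2))) *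
        ∫⁻ x in Set.Ioi (0 : ℝ), ENNReal.ofReal (D x z)
      = ENNReal.ofReal
        (chiralEllipticWeight ν τ z / (Real.pi * (1 - τ ^ 2) ^ 2 * Real.Gamma (ν + 2))) := by
    intro z hz
    have hz' : 0 < ‖z‖ := norm_pos_iff.mpr hz
    have hint : IntegrableOn (fun x => D x z) (Set.Ioi 0) :=
      ((integrableOn_besselK_integrand hν (inv_pos.mpr hδ)
        (c := (1 - τ ^ 2)⁻¹ * ‖z‖ ^ 2) (by positivity)).const_mul _).mul_const _
    rw [← ofReal_integral_eq_lintegral_ofReal hint, ← ENNReal.ofReal_mul hC]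
    · congr 1
      simp only [hD]
      rw [integral_mul_const, integral_const_mul, chiralEllipticWeight]
      have h := rpow_mul_besselK ν (inv_pos.mpr hδ) hz'
      rw [← div_eq_mul_inv] at h
      rw [h]
      field_simp
    · filter_upwards [ae_restrict_mem measurableSet_Ioi] with x hx
      have hx : (0 : ℝ) < x := hx
      simp only [hD, Pi.zero_apply]
      positivity
  have hF : Measurable fun p : ℝ × ℂ => f (mixtureMap τ p) := hf.comp (measurable_mixtureMap τ)
  rw [lintegral_smul_measure, lintegral_map hf (measurable_mixtureMap τ),
    lintegral_prod _ hF.aemeasurable, gammaWeight,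
    lintegral_withDensity_eq_lintegral_mul _ (measurable_gammaWeight_density ν)
      (Measurable.lintegral_prod_right' hF)]
  simp only [Pi.mul_apply]
  rw [setLIntegral_congr_fun measurableSet_Ioi inner, lintegral_lintegral_swap
    ((ENNReal.measurable_ofReal.comp hDm).mul (hf.comp measurable_snd)).aemeasurable,
    smul_eq_mul, ← lintegral_const_mul]
  · rw [chiralEllipticMeasure, lintegral_withDensity_eq_lintegral_mul _ (by fun_prop) hf]
    refine lintegral_congr_ae ?_
    filter_upwards [compl_mem_ae_iff.mpr (measure_singleton (0 : ℂ))] with z hz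
    have hm : Measurable fun x => ENNReal.ofReal (D x z) :=
      ENNReal.measurable_ofReal.comp (hDm.comp (measurable_id.prodMk measurable_const))
    rw [lintegral_mul_const _ hm, ← mul_assoc, outer z hz]
    rfl
  · exact Measurable.lintegral_prod_left'
      ((ENNReal.measurable_ofReal.comp hDm).mul (hf.comp measurable_snd))

end Mixture

/-! ### Gaussian moments. -/

/-- The bilinear form `∫ f(z) g(z̄) dμ(z)` on polynomials. -/
noncomputable def polyForm (μ : Measure ℂ) (f g : Polynomial ℂ) : ℂ :=
  ∫ z : ℂ, f.eval z * g.eval (starRingEnd ℂ z) ∂μ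

section GaussWeight

lemma integrable_gaussWeight_iff {f : ℂ → ℂ} :
    Integrable f gaussWeight ↔ Integrable fun w => (Real.exp (-‖w‖ ^ 2)) • f w := by
  rw [gaussWeight, integrable_withDensity_iff_integrable_smul' measurable_gaussWeight_density
    (Eventually.of_forall fun _ => ENNReal.ofReal_lt_top)]
  simp only [ENNReal.toReal_ofReal (Real.exp_pos _).le]

lemma integral_gaussWeight (f : ℂ → ℂ) :
    ∫ w, f w ∂gaussWeight = ∫ w, (Real.exp (-‖w‖ ^ 2)) • f w := by
  rw [gaussWeight, integral_withDensity_eq_integral_toReal_smul measurable_gaussWeight_density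
    (Eventually.of_forall fun _ => ENNReal.ofReal_lt_top)]
  simp only [ENNReal.toReal_ofReal (Real.exp_pos _).le]

lemma integral_norm_pow_mul_exp (n : ℕ) :
    ∫ w : ℂ, ‖w‖ ^ n * Real.exp (-‖w‖ ^ 2) = Real.pi * Real.Gamma ((n + 2) / 2) := by
  have := Complex.integral_rpow_mul_exp_neg_rpow (p := 2) (q := n) (by norm_num)
    (by have : (0 : ℝ) ≤ n := n.cast_nonneg
        linarith)
  simp only [Real.rpow_natCast, Real.rpow_two] at this
  rw [this]
  ring

lemma integrable_norm_pow_mul_exp (n : ℕ) :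
    Integrable fun w : ℂ => ‖w‖ ^ n * Real.exp (-‖w‖ ^ 2) := by
  apply Integrable.of_integral_ne_zero
  rw [integral_norm_pow_mul_exp]
  have : 0 < Real.Gamma (((n : ℝ) + 2) / 2) := Real.Gamma_pos_of_pos (by positivity)
  positivity

lemma integrable_pow_mul_conj_pow_gaussWeight (i j : ℕ) :
    Integrable (fun w : ℂ => w ^ i * (starRingEnd ℂ w) ^ j) gaussWeight := by
  rw [integrable_gaussWeight_iff]
  refine (integrable_norm_pow_mul_exp (i + j)).mono' (by fun_prop) (Eventually.of_forall fun w => ?_)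
  rw [norm_smul, norm_mul, norm_pow, norm_pow, RCLike.norm_conj, Real.norm_of_nonneg
    (Real.exp_pos _).le, pow_add, mul_comm]

lemma integral_pow_mul_conj_pow_gaussWeight (i j : ℕ) :
    ∫ w : ℂ, w ^ i * (starRingEnd ℂ w) ^ j ∂gaussWeight
      = if i = j then (Real.pi : ℂ) * (i ! : ℂ) else 0 := by
  rw [integral_gaussWeight]
  split_ifs with h
  · subst h
    have h1 : ∀ w : ℂ, Real.exp (-‖w‖ ^ 2) • (w ^ i * (starRingEnd ℂ w) ^ i)
        = ((‖w‖ ^ (2 * i) * Real.exp (-‖w‖ ^ 2) : ℝ) : ℂ) := by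
      intro w
      rw [← mul_pow, Complex.mul_conj, Complex.normSq_eq_norm_sq, Complex.real_smul]
      push_cast
      rw [← pow_mul, mul_comm]
    simp only [h1]
    rw [integral_complex_ofReal, integral_norm_pow_mul_exp]
    rw [show (((2 * i : ℕ) : ℝ) + 2) / 2 = i + 1 by push_cast; ring, Real.Gamma_nat_eq_factorial]
    push_cast
    rfl
  · set F : ℂ → ℂ := fun w => Real.exp (-‖w‖ ^ 2) • (w ^ i * (starRingEnd ℂ w) ^ j) with hF
    have key : ∀ c : Circle, ∫ w, F w = (c : ℂ) ^ i * (starRingEnd ℂ (c : ℂ)) ^ j * ∫ w, F w := by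
      intro c
      have h1 := (rotation c).measurePreserving.integral_comp
        (rotation c).toHomeomorph.measurableEmbedding F
      rw [← integral_const_mul]
      refine h1.symm.trans (integral_congr_ae (Eventually.of_forall fun w => ?_))
      simp only [hF, rotation_apply, norm_mul, Circle.norm_coe, one_mul, map_mul, mul_pow,
        Complex.real_smul]
      ring
    have hij : (i : ℝ) - j ≠ 0 := sub_ne_zero.mpr (by exact_mod_cast h)
    -- Rotation by `θ` multiplies the integral by `e^{iθ(i-j)}`; this angle makes the phase `-1`,
    -- which forces the integral to vanish.
    have h2 := key (Circle.exp (Real.pi / (i - j)))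
    have h3 : ((Circle.exp (Real.pi / (i - j)) : Circle) : ℂ) ^ i *
        (starRingEnd ℂ (Circle.exp (Real.pi / (i - j)) : ℂ)) ^ j = -1 := by
      rw [Circle.coe_exp, ← Complex.exp_conj, ← Complex.exp_nat_mul, ← Complex.exp_nat_mul,
        ← Complex.exp_add, ← Complex.exp_pi_mul_I]
      have hij' : (i : ℂ) - j ≠ 0 := by exact_mod_cast hij
      congr 1
      simp only [map_mul, Complex.conj_ofReal, Complex.conj_I]
      push_cast
      field_simp
      ring
    rw [h3] at h2
    linear_combination h2 / 2

end GaussWeight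

/-! ### Planar orthogonality of the rescaled Laguerre polynomials. -/

section PolyForm

variable {ν τ : ℝ}

lemma eval_add_eq_sum_hasseDeriv (f : Polynomial ℂ) {N : ℕ} (hN : f.natDegree < N) (a b : ℂ) :
    f.eval (a + b)
      = ∑ i ∈ Finset.range N, (Polynomial.hasseDeriv i f).eval a * b ^ i := by
  rw [add_comm, ← Polynomial.taylor_eval,
    Polynomial.eval_eq_sum_range' (n := N) (by rwa [Polynomial.natDegree_taylor])]
  simp only [Polynomial.taylor_coeff]

/-- Off-diagonal Taylor terms can carry half-integer powers of `x`. The Gaussian kills them, but the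
sum can be integrated term by term only if they are integrable. -/
lemma integrable_eval_mul_sqrt_pow (hν : -1 < ν) (τ : ℝ) (h : Polynomial ℂ) (m : ℕ) :
    Integrable (fun x : ℝ => h.eval ((τ * x : ℝ) : ℂ) *
      ((Real.sqrt (x * (1 - τ ^ 2)) : ℝ) : ℂ) ^ m) (gammaWeight ν) := by
  have h1 : ∀ k : ℕ, Integrable (fun x : ℝ => (x : ℂ) ^ k *
      ((Real.sqrt (x * (1 - τ ^ 2)) : ℝ) : ℂ) ^ m) (gammaWeight ν) := by
    intro k
    have := ((integrable_rpow_gammaWeight hν (s := k + m / 2) (by positivity)).ofReal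
      (𝕜 := ℂ)).mul_const ((Real.sqrt (1 - τ ^ 2) : ℂ) ^ m)
    rw [integrable_gammaWeight_iff] at this ⊢
    refine this.congr_fun (fun x hx => ?_) measurableSet_Ioi
    have hx : (0 : ℝ) < x := hx
    simp only
    congr 1
    rw [Real.sqrt_mul hx.le, Complex.ofReal_mul, mul_pow, ← mul_assoc]
    congr 1
    have : x ^ ((k : ℝ) + m / 2) = x ^ k * (Real.sqrt x) ^ m := by
      rw [Real.rpow_add hx, Real.rpow_natCast, Real.sqrt_eq_rpow, ← Real.rpow_natCast (x ^ (1 / 2 : ℝ)),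
        ← Real.rpow_mul hx.le]
      congr 2; ring
    simp only [this]
    push_cast
    rfl
  simp only [Polynomial.eval_eq_sum_range, Finset.sum_mul]
  refine integrable_finsetSum _ fun k _ => ?_
  have := (h1 k).const_mul (h.coeff k * τ ^ k)
  refine this.congr (Eventually.of_forall fun x => ?_)
  simp only
  push_cast
  ring

lemma integrable_term_mixture (hν : -1 < ν) (τ : ℝ) (f g : Polynomial ℂ) (i j : ℕ) :
    Integrable (fun p : ℝ × ℂ => (f.eval ((τ * p.1 : ℝ) : ℂ) * g.eval ((τ * p.1 : ℝ) : ℂ) *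
        ((Real.sqrt (p.1 * (1 - τ ^ 2)) : ℝ) : ℂ) ^ (i + j)) *
        (p.2 ^ i * (starRingEnd ℂ p.2) ^ j)) ((gammaWeight ν).prod gaussWeight) := by
  have h1 := integrable_eval_mul_sqrt_pow hν τ (f * g) (i + j)
  simp only [Polynomial.eval_mul] at h1
  exact h1.mul_prod (integrable_pow_mul_conj_pow_gaussWeight i j)

lemma mixture_expand (f g : Polynomial ℂ) {N : ℕ} (hf : f.natDegree < N) (hg : g.natDegree < N)
    (p : ℝ × ℂ) :
    f.eval (mixtureMap τ p) * g.eval (starRingEnd ℂ (mixtureMap τ p))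
      = ∑ i ∈ Finset.range N, ∑ j ∈ Finset.range N,
        ((Polynomial.hasseDeriv i f).eval ((τ * p.1 : ℝ) : ℂ) *
          (Polynomial.hasseDeriv j g).eval ((τ * p.1 : ℝ) : ℂ) *
          ((Real.sqrt (p.1 * (1 - τ ^ 2)) : ℝ) : ℂ) ^ (i + j)) *
          (p.2 ^ i * (starRingEnd ℂ p.2) ^ j) := by
  unfold mixtureMap
  rw [map_add, map_mul, Complex.conj_ofReal, Complex.conj_ofReal,
    eval_add_eq_sum_hasseDeriv f hf, eval_add_eq_sum_hasseDeriv g hg, Finset.sum_mul_sum]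
  refine Finset.sum_congr rfl fun i _ => Finset.sum_congr rfl fun j _ => ?_
  rw [mul_pow, mul_pow, pow_add]
  ring

lemma integrable_polyForm (hν : -1 < ν) (hτ0 : 0 < τ) (hτ1 : τ < 1) (f g : Polynomial ℂ) :
    Integrable (fun z : ℂ => f.eval z * g.eval (starRingEnd ℂ z)) (chiralEllipticMeasure ν τ) := by
  rw [chiralEllipticMeasure_eq_map hν hτ0 hτ1]
  refine Integrable.smul_measure ?_ ENNReal.ofReal_ne_top
  have hm : AEStronglyMeasurable (fun z : ℂ => f.eval z * g.eval (starRingEnd ℂ z))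
      (((gammaWeight ν).prod gaussWeight).map (mixtureMap τ)) :=
    (by fun_prop : Continuous fun z : ℂ => f.eval z * g.eval (starRingEnd ℂ z)).aestronglyMeasurable
  rw [integrable_map_measure hm (measurable_mixtureMap τ).aemeasurable]
  have e := fun p => mixture_expand (τ := τ) f g (N := f.natDegree + g.natDegree + 1) (by omega) (by omega) p
  simp only [Function.comp_def, e]
  exact integrable_finsetSum _ fun i _ => integrable_finsetSum _ fun j _ =>
    integrable_term_mixture hν τ _ _ i j

/-- Only the diagonal Gaussian moments survive. Each leaves `(x(1-τ²))^i`, and the power `x^i` turns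
the gamma weight of parameter `ν` into that of parameter `ν + i`. -/
lemma polyForm_eq (hν : -1 < ν) (hτ0 : 0 < τ) (hτ1 : τ < 1) (f g : Polynomial ℂ) {N : ℕ}
    (hf : f.natDegree < N) (hg : g.natDegree < N) :
    polyForm (chiralEllipticMeasure ν τ) f g
      = ((1 / (2 * (1 - τ ^ 2) * Real.Gamma (ν + 2)) : ℝ) : ℂ) *
        ∑ i ∈ Finset.range N, ((i ! : ℂ) * (1 - τ ^ 2) ^ i) *
          ∫ x : ℝ, (Polynomial.hasseDeriv i f).eval (τ * x : ℂ) *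
            (Polynomial.hasseDeriv i g).eval (τ * x : ℂ) ∂gammaWeight (ν + i) := by
  have hδ : 0 < 1 - τ ^ 2 := by nlinarith
  have hG : 0 < Real.Gamma (ν + 2) := Real.Gamma_pos_of_pos (by linarith)
  rw [polyForm, chiralEllipticMeasure_eq_map hν hτ0 hτ1, integral_smul_measure]
  have hm : AEStronglyMeasurable (fun z : ℂ => f.eval z * g.eval (starRingEnd ℂ z))
      (((gammaWeight ν).prod gaussWeight).map (mixtureMap τ)) :=
    (by fun_prop : Continuous fun z : ℂ => f.eval z * g.eval (starRingEnd ℂ z)).aestronglyMeasurable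
  rw [integral_map (measurable_mixtureMap τ).aemeasurable hm]
  simp only [mixture_expand (τ := τ) f g hf hg]
  rw [integral_finsetSum _ fun i _ => integrable_finsetSum _ fun j _ =>
    integrable_term_mixture hν τ _ _ i j]
  rw [ENNReal.toReal_ofReal (by positivity), Complex.real_smul, Finset.mul_sum, Finset.mul_sum]
  refine Finset.sum_congr rfl fun i hi => ?_
  rw [integral_finsetSum _ fun j _ => integrable_term_mixture hν τ _ _ i j]
  have hj : ∀ j ∈ Finset.range N, ∫ p : ℝ × ℂ,
      ((Polynomial.hasseDeriv i f).eval ((τ * p.1 : ℝ) : ℂ) *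
          (Polynomial.hasseDeriv j g).eval ((τ * p.1 : ℝ) : ℂ) *
          ((Real.sqrt (p.1 * (1 - τ ^ 2)) : ℝ) : ℂ) ^ (i + j)) *
          (p.2 ^ i * (starRingEnd ℂ p.2) ^ j) ∂((gammaWeight ν).prod gaussWeight)
      = if i = j then (Real.pi : ℂ) * (((i ! : ℂ) * (1 - τ ^ 2) ^ i) *
          ∫ x : ℝ, (Polynomial.hasseDeriv i f).eval (τ * x : ℂ) *
            (Polynomial.hasseDeriv i g).eval (τ * x : ℂ) ∂gammaWeight (ν + i)) else 0 := by
    intro j _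
    rw [integral_prod_mul (fun x : ℝ => (Polynomial.hasseDeriv i f).eval ((τ * x : ℝ) : ℂ) *
          (Polynomial.hasseDeriv j g).eval ((τ * x : ℝ) : ℂ) *
          ((Real.sqrt (x * (1 - τ ^ 2)) : ℝ) : ℂ) ^ (i + j))
          (fun w : ℂ => w ^ i * (starRingEnd ℂ w) ^ j), integral_pow_mul_conj_pow_gaussWeight]
    split_ifs with h
    · subst h
      rw [← integral_pow_mul_gammaWeight i, ← integral_const_mul]
      rw [mul_comm, ← integral_const_mul, ← integral_const_mul]
      rw [integral_gammaWeight, integral_gammaWeight]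
      refine setIntegral_congr_fun measurableSet_Ioi fun x hx => ?_
      have hx : (0 : ℝ) < x := hx
      have hs : ((Real.sqrt (x * (1 - τ ^ 2)) : ℝ) : ℂ) ^ (i + i) = (x * (1 - τ ^ 2)) ^ i := by
        rw [← two_mul, pow_mul, ← Complex.ofReal_pow, Real.sq_sqrt (by positivity)]
        push_cast; rfl
      simp only [hs, mul_pow]
      push_cast
      congr 1
      ring
    · rw [mul_zero]
  rw [Finset.sum_congr rfl hj, Finset.sum_ite_eq, if_pos hi]
  have hpi : (Real.pi : ℂ) ≠ 0 := by exact_mod_cast Real.pi_ne_zero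
  have hG' : (Real.Gamma (ν + 2) : ℂ) ≠ 0 := by exact_mod_cast hG.ne'
  have hδ' : (1 : ℂ) - τ ^ 2 ≠ 0 := by exact_mod_cast hδ.ne'
  push_cast
  field_simp

/-- The `i`-th derivatives are Laguerre polynomials of parameter `ν + i`, orthogonal for exactly the
weight that appears. On the diagonal the dependence on `i` is binomial: `∑ C(n,i) (1-τ²)^i
τ^(2(n-i)) = 1`. -/
lemma polyForm_monicLaguerre (hν : -1 < ν) (hτ0 : 0 < τ) (hτ1 : τ < 1) (m n : ℕ) :
    polyForm (chiralEllipticMeasure ν τ) (monicLaguerre ν τ m) (monicLaguerre ν τ n)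
      = if m = n then (((n ! : ℝ) * Real.Gamma (n + ν + 1)
          / (2 * (1 - τ ^ 2) * Real.Gamma (ν + 2)) : ℝ) : ℂ) else 0 := by
  have hdeg : ∀ k, (monicLaguerre ν τ k).natDegree = k := fun k =>
    Polynomial.natDegree_eq_of_degree_eq_some (monicLaguerre_degree hν τ k)
  rw [polyForm_eq hν hτ0 hτ1 _ _ (N := m + n + 1) (by rw [hdeg]; omega) (by rw [hdeg]; omega)]
  have hterm : ∀ i ∈ Finset.range (m + n + 1), ((i ! : ℂ) * (1 - τ ^ 2) ^ i) *
          ∫ x : ℝ, (Polynomial.hasseDeriv i (monicLaguerre ν τ m)).eval (τ * x : ℂ) *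
            (Polynomial.hasseDeriv i (monicLaguerre ν τ n)).eval (τ * x : ℂ) ∂gammaWeight (ν + i)
      = if m = n then ((n ! : ℂ) * (Real.Gamma (n + ν + 1) : ℂ)) *
          ((1 - τ ^ 2 : ℂ) ^ i * ((τ : ℂ) ^ 2) ^ (n - i) * (n.choose i : ℂ)) else 0 := by
    intro i _
    rcases Nat.lt_or_ge m i with hm | hm
    · rw [hasseDeriv_monicLaguerre_of_lt hν τ hm]
      simp only [Polynomial.eval_zero, zero_mul, integral_zero, mul_zero]
      split_ifs with h
      · rw [Nat.choose_eq_zero_of_lt (h ▸ hm)]; simp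
      · rfl
    rcases Nat.lt_or_ge n i with hn | hn
    · rw [hasseDeriv_monicLaguerre_of_lt hν τ hn]
      simp only [Polynomial.eval_zero, mul_zero, integral_zero]
      split_ifs with h
      · rw [Nat.choose_eq_zero_of_lt hn]; simp
      · rfl
    have hνi : -1 < ν + i := by have : (0 : ℝ) ≤ i := i.cast_nonneg
                                linarith
    rw [hasseDeriv_monicLaguerre τ hm, hasseDeriv_monicLaguerre τ hn]
    simp only [Polynomial.eval_mul, Polynomial.eval_C, eval_mul_monicLaguerre]
    have e : ∀ x : ℝ, (m.choose i : ℂ) * ((τ : ℂ) ^ (m - i) * (monicLaguerre (ν + i) 1 (m - i)).eval (x : ℂ)) *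
        ((n.choose i : ℂ) * ((τ : ℂ) ^ (n - i) * (monicLaguerre (ν + i) 1 (n - i)).eval (x : ℂ)))
        = ((m.choose i : ℂ) * (n.choose i : ℂ) * (τ : ℂ) ^ (m - i) * (τ : ℂ) ^ (n - i)) *
          ((monicLaguerre (ν + i) 1 (m - i)).eval (x : ℂ) * (monicLaguerre (ν + i) 1 (n - i)).eval (x : ℂ)) := by
      intro x; ring
    simp only [e]
    rw [integral_const_mul, integral_monicLaguerre_mul hνi]
    by_cases h : m = n
    · subst h
      simp only [if_true]
      rw [show ((m - i : ℕ) : ℝ) + (ν + i) + 1 = m + ν + 1 by rw [Nat.cast_sub hm]; ring]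
      have hc : (m ! : ℂ) = (m.choose i : ℂ) * (i ! : ℂ) * ((m - i)! : ℂ) := by
        exact_mod_cast (Nat.choose_mul_factorial_mul_factorial hm).symm
      rw [hc]
      push_cast
      ring
    · have h' : m - i ≠ n - i := by omega
      simp [h, h']
  rw [Finset.sum_congr rfl hterm]
  by_cases h : m = n
  · subst h
    simp only [if_true]
    rw [← Finset.mul_sum]
    have hs : ∑ i ∈ Finset.range (m + m + 1),
        ((1 - τ ^ 2 : ℂ) ^ i * ((τ : ℂ) ^ 2) ^ (m - i) * (m.choose i : ℂ)) = 1 := by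
      have h1 := add_pow (1 - τ ^ 2 : ℂ) ((τ : ℂ) ^ 2) m
      rw [sub_add_cancel, one_pow] at h1
      have hsub : Finset.range (m + 1) ⊆ Finset.range (m + m + 1) :=
        Finset.range_subset_range.mpr (by omega)
      refine (Finset.sum_subset hsub fun i _ hi => ?_).symm.trans h1.symm
      rw [Nat.choose_eq_zero_of_lt (by simpa using hi)]
      simp
    rw [hs]
    push_cast
    ring
  · simp [h]

/-- The expression in `polyForm_eq` is visibly symmetric, as the conjugation symmetry of the measure
predicts. -/
lemma polyForm_comm (hν : -1 < ν) (hτ0 : 0 < τ) (hτ1 : τ < 1) (f g : Polynomial ℂ) :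
    polyForm (chiralEllipticMeasure ν τ) f g = polyForm (chiralEllipticMeasure ν τ) g f := by
  have hN : f.natDegree < f.natDegree + g.natDegree + 1 := by omega
  have hN' : g.natDegree < f.natDegree + g.natDegree + 1 := by omega
  rw [polyForm_eq hν hτ0 hτ1 f g hN hN', polyForm_eq hν hτ0 hτ1 g f hN' hN]
  simp only [mul_comm]

/-- The factor `z - z̄` splits the integrand into four products, equal in pairs by `polyForm_comm`.
The skew form thus measures how far multiplication by `X` is from being symmetric. -/
lemma skewProduct_eq (hν : -1 < ν) (hτ0 : 0 < τ) (hτ1 : τ < 1) (f g : Polynomial ℂ) :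
    skewProduct (chiralEllipticMeasure ν τ) f g
      = 2 * (polyForm (chiralEllipticMeasure ν τ) (Polynomial.X * f) g
        - polyForm (chiralEllipticMeasure ν τ) f (Polynomial.X * g)) := by
  have hi := integrable_polyForm hν hτ0 hτ1
  have e : ∀ z : ℂ, (f.eval z * g.eval (starRingEnd ℂ z) - g.eval z * f.eval (starRingEnd ℂ z))
      * (z - starRingEnd ℂ z)
      = ((Polynomial.X * f).eval z * g.eval (starRingEnd ℂ z)
          - f.eval z * (Polynomial.X * g).eval (starRingEnd ℂ z))
        + (g.eval z * (Polynomial.X * f).eval (starRingEnd ℂ z)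
          - (Polynomial.X * g).eval z * f.eval (starRingEnd ℂ z)) := by
    intro z
    simp only [Polynomial.eval_mul, Polynomial.eval_X]
    ring
  unfold skewProduct
  simp only [e]
  have h1 : ∀ a b c d : Polynomial ℂ, Integrable (fun z : ℂ =>
      a.eval z * b.eval (starRingEnd ℂ z) - c.eval z * d.eval (starRingEnd ℂ z))
      (chiralEllipticMeasure ν τ) := fun a b c d => (hi a b).sub (hi c d)
  rw [integral_add (h1 _ _ _ _) (h1 _ _ _ _), integral_sub (hi _ _) (hi _ _),
    integral_sub (hi _ _) (hi _ _)]
  change (polyForm _ _ _ - polyForm _ _ _) + (polyForm _ _ _ - polyForm _ _ _) = _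
  rw [polyForm_comm hν hτ0 hτ1 g, polyForm_comm hν hτ0 hτ1 _ f]
  ring

end PolyForm

/-! ### Independence of the pre-kernel from the chosen family. -/

section Uniqueness

open Polynomial in
lemma mem_span_of_degree_lt {q : ℕ → ℂ[X]} (hq : ∀ n : ℕ, (q n).degree = (n : WithBot ℕ)) (M : ℕ) :
    ∀ f : ℂ[X], f.degree < (M : WithBot ℕ) → f ∈ Submodule.span ℂ (q '' Set.Iio M) := by
  induction M with
  | zero =>
    intro f hf
    have : f = 0 := by
      rw [← Polynomial.degree_eq_bot]
      simpa using hf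
    rw [this]; exact Submodule.zero_mem _
  | succ M ih =>
    intro f hf
    have hlead : (q M).coeff M ≠ 0 := by
      have := Polynomial.coeff_ne_zero_of_eq_degree (hq M)
      exact this
    set c := f.coeff M / (q M).coeff M with hc
    have h1 : (f - c • q M).degree < (M : WithBot ℕ) := by
      rw [Polynomial.degree_lt_iff_coeff_zero] at hf ⊢
      intro k hk
      rcases hk.lt_or_eq with h | h
      · have h2 : (q M).coeff k = 0 :=
          Polynomial.coeff_eq_zero_of_degree_lt (by rw [hq]; exact_mod_cast h)
        rw [Polynomial.coeff_sub, Polynomial.coeff_smul, h2, hf k (by omega)]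
        simp
      · subst h
        rw [Polynomial.coeff_sub, Polynomial.coeff_smul, smul_eq_mul, hc, div_mul_cancel₀ _ hlead,
          sub_self]
    have h2 : f = (f - c • q M) + c • q M := by ring
    rw [h2]
    refine Submodule.add_mem _ (Submodule.span_mono ?_ (ih _ h1))
      (Submodule.smul_mem _ _ (Submodule.subset_span ⟨M, by simp, rfl⟩))
    exact Set.image_mono (Set.Iio_subset_Iio (Nat.le_succ M))

/-- The pre-kernel as a polynomial in its first variable. -/
noncomputable def preKernelPoly (q : ℕ → Polynomial ℂ) (r : ℕ → ℝ) (N : ℕ) (u : ℂ) :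
    Polynomial ℂ :=
  ∑ k ∈ Finset.range N, (((q (2 * k)).eval u / (r k : ℂ)) • q (2 * k + 1)
    - ((q (2 * k + 1)).eval u / (r k : ℂ)) • q (2 * k))

variable {q q' : ℕ → Polynomial ℂ} {r r' : ℕ → ℝ}

lemma eval_preKernelPoly (N : ℕ) (z u : ℂ) :
    (preKernelPoly q r N u).eval z = preKernel q r N z u := by
  rw [preKernelPoly, preKernel, Polynomial.eval_finsetSum]
  refine Finset.sum_congr rfl fun k _ => ?_
  simp only [Polynomial.eval_sub, Polynomial.eval_smul, smul_eq_mul]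
  ring

lemma preKernel_swap (N : ℕ) (z u : ℂ) : preKernel q r N z u = -preKernel q r N u z := by
  rw [preKernel, preKernel, ← Finset.sum_neg_distrib]
  refine Finset.sum_congr rfl fun k _ => ?_
  ring

lemma preKernelPoly_degree_lt (hq : ∀ n : ℕ, (q n).degree = (n : WithBot ℕ)) (N : ℕ) (u : ℂ) :
    (preKernelPoly q r N u).degree < ((2 * N : ℕ) : WithBot ℕ) := by
  rw [← Polynomial.mem_degreeLT]
  refine Submodule.sum_mem _ fun k hk => ?_
  have hk := Finset.mem_range.mp hk
  refine Submodule.sub_mem _ (Submodule.smul_mem _ _ ?_) (Submodule.smul_mem _ _ ?_)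
  · rw [Polynomial.mem_degreeLT, hq]
    exact_mod_cast (show 2 * k + 1 < 2 * N by omega)
  · rw [Polynomial.mem_degreeLT, hq]
    exact_mod_cast (show 2 * k < 2 * N by omega)

/-- Pairing with `q_i` selects the one summand that contains its partner and returns `q_i(u)`; the
`q_i` with `i < 2N` span the polynomials of degree below `2N`. -/
lemma skew_reproducing {μ : Measure ℂ}
    (ω : Polynomial ℂ →ₗ[ℂ] Polynomial ℂ →ₗ[ℂ] ℂ) (hω : ∀ f g, ω f g = skewProduct μ f g)
    (hq : IsSkewOrthogonalFamily μ q r) (N : ℕ) (u : ℂ) {f : Polynomial ℂ}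
    (hf : f.degree < ((2 * N : ℕ) : WithBot ℕ)) :
    ω f (preKernelPoly q r N u) = f.eval u := by
  have hr : ∀ k, (r k : ℂ) ≠ 0 := fun k => by exact_mod_cast (hq.norm_pos k).ne'
  refine Submodule.span_induction (p := fun f _ => ω f (preKernelPoly q r N u) = f.eval u)
    ?_ ?_ ?_ ?_ (mem_span_of_degree_lt hq.degree_eq (2 * N) f hf)
  · rintro _ ⟨i, hi, rfl⟩
    have hi : i < 2 * N := hi
    rw [preKernelPoly, map_sum]
    simp only [map_sub, map_smul, smul_eq_mul]
    simp only [hω]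
    rcases Nat.even_or_odd' i with ⟨j, rfl | rfl⟩
    · simp only [hq.even_odd, hq.even_even, mul_zero, sub_zero, mul_ite]
      rw [Finset.sum_ite_eq, if_pos (Finset.mem_range.mpr (by omega)), div_mul_cancel₀ _ (hr j)]
    · simp only [hq.odd_even, hq.odd_odd, mul_zero, zero_sub, mul_neg, neg_neg, mul_ite]
      rw [Finset.sum_ite_eq', if_pos (Finset.mem_range.mpr (by omega)), div_mul_cancel₀ _ (hr j)]
  · simp
  · intro f g _ _ h1 h2
    simp [h1, h2]
  · intro c f _ h
    simp [h]

/-- Two reproducing kernels, paired with each other, can be evaluated by either reproducing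
property; antisymmetry of `ω` and of the kernels then identifies them. -/
lemma preKernel_unique {μ : Measure ℂ}
    (ω : Polynomial ℂ →ₗ[ℂ] Polynomial ℂ →ₗ[ℂ] ℂ) (hω : ∀ f g, ω f g = skewProduct μ f g)
    (hanti : ∀ f g, ω f g = -ω g f)
    (hq : IsSkewOrthogonalFamily μ q r) (hq' : IsSkewOrthogonalFamily μ q' r')
    (N : ℕ) (z u : ℂ) :
    preKernel q r N z u = preKernel q' r' N z u := by
  have h1 := skew_reproducing ω hω hq N z (preKernelPoly_degree_lt (r := r') hq'.degree_eq N u)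
  have h2 := skew_reproducing ω hω hq' N u (preKernelPoly_degree_lt (r := r) hq.degree_eq N z)
  rw [hanti, h2, eval_preKernelPoly, eval_preKernelPoly] at h1
  rw [← h1, preKernel_swap]

end Uniqueness

/-! ### A monic skew-orthogonal family. -/

section SkewForm

variable {ν τ : ℝ}

lemma polyForm_add_left (hν : -1 < ν) (hτ0 : 0 < τ) (hτ1 : τ < 1) (f g h : Polynomial ℂ) :
    polyForm (chiralEllipticMeasure ν τ) (f + g) h
      = polyForm (chiralEllipticMeasure ν τ) f h + polyForm (chiralEllipticMeasure ν τ) g h := by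
  have hi := integrable_polyForm hν hτ0 hτ1
  simp only [polyForm, Polynomial.eval_add, add_mul]
  exact integral_add (hi f h) (hi g h)

lemma polyForm_smul_left (μ : Measure ℂ) (c : ℂ) (f h : Polynomial ℂ) :
    polyForm μ (c • f) h = c * polyForm μ f h := by
  simp only [polyForm, Polynomial.eval_smul, smul_eq_mul, mul_assoc]
  exact integral_const_mul _ _

/-- The form `∫ f(z) g(z̄) dμ(z)` as a bilinear map. -/
noncomputable def polyBilin (hν : -1 < ν) (hτ0 : 0 < τ) (hτ1 : τ < 1) :
    Polynomial ℂ →ₗ[ℂ] Polynomial ℂ →ₗ[ℂ] ℂ :=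
  LinearMap.mk₂ ℂ (polyForm (chiralEllipticMeasure ν τ))
    (polyForm_add_left hν hτ0 hτ1) (polyForm_smul_left _)
    (fun f g h => by
      simp only [polyForm_comm hν hτ0 hτ1 f, polyForm_add_left hν hτ0 hτ1])
    (fun c f g => by
      simp only [polyForm_comm hν hτ0 hτ1 f, polyForm_smul_left, smul_eq_mul])

/-- The skew-symmetric form as a bilinear map. -/
noncomputable def skewBilin (hν : -1 < ν) (hτ0 : 0 < τ) (hτ1 : τ < 1) :
    Polynomial ℂ →ₗ[ℂ] Polynomial ℂ →ₗ[ℂ] ℂ :=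
  (2 : ℂ) • ((polyBilin hν hτ0 hτ1).compl₁₂ (LinearMap.mulLeft ℂ Polynomial.X) LinearMap.id
    - (polyBilin hν hτ0 hτ1).compl₁₂ LinearMap.id (LinearMap.mulLeft ℂ Polynomial.X))

lemma skewBilin_apply (hν : -1 < ν) (hτ0 : 0 < τ) (hτ1 : τ < 1) (f g : Polynomial ℂ) :
    skewBilin hν hτ0 hτ1 f g = skewProduct (chiralEllipticMeasure ν τ) f g := by
  rw [skewProduct_eq hν hτ0 hτ1]
  simp [skewBilin, polyBilin]

lemma skewBilin_anti (hν : -1 < ν) (hτ0 : 0 < τ) (hτ1 : τ < 1) (f g : Polynomial ℂ) :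
    skewBilin hν hτ0 hτ1 f g = -skewBilin hν hτ0 hτ1 g f := by
  rw [skewBilin_apply, skewBilin_apply, skewProduct_eq hν hτ0 hτ1, skewProduct_eq hν hτ0 hτ1,
    polyForm_comm hν hτ0 hτ1 _ g, polyForm_comm hν hτ0 hτ1 f]
  ring

/-- The skew product of two consecutive monic rescaled Laguerre polynomials. -/
noncomputable def skewNorm (ν : ℝ) (m : ℕ) : ℝ :=
  ((m + 1)! : ℝ) * Real.Gamma (m + ν + 2) / Real.Gamma (ν + 2)

lemma skewNorm_pos (hν : -1 < ν) (m : ℕ) : 0 < skewNorm ν m := by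
  have hm : (0 : ℝ) ≤ m := m.cast_nonneg
  have h1 : 0 < Real.Gamma (m + ν + 2) := Real.Gamma_pos_of_pos (by linarith)
  have h2 : 0 < Real.Gamma (ν + 2) := Real.Gamma_pos_of_pos (by linarith)
  unfold skewNorm
  positivity

lemma skewNorm_succ (hν : -1 < ν) (m : ℕ) :
    skewNorm ν (m + 1) = (m + 2) * (m + 2 + ν) * skewNorm ν m := by
  have hm : (0 : ℝ) ≤ m := m.cast_nonneg
  unfold skewNorm
  rw [show ((m + 1 : ℕ) : ℝ) + ν + 2 = (m + ν + 2) + 1 by push_cast; ring,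
    Real.Gamma_add_one (by linarith), Nat.factorial_succ (m + 1)]
  push_cast
  ring

/-- Turns the coefficient `1/(r_k a_{2k})` of the constructed family into `a_{2k+1}`, the weight
found in the Laguerre sum. -/
lemma skewCoeff_mul_skewNorm (hν : -1 < ν) (k : ℕ) :
    skewCoeff ν (2 * k + 1) * skewCoeff ν (2 * k) * skewNorm ν (2 * k) = 1 := by
  induction k with
  | zero =>
    have h2 : 0 < Real.Gamma (ν + 2) := Real.Gamma_pos_of_pos (by linarith)
    simp [skewCoeff, skewNorm, h2.ne']
  | succ k ih =>
    have h1 := skewCoeff_rec hν (2 * k)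
    have h2 := skewCoeff_rec hν (2 * k + 1)
    rw [show 2 * (k + 1) + 1 = 2 * k + 1 + 2 by ring, show 2 * (k + 1) = 2 * k + 2 by ring,
      show 2 * k + 2 = 2 * k + 1 + 1 by ring, skewNorm_succ hν, skewNorm_succ hν]
    rw [← h1, ← h2] at ih
    rw [← ih]
    push_cast
    ring

/-- At `n = 0` the truncated index `n - 1` is harmless, since its coefficient contains the factor
`n`. -/
lemma X_mul_monicLaguerre (hν : -1 < ν) (t : ℂ) (n : ℕ) :
    Polynomial.X * monicLaguerre ν t n
      = monicLaguerre ν t (n + 1) + (t * (2 * n + ν + 1)) • monicLaguerre ν t n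
        + (t ^ 2 * (n * (n + ν))) • monicLaguerre ν t (n - 1) := by
  rcases n with _ | n
  · rw [X_mul_monicLaguerre_zero hν]
    simp [Polynomial.smul_eq_C_mul]
  · rw [X_mul_monicLaguerre_succ hν, Polynomial.smul_eq_C_mul, Polynomial.smul_eq_C_mul]
    push_cast
    congr 4
    ring

lemma polyForm_X_mul_monicLaguerre (hν : -1 < ν) (hτ0 : 0 < τ) (hτ1 : τ < 1) (m n : ℕ) :
    polyForm (chiralEllipticMeasure ν τ) (Polynomial.X * monicLaguerre ν τ m) (monicLaguerre ν τ n)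
      = polyForm (chiralEllipticMeasure ν τ) (monicLaguerre ν τ (m + 1)) (monicLaguerre ν τ n)
        + τ * (2 * m + ν + 1) *
          polyForm (chiralEllipticMeasure ν τ) (monicLaguerre ν τ m) (monicLaguerre ν τ n)
        + τ ^ 2 * (m * (m + ν)) *
          polyForm (chiralEllipticMeasure ν τ) (monicLaguerre ν τ (m - 1)) (monicLaguerre ν τ n) := by
  rw [X_mul_monicLaguerre hν, polyForm_add_left hν hτ0 hτ1, polyForm_add_left hν hτ0 hτ1,
    polyForm_smul_left, polyForm_smul_left]

/-- With `h_m` the squared norm of `p_m`, the surviving terms are `h_{m+1}` and `τ²(m+1)(m+1+ν) h_m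
= τ² h_{m+1}`. Their difference carries `1 - τ²`, which cancels the one in `h_{m+1}`; hence the
value is free of `τ`. -/
lemma skewProduct_monicLaguerre_succ (hν : -1 < ν) (hτ0 : 0 < τ) (hτ1 : τ < 1) (m : ℕ) :
    skewProduct (chiralEllipticMeasure ν τ) (monicLaguerre ν τ m) (monicLaguerre ν τ (m + 1))
      = (skewNorm ν m : ℂ) := by
  have hδ : 0 < 1 - τ ^ 2 := by nlinarith
  have hG : 0 < Real.Gamma (ν + 2) := Real.Gamma_pos_of_pos (by linarith)
  rw [skewProduct_eq hν hτ0 hτ1, polyForm_comm hν hτ0 hτ1 _ (Polynomial.X * _),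
    polyForm_X_mul_monicLaguerre hν hτ0 hτ1, polyForm_X_mul_monicLaguerre hν hτ0 hτ1]
  simp only [polyForm_monicLaguerre hν hτ0 hτ1, Nat.add_sub_cancel, if_true]
  rw [if_neg (by omega), if_neg (by omega), if_neg (by omega), if_neg (by omega),
    gamma_nat_succ hν, skewNorm, Nat.factorial_succ]
  rw [show (m : ℝ) + ν + 2 = (m + ν + 1) + 1 by ring, Real.Gamma_add_one (s := m + ν + 1)
    (by have : (0 : ℝ) ≤ m := m.cast_nonneg
        linarith)]
  have hG' : (Real.Gamma (ν + 2) : ℂ) ≠ 0 := by exact_mod_cast hG.ne'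
  have hδ' : (1 : ℂ) - τ ^ 2 ≠ 0 := by exact_mod_cast hδ.ne'
  push_cast
  field_simp
  ring

lemma skewProduct_monicLaguerre_of_ne (hν : -1 < ν) (hτ0 : 0 < τ) (hτ1 : τ < 1) {m n : ℕ}
    (h1 : n ≠ m + 1) (h2 : m ≠ n + 1) :
    skewProduct (chiralEllipticMeasure ν τ) (monicLaguerre ν τ m) (monicLaguerre ν τ n) = 0 := by
  rw [skewProduct_eq hν hτ0 hτ1, polyForm_comm hν hτ0 hτ1 _ (Polynomial.X * _),
    polyForm_X_mul_monicLaguerre hν hτ0 hτ1, polyForm_X_mul_monicLaguerre hν hτ0 hτ1]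
  simp only [polyForm_monicLaguerre hν hτ0 hτ1]
  rw [if_neg h1.symm, if_neg h2.symm]
  by_cases h : m = n
  · subst h; ring
  · rw [if_neg h, if_neg (Ne.symm h)]
    have e1 : ((m : ℂ) * (m + ν)) * (if m - 1 = n then (((n ! : ℝ) * Real.Gamma (n + ν + 1)
          / (2 * (1 - τ ^ 2) * Real.Gamma (ν + 2)) : ℝ) : ℂ) else 0) = 0 := by
      rcases m with _ | m
      · simp
      · rw [if_neg (by omega), mul_zero]
    have e2 : ((n : ℂ) * (n + ν)) * (if n - 1 = m then (((m ! : ℝ) * Real.Gamma (m + ν + 1)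
          / (2 * (1 - τ ^ 2) * Real.Gamma (ν + 2)) : ℝ) : ℂ) else 0) = 0 := by
      rcases n with _ | n
      · simp
      · rw [if_neg (by omega), mul_zero]
    linear_combination 2 * τ ^ 2 * (e1 - e2)

/-- The monic skew-orthogonal polynomials. -/
noncomputable def skewFamily (ν : ℝ) (t : ℂ) (n : ℕ) : Polynomial ℂ :=
  if Even n then ∑ l ∈ Finset.range (n / 2 + 1),
    ((skewCoeff ν (2 * l) / skewCoeff ν n : ℝ) : ℂ) • monicLaguerre ν t (2 * l)
  else monicLaguerre ν t n

lemma skewFamily_even (t : ℂ) (k : ℕ) :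
    skewFamily ν t (2 * k) = ∑ l ∈ Finset.range (k + 1),
      ((skewCoeff ν (2 * l) / skewCoeff ν (2 * k) : ℝ) : ℂ) • monicLaguerre ν t (2 * l) := by
  rw [skewFamily, if_pos (even_two_mul k), Nat.mul_div_cancel_left _ two_pos]

lemma skewFamily_odd (t : ℂ) (k : ℕ) :
    skewFamily ν t (2 * k + 1) = monicLaguerre ν t (2 * k + 1) := by
  rw [skewFamily, if_neg (by simp)]

lemma skewFamily_monic_degree (hν : -1 < ν) (t : ℂ) (n : ℕ) :
    (skewFamily ν t n).Monic ∧ (skewFamily ν t n).degree = n := by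
  rcases Nat.even_or_odd' n with ⟨k, rfl | rfl⟩
  · rw [skewFamily_even, Finset.sum_range_succ, div_self (skewCoeff_pos hν _).ne',
      Complex.ofReal_one, one_smul]
    have hlt : (∑ l ∈ Finset.range k, ((skewCoeff ν (2 * l) / skewCoeff ν (2 * k) : ℝ) : ℂ) •
        monicLaguerre ν t (2 * l)).degree < (monicLaguerre ν t (2 * k)).degree := by
      rw [monicLaguerre_degree hν, ← Polynomial.mem_degreeLT]
      refine Submodule.sum_mem _ fun l hl => Submodule.smul_mem _ _ ?_
      have hl := Finset.mem_range.mp hl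
      rw [Polynomial.mem_degreeLT, monicLaguerre_degree hν]
      exact_mod_cast (show 2 * l < 2 * k by omega)
    exact ⟨(monicLaguerre_monic hν t _).add_of_right hlt,
      by rw [Polynomial.degree_add_eq_right_of_degree_lt hlt, monicLaguerre_degree hν]⟩
  · rw [skewFamily_odd]
    exact ⟨monicLaguerre_monic hν t _, monicLaguerre_degree hν t _⟩

lemma skewProduct_swap (hν : -1 < ν) (hτ0 : 0 < τ) (hτ1 : τ < 1) (f g : Polynomial ℂ) :
    skewProduct (chiralEllipticMeasure ν τ) f g
      = -skewProduct (chiralEllipticMeasure ν τ) g f := by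
  rw [← skewBilin_apply hν hτ0 hτ1, skewBilin_anti, skewBilin_apply]

/-- The polynomial `p_{2j+1}` meets only `p_{2j}` and `p_{2j+2}`, and their contributions cancel
because `a_{2j+2} N_{2j+1} = a_{2j} N_{2j}`, with `N` = `skewNorm`. For `k = j` the sum stops before
`p_{2j+2}`, and the norm remains. -/
lemma skewProduct_skewFamily_even_odd (hν : -1 < ν) (hτ0 : 0 < τ) (hτ1 : τ < 1) (k j : ℕ) :
    skewProduct (chiralEllipticMeasure ν τ) (skewFamily ν τ (2 * k)) (skewFamily ν τ (2 * j + 1))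
      = if k = j then (skewNorm ν (2 * k) : ℂ) else 0 := by
  rw [skewFamily_even, skewFamily_odd, ← skewBilin_apply hν hτ0 hτ1, map_sum,
    LinearMap.sum_apply]
  simp only [map_smul, LinearMap.smul_apply, skewBilin_apply, smul_eq_mul]
  have hterm : ∀ l : ℕ, ((skewCoeff ν (2 * l) / skewCoeff ν (2 * k) : ℝ) : ℂ) *
      skewProduct (chiralEllipticMeasure ν τ) (monicLaguerre ν τ (2 * l))
        (monicLaguerre ν τ (2 * j + 1))
      = (if l = j then ((skewCoeff ν (2 * j) * skewNorm ν (2 * j) / skewCoeff ν (2 * k) : ℝ) : ℂ)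
          else 0)
        - (if l = j + 1 then
          ((skewCoeff ν (2 * j) * skewNorm ν (2 * j) / skewCoeff ν (2 * k) : ℝ) : ℂ) else 0) := by
    intro l
    by_cases h1 : l = j
    · subst h1
      rw [skewProduct_monicLaguerre_succ hν hτ0 hτ1, if_pos rfl, if_neg (by omega)]
      push_cast
      ring
    · by_cases h2 : l = j + 1
      · subst h2
        rw [skewProduct_swap hν hτ0 hτ1, show 2 * (j + 1) = 2 * j + 1 + 1 by ring,
          skewProduct_monicLaguerre_succ hν hτ0 hτ1, if_neg h1, if_pos rfl, skewNorm_succ hν,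
          ← skewCoeff_rec hν (2 * j)]
        push_cast
        ring
      · rw [skewProduct_monicLaguerre_of_ne hν hτ0 hτ1 (by omega) (by omega), if_neg h1, if_neg h2]
        simp
  simp only [hterm]
  rw [Finset.sum_sub_distrib, Finset.sum_ite_eq', Finset.sum_ite_eq']
  simp only [Finset.mem_range]
  by_cases h : k = j
  · subst h
    rw [if_pos (by omega), if_neg (by omega), if_pos rfl, sub_zero,
      mul_div_cancel_left₀ _ (skewCoeff_pos hν _).ne']
  · rw [if_neg h]
    by_cases h' : j < k
    · rw [if_pos (by omega), if_pos (by omega), sub_self]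
    · rw [if_neg (by omega), if_neg (by omega), sub_self]

lemma isSkewOrthogonalFamily_skewFamily (hν : -1 < ν) (hτ0 : 0 < τ) (hτ1 : τ < 1) :
    IsSkewOrthogonalFamily (chiralEllipticMeasure ν τ) (skewFamily ν τ)
      (fun k => skewNorm ν (2 * k)) where
  degree_eq n := (skewFamily_monic_degree hν τ n).2
  even_even k l := by
    rw [skewFamily_even, skewFamily_even, ← skewBilin_apply hν hτ0 hτ1, map_sum]
    refine Finset.sum_eq_zero fun i _ => ?_
    rw [map_sum, LinearMap.sum_apply]
    refine Finset.sum_eq_zero fun j _ => ?_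
    rw [map_smul, map_smul, LinearMap.smul_apply, skewBilin_apply,
      skewProduct_monicLaguerre_of_ne hν hτ0 hτ1 (by omega) (by omega), smul_zero, smul_zero]
  odd_odd k l := by
    rw [skewFamily_odd, skewFamily_odd]
    exact skewProduct_monicLaguerre_of_ne hν hτ0 hτ1 (by omega) (by omega)
  even_odd := skewProduct_skewFamily_even_odd hν hτ0 hτ1
  odd_even k l := by
    rw [skewProduct_swap hν hτ0 hτ1, skewProduct_skewFamily_even_odd hν hτ0 hτ1]
  norm_pos k := skewNorm_pos hν _

lemma preKernel_skewFamily (hν : -1 < ν) (hτ0 : 0 < τ) (N : ℕ) (z u : ℂ) :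
    preKernel (skewFamily ν τ) (fun k => skewNorm ν (2 * k)) N z u
      = ∑ k ∈ Finset.range N, laguerreKernelTerm ν τ k z u := by
  refine Finset.sum_congr rfl fun k _ => ?_
  rw [laguerreKernelTerm_eq hν hτ0.ne', skewFamily_even, skewFamily_odd,
    Polynomial.eval_finsetSum, Polynomial.eval_finsetSum, Finset.mul_sum, Finset.sum_mul,
    ← Finset.sum_sub_distrib, Finset.sum_div]
  refine Finset.sum_congr rfl fun l _ => ?_
  simp only [Polynomial.eval_smul, smul_eq_mul]
  have h1 : (skewNorm ν (2 * k) : ℂ) ≠ 0 := by exact_mod_cast (skewNorm_pos hν _).ne'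
  have h2 : (skewCoeff ν (2 * k) : ℂ) ≠ 0 := by exact_mod_cast (skewCoeff_pos hν _).ne'
  have h3 : (skewCoeff ν (2 * k + 1) : ℂ) = 1 / (skewCoeff ν (2 * k) * skewNorm ν (2 * k)) := by
    rw [eq_div_iff (mul_ne_zero h2 h1), ← mul_assoc]
    exact_mod_cast skewCoeff_mul_skewNorm hν k
  push_cast
  rw [h3]
  field_simp

lemma preKernel_eq_sum (hν : -1 < ν) (hτ0 : 0 < τ) (hτ1 : τ < 1) {q : ℕ → Polynomial ℂ}
    {r : ℕ → ℝ} (hq : IsSkewOrthogonalFamily (chiralEllipticMeasure ν τ) q r) (N : ℕ) (z u : ℂ) :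
    preKernel q r N z u = ∑ k ∈ Finset.range N, laguerreKernelTerm ν τ k z u := by
  rw [← preKernel_skewFamily hν hτ0]
  exact preKernel_unique (skewBilin hν hτ0 hτ1) (skewBilin_apply hν hτ0 hτ1)
    (skewBilin_anti hν hτ0 hτ1) hq (isSkewOrthogonalFamily_skewFamily hν hτ0 hτ1) N z u

end SkewForm

/-! ### The majorant of the Laguerre expansion. -/

section Summability

variable {ν : ℝ}

/-- In two steps of `i` the left side grows by `(i+1)(i+1+ν)` and the right by the larger
`(i+2+M)(i+1+M)`; the constant covers the two initial values. -/
lemma skewCoeff_mul_factorial_mul_gamma_le (hν : -1 < ν) {M : ℕ} (hM : ν ≤ M) :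
    ∃ C : ℝ, 0 ≤ C ∧ ∀ i : ℕ,
      skewCoeff ν i * (i ! : ℝ) * Real.Gamma (i + ν + 1) ≤ C * ((i + M)! : ℝ) := by
  have g0 := gamma_nat_pos hν 0
  have g1 := gamma_nat_pos hν 1
  refine ⟨Real.Gamma ((0 : ℕ) + ν + 1) + Real.Gamma ((1 : ℕ) + ν + 1), by positivity, ?_⟩
  set C := Real.Gamma ((0 : ℕ) + ν + 1) + Real.Gamma ((1 : ℕ) + ν + 1) with hC
  have hC0 : 0 ≤ C := by positivity
  intro i
  induction i using Nat.twoStepInduction with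
  | zero =>
    have h : (1 : ℝ) ≤ ((0 + M)! : ℝ) := by exact_mod_cast Nat.factorial_pos _
    simp only [skewCoeff, Nat.factorial_zero, Nat.cast_one, one_mul]
    nlinarith
  | one =>
    have h : (1 : ℝ) ≤ ((1 + M)! : ℝ) := by exact_mod_cast Nat.factorial_pos _
    simp only [skewCoeff, Nat.factorial_one, Nat.cast_one, one_mul] at *
    nlinarith
  | more i ih _ =>
    have hi : (0 : ℝ) ≤ i := i.cast_nonneg
    have hMn : (0 : ℝ) ≤ M := M.cast_nonneg
    have e1 : skewCoeff ν (i + 2) * ((i + 2)! : ℝ) * Real.Gamma ((i + 2 : ℕ) + ν + 1)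
        = ((i + 1) * (i + 1 + ν)) * (skewCoeff ν i * (i ! : ℝ) * Real.Gamma (i + ν + 1)) := by
      rw [gamma_nat_succ hν (i + 1), gamma_nat_succ hν i, Nat.factorial_succ, Nat.factorial_succ,
        ← skewCoeff_rec hν i]
      push_cast
      ring
    have e2 : ((i + 2 + M)! : ℝ) = ((i + 2 + M) * (i + 1 + M)) * ((i + M)! : ℝ) := by
      rw [show i + 2 + M = (i + M) + 1 + 1 by ring, Nat.factorial_succ, Nat.factorial_succ]
      push_cast
      ring
    rw [e1, e2]
    have h1 : ((i : ℝ) + 1) * (i + 1 + ν) ≤ (i + 2 + M) * (i + 1 + M) := by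
      apply mul_le_mul <;> linarith
    calc ((i : ℝ) + 1) * (i + 1 + ν) * (skewCoeff ν i * (i ! : ℝ) * Real.Gamma (i + ν + 1))
        ≤ (i + 2 + M) * (i + 1 + M) * (C * ((i + M)! : ℝ)) := by
          have := skewCoeff_pos hν i
          have := gamma_nat_pos hν i
          exact mul_le_mul h1 ih (by positivity) (by positivity)
      _ = C * ((i + 2 + M) * (i + 1 + M) * ((i + M)! : ℝ)) := by ring

lemma summable_factorial_div_gamma (hν : -1 < ν) (M : ℕ) {y : ℝ} (hy : 0 ≤ y) :
    Summable fun k : ℕ => ((k + M)! : ℝ) / ((k ! : ℝ) * Real.Gamma (k + ν + 1)) * y ^ k := by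
  refine summable_of_ratio_norm_eventually_le (r := 1 / 2) (by norm_num) ?_
  -- The ratio of consecutive terms is at most `(M+1)y/(k+1+ν)`, hence at most `1/2` for `k > K`.
  obtain ⟨K, hK⟩ := exists_nat_ge (2 * y * (M + 1))
  filter_upwards [eventually_ge_atTop (K + 1)] with k hk
  have hk' : (K : ℝ) + 1 ≤ k := by exact_mod_cast hk
  have hK0 : (0 : ℝ) ≤ K := K.cast_nonneg
  have hM : (0 : ℝ) ≤ M := M.cast_nonneg
  have hg := gamma_nat_pos hν k
  have hg' : 0 < (k : ℝ) + ν + 1 := by linarith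
  rw [gamma_nat_succ hν, Real.norm_of_nonneg (by positivity), Real.norm_of_nonneg (by positivity),
    show k + 1 + M = k + M + 1 by ring, Nat.factorial_succ, Nat.factorial_succ, pow_succ]
  have h1 : (((k + M + 1 : ℕ) : ℝ) / ((k + 1 : ℕ) * (k + ν + 1))) * y ≤ 1 / 2 := by
    rw [div_mul_eq_mul_div, div_le_iff₀ (by positivity)]
    push_cast
    have h2 : 2 * y * (M + 1) ≤ k + ν + 1 := by linarith
    have h3 : ((k : ℝ) + M + 1) * y ≤ ((M + 1) * (k + 1)) * y := by
      apply mul_le_mul_of_nonneg_right _ hy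
      nlinarith
    nlinarith
  calc _ = ((((k + M + 1 : ℕ) : ℝ) / ((k + 1 : ℕ) * (k + ν + 1))) * y) *
        (((k + M)! : ℝ) / ((k ! : ℝ) * Real.Gamma (k + ν + 1)) * y ^ k) := by
        push_cast; field_simp
    _ ≤ _ := mul_le_mul_of_nonneg_right h1 (by positivity)

/-- The majorant of the coefficients of the rescaled Laguerre polynomials weighted by
`skewCoeff`. -/
noncomputable def majorant (ν ρ R : ℝ) (p : ℕ × ℕ) : ℝ :=
  skewCoeff ν p.1 * laguerreCoeff ν p.1 p.2 * ρ ^ (p.1 - p.2) * R ^ p.2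

lemma majorant_nonneg (hν : -1 < ν) {ρ R : ℝ} (hρ : 0 ≤ ρ) (hR : 0 ≤ R) (p : ℕ × ℕ) :
    0 ≤ majorant ν ρ R p := by
  have := (skewCoeff_pos hν p.1).le
  have := laguerreCoeff_nonneg hν p.1 p.2
  unfold majorant
  positivity

lemma summable_mul_choose_geometric {ρ : ℝ} (hρ : 0 ≤ ρ) (hρ1 : ρ < 1) (M : ℕ) {G : ℕ → ℝ}
    (hG : ∀ k, 0 ≤ G k) (h : Summable fun k => G k * (1 / (1 - ρ) ^ (k + M + 1))) :
    Summable fun q : ℕ × ℕ =>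
      G q.1 * (((q.2 + (q.1 + M)).choose (q.1 + M) : ℝ) * ρ ^ q.2) := by
  have hρ' : ‖ρ‖ < 1 := by rwa [Real.norm_of_nonneg hρ]
  have hs := fun k : ℕ => (hasSum_choose_mul_geometric_of_norm_lt_one (k + M) hρ').mul_left (G k)
  rw [summable_prod_of_nonneg]
  · refine ⟨fun k => ?_, ?_⟩
    · change Summable fun m : ℕ => G k * (((m + (k + M)).choose (k + M) : ℝ) * ρ ^ m)
      exact (hs k).summable
    · change Summable fun k : ℕ => ∑' m : ℕ, G k * (((m + (k + M)).choose (k + M) : ℝ) * ρ ^ m)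
      exact h.congr fun k => (hs k).tsum_eq.symm
  · exact fun q => mul_nonneg (hG _) (by positivity)

/-- Put `i = m + k`. By the growth bound, the `m`-sum is at most a negative binomial series with
value `(1-ρ)^(-(k+M+1))`; the remaining `k`-series converges for every `R` because of the factor
`1/Γ(k+ν+1)`. The hypothesis `ρ < 1` is where `τ < 1` matters for convergence. -/
lemma summable_majorant (hν : -1 < ν) {ρ R : ℝ} (hρ : 0 ≤ ρ) (hρ1 : ρ < 1) (hR : 0 ≤ R) :
    Summable (majorant ν ρ R) := by
  obtain ⟨M, hM⟩ := exists_nat_ge ν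
  obtain ⟨C, hC0, hC⟩ := skewCoeff_mul_factorial_mul_gamma_le hν hM
  have hinj : Function.Injective fun q : ℕ × ℕ => (q.2 + q.1, q.1) := by
    rintro ⟨a, b⟩ ⟨c, d⟩ h
    simp only [Prod.mk.injEq] at h
    obtain ⟨h1, rfl⟩ := h
    simp at h1
    simp [h1]
  rw [← hinj.summable_iff]
  · refine Summable.of_nonneg_of_le (f := fun q : ℕ × ℕ =>
      C * (((q.1 + M)! : ℝ) / ((q.1 ! : ℝ) * Real.Gamma (q.1 + ν + 1)) * R ^ q.1) *
        (((q.2 + (q.1 + M)).choose (q.1 + M) : ℝ) * ρ ^ q.2)) ?_ ?_ ?_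
    · exact fun q => majorant_nonneg hν hρ hR _
    · rintro ⟨k, m⟩
      have h1 := hC (m + k)
      have hg := gamma_nat_pos hν k
      have e1 : (((m + k).choose k : ℕ) : ℝ) = ((m + k)! : ℝ) / ((m ! : ℝ) * (k ! : ℝ)) := by
        rw [Nat.cast_choose ℝ (Nat.le_add_left k m), Nat.add_sub_cancel]
        ring
      have e2 : (((m + (k + M)).choose (k + M) : ℕ) : ℝ)
          = ((m + k + M)! : ℝ) / ((m ! : ℝ) * ((k + M)! : ℝ)) := by
        rw [Nat.cast_choose ℝ (Nat.le_add_left (k + M) m), Nat.add_sub_cancel, ← add_assoc]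
        ring
      simp only [Function.comp, majorant, laguerreCoeff, Nat.add_sub_cancel]
      rw [e1, e2]
      have hf : (0 : ℝ) < (k + M)! := by positivity
      calc _ = (skewCoeff ν (m + k) * ((m + k)! : ℝ) * Real.Gamma ((m + k : ℕ) + ν + 1)) *
            (1 / ((m ! : ℝ) * (k ! : ℝ) * Real.Gamma (k + ν + 1)) * ρ ^ m * R ^ k) := by
            field_simp
        _ ≤ (C * ((m + k + M)! : ℝ)) *
            (1 / ((m ! : ℝ) * (k ! : ℝ) * Real.Gamma (k + ν + 1)) * ρ ^ m * R ^ k) :=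
            mul_le_mul_of_nonneg_right h1 (by positivity)
        _ = _ := by field_simp
    · refine summable_mul_choose_geometric hρ hρ1 M (G := fun k : ℕ =>
        C * (((k + M)! : ℝ) / ((k ! : ℝ) * Real.Gamma (k + ν + 1)) * R ^ k)) (fun k => ?_) ?_
      · have hg := gamma_nat_pos hν k
        positivity
      · have h1ρ : 0 < 1 - ρ := by linarith
        have hy : 0 ≤ R / (1 - ρ) := div_nonneg hR h1ρ.le
        have := (summable_factorial_div_gamma hν M hy).mul_left (C * (1 / (1 - ρ) ^ (M + 1)))
        refine this.congr fun k => ?_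
        generalize ((k + M)! : ℝ) / ((k ! : ℝ) * Real.Gamma (k + ν + 1)) = G
        rw [div_pow, show k + M + 1 = k + (M + 1) by ring, pow_add]
        have := (pow_pos h1ρ k).ne'
        have := (pow_pos h1ρ (M + 1)).ne'
        field_simp
        ring
  · rintro ⟨i, k⟩ hik
    have : i < k := by
      by_contra h
      exact hik ⟨(k, i - k), by simp; omega⟩
    simp [majorant, laguerreCoeff_of_lt this]

lemma norm_scaledLaguerreCoeff_le (hν : -1 < ν) {t : ℂ} {ρ : ℝ} (ht : ‖t‖ ≤ ρ) (z : ℂ) {R : ℝ}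
    (hz : ‖z‖ ≤ R) (i k : ℕ) :
    ‖(skewCoeff ν i : ℂ) * (scaledLaguerreCoeff ν t i k * z ^ k)‖ ≤ majorant ν ρ R (i, k) := by
  have h1 := (skewCoeff_pos hν i).le
  have h2 := laguerreCoeff_nonneg hν i k
  have h3 : 0 ≤ ρ := (norm_nonneg t).trans ht
  rw [norm_mul, norm_mul, scaledLaguerreCoeff, norm_mul, norm_pow, norm_pow, norm_neg,
    Complex.norm_real, Complex.norm_real, Real.norm_of_nonneg h1, Real.norm_of_nonneg h2, majorant]
  calc _ = skewCoeff ν i * laguerreCoeff ν i k * ‖t‖ ^ (i - k) * ‖z‖ ^ k := by ring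
    _ ≤ _ := by gcongr

lemma hasSum_eval_monicLaguerre (t z : ℂ) (n : ℕ) :
    HasSum (fun k => scaledLaguerreCoeff ν t n k * z ^ k) ((monicLaguerre ν t n).eval z) := by
  rw [eval_monicLaguerre]
  refine hasSum_sum_of_ne_finset_zero fun k hk => ?_
  rw [scaledLaguerreCoeff_of_lt t (by simpa [Nat.lt_succ_iff] using hk), zero_mul]

/-- The bound on the `i`-th weighted rescaled Laguerre polynomial. -/
noncomputable def rowMajorant (ν ρ R : ℝ) (i : ℕ) : ℝ := ∑' k, majorant ν ρ R (i, k)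

lemma summable_rowMajorant (hν : -1 < ν) {ρ R : ℝ} (hρ : 0 ≤ ρ) (hρ1 : ρ < 1) (hR : 0 ≤ R) :
    Summable (rowMajorant ν ρ R) :=
  (summable_majorant hν hρ hρ1 hR).prod

lemma rowMajorant_nonneg (hν : -1 < ν) {ρ R : ℝ} (hρ : 0 ≤ ρ) (hR : 0 ≤ R) (i : ℕ) :
    0 ≤ rowMajorant ν ρ R i :=
  tsum_nonneg fun _ => majorant_nonneg hν hρ hR _

lemma norm_eval_monicLaguerre_le (hν : -1 < ν) {t : ℂ} {ρ : ℝ} (ht : ‖t‖ ≤ ρ) (hρ1 : ρ < 1) {z : ℂ}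
    {R : ℝ} (hz : ‖z‖ ≤ R) (i : ℕ) :
    ‖(skewCoeff ν i : ℂ) * (monicLaguerre ν t i).eval z‖ ≤ rowMajorant ν ρ R i := by
  have hρ : 0 ≤ ρ := (norm_nonneg t).trans ht
  have hR : 0 ≤ R := (norm_nonneg z).trans hz
  have h1 := ((hasSum_eval_monicLaguerre (ν := ν) t z i).mul_left (skewCoeff ν i : ℂ))
  rw [← h1.tsum_eq]
  exact tsum_of_norm_bounded ((summable_majorant hν hρ hρ1 hR).prod_factor i).hasSum
    (fun k => norm_scaledLaguerreCoeff_le hν ht z hz i k)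

end Summability

/-! ### Locally uniform convergence and continuity of the kernel. -/

section Convergence

variable {ν τ : ℝ}

lemma exists_laguerreKernelTerm_bound (hν : -1 < ν) (hτ0 : 0 < τ) (hτ1 : τ < 1) {R : ℝ}
    (hR : 0 ≤ R) :
    ∃ b : ℕ → ℝ, Summable b ∧ ∀ k z u, ‖z‖ ≤ R → ‖u‖ ≤ R →
      ‖laguerreKernelTerm ν τ k z u‖ ≤ b k := by
  have hV := summable_rowMajorant hν hτ0.le hτ1 hR
  have hV0 := rowMajorant_nonneg (ν := ν) hν hτ0.le hR
  set V := rowMajorant ν τ R with hVdef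
  have hodd : Summable fun k : ℕ => V (2 * k + 1) :=
    hV.comp_injective fun a b h => by simpa using h
  have heven : Summable fun k : ℕ => V (2 * k) :=
    hV.comp_injective fun a b h => by simpa using h
  have ht : ‖(τ : ℂ)‖ ≤ τ := by rw [Complex.norm_real, Real.norm_of_nonneg hτ0.le]
  refine ⟨fun k => 2 * V (2 * k + 1) * ∑' l, V (2 * l), (hodd.mul_left 2).mul_right _, ?_⟩
  intro k z u hz hu
  have hb := fun (w : ℂ) (hw : ‖w‖ ≤ R) (i : ℕ) => norm_eval_monicLaguerre_le hν ht hτ1 hw i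
  rw [laguerreKernelTerm_eq hν hτ0.ne']
  calc _ ≤ ∑ l ∈ Finset.range (k + 1), 2 * V (2 * k + 1) * V (2 * l) := by
        refine norm_sum_le_of_le _ fun l _ => ?_
        have e : ((skewCoeff ν (2 * k + 1) * skewCoeff ν (2 * l) : ℝ) : ℂ) *
            ((monicLaguerre ν τ (2 * k + 1)).eval z * (monicLaguerre ν τ (2 * l)).eval u
              - (monicLaguerre ν τ (2 * l)).eval z * (monicLaguerre ν τ (2 * k + 1)).eval u)
            = (skewCoeff ν (2 * k + 1) * (monicLaguerre ν τ (2 * k + 1)).eval z) *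
                (skewCoeff ν (2 * l) * (monicLaguerre ν τ (2 * l)).eval u)
              - (skewCoeff ν (2 * l) * (monicLaguerre ν τ (2 * l)).eval z) *
                (skewCoeff ν (2 * k + 1) * (monicLaguerre ν τ (2 * k + 1)).eval u) := by
          push_cast; ring
        rw [e]
        refine ((norm_sub_le _ _).trans <| add_le_add (norm_mul_le _ _) (norm_mul_le _ _)).trans ?_
        have h1 := mul_le_mul (hb z hz (2 * k + 1)) (hb u hu (2 * l)) (norm_nonneg _) (hV0 _)
        have h2 := mul_le_mul (hb z hz (2 * l)) (hb u hu (2 * k + 1)) (norm_nonneg _) (hV0 _)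
        linarith
    _ = 2 * V (2 * k + 1) * ∑ l ∈ Finset.range (k + 1), V (2 * l) := by rw [Finset.mul_sum]
    _ ≤ _ := mul_le_mul_of_nonneg_left (heven.sum_le_tsum _ fun l _ => hV0 _)
        (mul_nonneg zero_le_two (hV0 _))

lemma continuous_laguerreKernelTerm (hν : -1 < ν) (hτ0 : 0 < τ) (k : ℕ) :
    Continuous fun p : ℂ × ℂ => laguerreKernelTerm ν τ k p.1 p.2 := by
  simp only [laguerreKernelTerm_eq hν hτ0.ne']
  fun_prop

lemma summable_laguerreKernelTerm (hν : -1 < ν) (hτ0 : 0 < τ) (hτ1 : τ < 1) (z u : ℂ) :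
    Summable fun k : ℕ => laguerreKernelTerm ν τ k z u := by
  obtain ⟨b, hb, h⟩ := exists_laguerreKernelTerm_bound hν hτ0 hτ1
    (R := max ‖z‖ ‖u‖) (by positivity)
  exact Summable.of_norm_bounded hb fun k => h k z u (le_max_left _ _) (le_max_right _ _)

lemma continuous_laguerreKernel (hν : -1 < ν) (hτ0 : 0 < τ) (hτ1 : τ < 1) :
    Continuous fun p : ℂ × ℂ => laguerreKernel ν τ p.1 p.2 := by
  rw [continuous_iff_continuousAt]
  intro p
  obtain ⟨b, hb, h⟩ := exists_laguerreKernelTerm_bound hν hτ0 hτ1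
    (R := ‖p‖ + 1) (by positivity)
  have hc : ContinuousOn (fun p : ℂ × ℂ => laguerreKernel ν τ p.1 p.2) (Metric.ball 0 (‖p‖ + 1)) :=
    continuousOn_tsum (fun k => (continuous_laguerreKernelTerm hν hτ0 k).continuousOn) hb
      fun k q hq => by
        have hq := (mem_ball_zero_iff.mp hq).le
        exact h k _ _ ((norm_fst_le q).trans hq) ((norm_snd_le q).trans hq)
  exact hc.continuousAt (Metric.isOpen_ball.mem_nhds (by simp))

lemma tendstoUniformlyOn_laguerreKernel (hν : -1 < ν) (hτ0 : 0 < τ) (hτ1 : τ < 1)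
    {S : Set (ℂ × ℂ)} (hS : IsCompact S) :
    TendstoUniformlyOn (fun (N : ℕ) (p : ℂ × ℂ) =>
        ∑ k ∈ Finset.range N, laguerreKernelTerm ν τ k p.1 p.2)
      (fun p : ℂ × ℂ => laguerreKernel ν τ p.1 p.2) atTop S := by
  obtain ⟨R, hR⟩ := hS.isBounded.exists_norm_le
  obtain ⟨b, hb, h⟩ := exists_laguerreKernelTerm_bound hν hτ0 hτ1 (R := max R 0)
    (le_max_right _ _)
  refine tendstoUniformlyOn_tsum_nat hb fun k q hq => ?_
  have hq := (hR q hq).trans (le_max_left R 0)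
  exact h k _ _ ((norm_fst_le q).trans hq) ((norm_snd_le q).trans hq)

end Convergence

/-! ### The double sum as a sum over all pairs of indices. -/

/-- The Taylor coefficients of the limiting kernel at `τ = 0`. -/
noncomputable def kernelCoeff (ν : ℝ) (i j : ℕ) : ℝ :=
  if Odd i ∧ Even j ∧ j < i then skewCoeff ν i * skewCoeff ν j
  else if Even i ∧ Odd j ∧ i < j then -(skewCoeff ν i * skewCoeff ν j) else 0

/-- The Taylor coefficients in `(z, u)` of the limiting kernel at a complex parameter `t`. -/
noncomputable def kernelMoment (ν : ℝ) (m n : ℕ) (t : ℂ) : ℂ :=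
  ∑' p : ℕ × ℕ, (kernelCoeff ν p.1 p.2 : ℂ) *
    (scaledLaguerreCoeff ν t p.1 m * scaledLaguerreCoeff ν t p.2 n)

section KernelCoeff

variable {ν : ℝ}

lemma abs_kernelCoeff_le (hν : -1 < ν) (i j : ℕ) :
    |kernelCoeff ν i j| ≤ skewCoeff ν i * skewCoeff ν j := by
  have h := mul_pos (skewCoeff_pos hν i) (skewCoeff_pos hν j)
  unfold kernelCoeff
  split_ifs
  · rw [abs_of_pos h]
  · rw [abs_neg, abs_of_pos h]
  · simpa using h.le

lemma norm_kernelCoeff_mul_le (hν : -1 < ν) (i j : ℕ) (x y : ℂ) :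
    ‖(kernelCoeff ν i j : ℂ) * (x * y)‖ ≤ ‖(skewCoeff ν i : ℂ) * x‖ * ‖(skewCoeff ν j : ℂ) * y‖ := by
  rw [norm_mul, norm_mul, norm_mul, norm_mul, Complex.norm_real, Complex.norm_real,
    Complex.norm_real, Real.norm_of_nonneg (skewCoeff_pos hν i).le,
    Real.norm_of_nonneg (skewCoeff_pos hν j).le, Real.norm_eq_abs]
  calc _ ≤ (skewCoeff ν i * skewCoeff ν j) * (‖x‖ * ‖y‖) :=
        mul_le_mul_of_nonneg_right (abs_kernelCoeff_le hν i j) (by positivity)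
    _ = _ := by ring

lemma summable_kernelCoeff (hν : -1 < ν) {x y : ℕ → ℂ}
    (hx : Summable fun i => ‖(skewCoeff ν i : ℂ) * x i‖)
    (hy : Summable fun i => ‖(skewCoeff ν i : ℂ) * y i‖) :
    Summable fun p : ℕ × ℕ => ‖(kernelCoeff ν p.1 p.2 : ℂ) * (x p.1 * y p.2)‖ :=
  Summable.of_nonneg_of_le (fun _ => norm_nonneg _)
    (fun p => norm_kernelCoeff_mul_le hν p.1 p.2 (x p.1) (y p.2))
    (hx.mul_of_nonneg hy (fun _ => norm_nonneg _) (fun _ => norm_nonneg _))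

/-- Regroups a summable family, cut down to a triangle parametrised by `e`, into finite rows. -/
lemma hasSum_lower_triangle {H : ℕ × ℕ → ℂ} (hH : Summable H) {e : ℕ × ℕ → ℕ × ℕ}
    (he : Function.Injective e) (P : ℕ × ℕ → Prop) [DecidablePred P]
    (hP : ∀ p, P p → p ∈ Set.range e) (hPe : ∀ k l, P (e (k, l)) ↔ l ≤ k) :
    HasSum (fun k : ℕ => ∑ l ∈ Finset.range (k + 1), H (e (k, l)))
      (∑' p, if P p then H p else 0) := by
  have hs : Summable fun p => if P p then H p else 0 := by
    have := hH.indicator {p | P p}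
    exact this.congr fun p => by simp [Set.indicator_apply]
  have h1 := hs.hasSum
  rw [← he.hasSum_iff (fun p hp => if_neg fun h => hp (hP p h))] at h1
  refine h1.prod_fiberwise fun k => ?_
  have : ∑ l ∈ Finset.range (k + 1), H (e (k, l))
      = ∑ l ∈ Finset.range (k + 1), ((fun p => if P p then H p else 0) ∘ e) (k, l) := by
    refine Finset.sum_congr rfl fun l hl => ?_
    rw [Function.comp, if_pos ((hPe k l).mpr (Nat.lt_succ_iff.mp (Finset.mem_range.mp hl)))]
  rw [this]
  refine hasSum_sum_of_ne_finset_zero fun l hl => ?_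
  rw [Function.comp, if_neg]
  rw [hPe]
  simpa using hl

/-- The (odd, even) triangle yields the first products and the (even, odd) triangle the second ones,
with the opposite sign. -/
lemma hasSum_kernelCoeff {x y : ℕ → ℂ}
    (hx : Summable fun i => ‖(skewCoeff ν i : ℂ) * x i‖)
    (hy : Summable fun i => ‖(skewCoeff ν i : ℂ) * y i‖) :
    HasSum (fun k : ℕ => ∑ l ∈ Finset.range (k + 1),
        ((skewCoeff ν (2 * k + 1) * skewCoeff ν (2 * l) : ℝ) : ℂ) *
          (x (2 * k + 1) * y (2 * l) - x (2 * l) * y (2 * k + 1)))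
      (∑' p : ℕ × ℕ, (kernelCoeff ν p.1 p.2 : ℂ) * (x p.1 * y p.2)) := by
  set H : ℕ × ℕ → ℂ := fun p => ((skewCoeff ν p.1 : ℂ) * x p.1) * ((skewCoeff ν p.2 : ℂ) * y p.2)
    with hHdef
  have hH : Summable H := summable_mul_of_summable_norm
    (f := fun i => (skewCoeff ν i : ℂ) * x i) (g := fun i => (skewCoeff ν i : ℂ) * y i) hx hy
  have h1 := hasSum_lower_triangle hH (e := fun p => (2 * p.1 + 1, 2 * p.2))
    (fun a b h => by simp only [Prod.mk.injEq] at h; ext <;> omega)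
    (fun p => Odd p.1 ∧ Even p.2 ∧ p.2 < p.1)
    (by
      rintro ⟨i, j⟩ ⟨⟨k, hk⟩, ⟨l, hl⟩, _⟩
      exact ⟨(k, l), by simp at hk hl ⊢; omega⟩)
    (fun k l => by
      simp only [show Odd (2 * k + 1) from ⟨k, rfl⟩, even_two_mul, true_and]
      omega)
  have h2 := hasSum_lower_triangle hH (e := fun p => (2 * p.2, 2 * p.1 + 1))
    (fun a b h => by simp only [Prod.mk.injEq] at h; ext <;> omega)
    (fun p => Even p.1 ∧ Odd p.2 ∧ p.1 < p.2)
    (by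
      rintro ⟨i, j⟩ ⟨⟨k, hk⟩, ⟨l, hl⟩, _⟩
      exact ⟨(l, k), by simp at hk hl ⊢; omega⟩)
    (fun k l => by
      simp only [show Odd (2 * k + 1) from ⟨k, rfl⟩, even_two_mul, true_and]
      omega)
  have hs1 : Summable fun p : ℕ × ℕ => if Odd p.1 ∧ Even p.2 ∧ p.2 < p.1 then H p else 0 := by
    exact (hH.indicator {p | Odd p.1 ∧ Even p.2 ∧ p.2 < p.1}).congr
      fun p => by simp [Set.indicator_apply]
  have hs2 : Summable fun p : ℕ × ℕ => if Even p.1 ∧ Odd p.2 ∧ p.1 < p.2 then H p else 0 := by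
    exact (hH.indicator {p | Even p.1 ∧ Odd p.2 ∧ p.1 < p.2}).congr
      fun p => by simp [Set.indicator_apply]
  have h3 := h1.sub h2
  rw [← hs1.tsum_sub hs2] at h3
  have g1 : ∀ k : ℕ, ∑ l ∈ Finset.range (k + 1),
        ((skewCoeff ν (2 * k + 1) * skewCoeff ν (2 * l) : ℝ) : ℂ) *
          (x (2 * k + 1) * y (2 * l) - x (2 * l) * y (2 * k + 1))
      = ∑ l ∈ Finset.range (k + 1), H (2 * k + 1, 2 * l)
        - ∑ l ∈ Finset.range (k + 1), H (2 * l, 2 * k + 1) := by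
    intro k
    rw [← Finset.sum_sub_distrib]
    refine Finset.sum_congr rfl fun l _ => ?_
    simp only [hHdef]
    push_cast
    ring
  have g2 : ∀ p : ℕ × ℕ, (kernelCoeff ν p.1 p.2 : ℂ) * (x p.1 * y p.2)
      = (if Odd p.1 ∧ Even p.2 ∧ p.2 < p.1 then H p else 0)
        - (if Even p.1 ∧ Odd p.2 ∧ p.1 < p.2 then H p else 0) := by
    intro p
    simp only [hHdef, kernelCoeff]
    by_cases c1 : Odd p.1 ∧ Even p.2 ∧ p.2 < p.1
    · have c2 : ¬ (Even p.1 ∧ Odd p.2 ∧ p.1 < p.2) := fun h => by omega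
      rw [if_pos c1, if_pos c1, if_neg c2]
      push_cast
      ring
    · by_cases c2 : Even p.1 ∧ Odd p.2 ∧ p.1 < p.2
      · rw [if_neg c1, if_neg c1, if_pos c2, if_pos c2]
        push_cast
        ring
      · rw [if_neg c1, if_neg c1, if_neg c2, if_neg c2]
        simp
  rw [tsum_congr g2, funext g1]
  exact h3

end KernelCoeff

/-! ### Power series in `z`, `u` and their evolution in `t`. -/

section KernelMoment

variable {ν : ℝ}

lemma norm_kernelMoment_term_le (hν : -1 < ν) {t : ℂ} {ρ : ℝ} (ht : ‖t‖ ≤ ρ) (z u : ℂ) {R : ℝ}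
    (hz : ‖z‖ ≤ R) (hu : ‖u‖ ≤ R) (i j m n : ℕ) :
    ‖(kernelCoeff ν i j : ℂ) * ((scaledLaguerreCoeff ν t i m * z ^ m) *
        (scaledLaguerreCoeff ν t j n * u ^ n))‖
      ≤ majorant ν ρ R (i, m) * majorant ν ρ R (j, n) :=
  (norm_kernelCoeff_mul_le hν i j _ _).trans
    (mul_le_mul (norm_scaledLaguerreCoeff_le hν ht z hz i m)
      (norm_scaledLaguerreCoeff_le hν ht u hu j n) (norm_nonneg _)
      (majorant_nonneg hν ((norm_nonneg t).trans ht) ((norm_nonneg z).trans hz) _))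

lemma summable_kernelMoment_quadruple (hν : -1 < ν) {t : ℂ} (ht : ‖t‖ < 1) (z u : ℂ) :
    Summable fun q : (ℕ × ℕ) × (ℕ × ℕ) => ‖(kernelCoeff ν q.1.1 q.1.2 : ℂ) *
      ((scaledLaguerreCoeff ν t q.1.1 q.2.1 * z ^ q.2.1) *
        (scaledLaguerreCoeff ν t q.1.2 q.2.2 * u ^ q.2.2))‖ := by
  have hR : 0 ≤ max ‖z‖ ‖u‖ := by positivity
  have hW := summable_majorant hν (norm_nonneg t) ht hR
  have hW2 := hW.mul_of_nonneg hW (majorant_nonneg hν (norm_nonneg t) hR)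
    (majorant_nonneg hν (norm_nonneg t) hR)
  have hW3 := (Equiv.prodProdProdComm ℕ ℕ ℕ ℕ).summable_iff.mpr hW2
  refine Summable.of_nonneg_of_le (fun _ => norm_nonneg _) (fun q => ?_) hW3
  exact norm_kernelMoment_term_le hν le_rfl z u (le_max_left _ _) (le_max_right _ _) _ _ _ _

lemma summable_kernelMoment_term (hν : -1 < ν) {t : ℂ} (ht : ‖t‖ < 1) (m n : ℕ) :
    Summable fun p : ℕ × ℕ => (kernelCoeff ν p.1 p.2 : ℂ) *
      (scaledLaguerreCoeff ν t p.1 m * scaledLaguerreCoeff ν t p.2 n) := by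
  -- At `z = u = 1` the powers drop out, and fixing `(m, n)` leaves the required subfamily.
  have h := (summable_kernelMoment_quadruple hν ht 1 1).of_norm
  have h2 := h.comp_injective (i := fun p : ℕ × ℕ => (p, (m, n))) fun a b h => by simpa using h
  simpa [Function.comp_def] using h2

/-- Fubini for the quadruple series: summing over powers first gives the polynomials, summing over
polynomials first gives the moments. -/
lemma tsum_kernelMoment (hν : -1 < ν) {t : ℂ} (ht : ‖t‖ < 1) (z u : ℂ) :
    ∑' p : ℕ × ℕ, kernelMoment ν p.1 p.2 t * (z ^ p.1 * u ^ p.2)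
      = ∑' p : ℕ × ℕ, (kernelCoeff ν p.1 p.2 : ℂ) *
        ((monicLaguerre ν t p.1).eval z * (monicLaguerre ν t p.2).eval u) := by
  have h := (summable_kernelMoment_quadruple hν ht z u).of_norm
  have e1 : ∀ p : ℕ × ℕ, kernelMoment ν p.1 p.2 t * (z ^ p.1 * u ^ p.2)
      = ∑' q : ℕ × ℕ, (kernelCoeff ν q.1 q.2 : ℂ) *
        ((scaledLaguerreCoeff ν t q.1 p.1 * z ^ p.1) *
          (scaledLaguerreCoeff ν t q.2 p.2 * u ^ p.2)) := by
    intro p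
    rw [kernelMoment, ← tsum_mul_right]
    refine tsum_congr fun q => ?_
    ring
  have e2 : ∀ q : ℕ × ℕ, (kernelCoeff ν q.1 q.2 : ℂ) *
        ((monicLaguerre ν t q.1).eval z * (monicLaguerre ν t q.2).eval u)
      = ∑' p : ℕ × ℕ, (kernelCoeff ν q.1 q.2 : ℂ) *
        ((scaledLaguerreCoeff ν t q.1 p.1 * z ^ p.1) *
          (scaledLaguerreCoeff ν t q.2 p.2 * u ^ p.2)) := by
    intro q
    have hn : ∀ (w : ℂ) (i : ℕ), Summable fun k => ‖scaledLaguerreCoeff ν t i k * w ^ k‖ := by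
      intro w i
      refine summable_of_ne_finset_zero (s := Finset.range (i + 1)) fun k hk => ?_
      rw [scaledLaguerreCoeff_of_lt t (by simpa [Nat.lt_succ_iff] using hk), zero_mul, norm_zero]
    rw [tsum_mul_left, ← tsum_mul_tsum_of_summable_norm (hn z q.1) (hn u q.2),
      (hasSum_eval_monicLaguerre t z q.1).tsum_eq, (hasSum_eval_monicLaguerre t u q.2).tsum_eq]
  simp only [e1, e2]
  exact Summable.tsum_comm h

lemma laguerreKernel_eq_tsum_kernelMoment {τ : ℝ} (hν : -1 < ν) (hτ0 : 0 < τ) (hτ1 : τ < 1)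
    (z u : ℂ) :
    laguerreKernel ν τ z u
      = ∑' p : ℕ × ℕ, kernelMoment ν p.1 p.2 τ * (z ^ p.1 * u ^ p.2) := by
  have ht : ‖(τ : ℂ)‖ = τ := by rw [Complex.norm_real, Real.norm_of_nonneg hτ0.le]
  rw [tsum_kernelMoment hν (by rwa [ht]), laguerreKernel]
  simp only [laguerreKernelTerm_eq hν hτ0.ne']
  refine (hasSum_kernelCoeff (x := fun i => (monicLaguerre ν τ i).eval z)
    (y := fun i => (monicLaguerre ν τ i).eval u) ?_ ?_).tsum_eq <;>
  exact Summable.of_nonneg_of_le (fun _ => norm_nonneg _)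
    (fun i => norm_eval_monicLaguerre_le hν ht.le hτ1 le_rfl i)
    (summable_rowMajorant hν hτ0.le hτ1 (norm_nonneg _))

lemma hasDerivAt_scaledLaguerreCoeff (hν : -1 < ν) (i m : ℕ) (t : ℂ) :
    HasDerivAt (fun t => scaledLaguerreCoeff ν t i m)
      (-((m + 1) * (m + 1 + ν) * scaledLaguerreCoeff ν t i (m + 1))) t := by
  unfold scaledLaguerreCoeff
  rcases Nat.lt_or_ge m i with h | h
  · obtain ⟨j, rfl⟩ := Nat.exists_eq_add_of_lt h
    rw [show m + j + 1 - (m + 1) = j by omega, show m + j + 1 - m = j + 1 by omega]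
    have h1 := ((hasDerivAt_neg t).pow (j + 1)).mul_const (laguerreCoeff ν (m + j + 1) m : ℂ)
    refine h1.congr_deriv ?_
    have h2 := congrArg (fun x : ℝ => (x : ℂ)) (sub_mul_laguerreCoeff hν h.le)
    push_cast at h2 ⊢
    linear_combination (-(-t) ^ j) * h2
  · rw [laguerreCoeff_of_lt (show i < m + 1 by omega), show i - m = 0 by omega]
    simpa using hasDerivAt_const t _

/-- The equation `∂_t S = -(B_z + B_u) S` on Taylor coefficients. Termwise differentiation is
licensed by the majorant on a disc of radius `ρ` with `‖t‖ < ρ < 1`. -/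
lemma hasDerivAt_kernelMoment (hν : -1 < ν) (m n : ℕ) {t : ℂ} (ht : ‖t‖ < 1) :
    HasDerivAt (kernelMoment ν m n)
      (-((m + 1) * (m + 1 + ν) * kernelMoment ν (m + 1) n t
        + (n + 1) * (n + 1 + ν) * kernelMoment ν m (n + 1) t)) t := by
  obtain ⟨ρ, hρ1, hρ2⟩ := exists_between ht
  have hρ0 : 0 ≤ ρ := (norm_nonneg t).trans hρ1.le
  have hW := summable_majorant hν hρ0 hρ2 zero_le_one
  have hWm : ∀ m, Summable fun i => majorant ν ρ 1 (i, m) := fun m =>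
    hW.comp_injective (i := fun i => (i, m)) fun a b h => by simpa using h
  have hu := (hWm m).mul_of_nonneg (hWm n) (fun _ => majorant_nonneg hν hρ0 zero_le_one _)
    (fun _ => majorant_nonneg hν hρ0 zero_le_one _)
  have hd : ∀ (p : ℕ × ℕ) (s : ℂ), HasDerivAt (fun t => (kernelCoeff ν p.1 p.2 : ℂ) *
      (scaledLaguerreCoeff ν t p.1 m * scaledLaguerreCoeff ν t p.2 n))
      (-((m + 1) * (m + 1 + ν) * ((kernelCoeff ν p.1 p.2 : ℂ) *
          (scaledLaguerreCoeff ν s p.1 (m + 1) * scaledLaguerreCoeff ν s p.2 n))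
        + (n + 1) * (n + 1 + ν) * ((kernelCoeff ν p.1 p.2 : ℂ) *
          (scaledLaguerreCoeff ν s p.1 m * scaledLaguerreCoeff ν s p.2 (n + 1))))) s := by
    intro p s
    refine (((hasDerivAt_scaledLaguerreCoeff hν p.1 m s).mul
      (hasDerivAt_scaledLaguerreCoeff hν p.2 n s)).const_mul _).congr_deriv ?_
    ring
  have hbound : ∀ (p : ℕ × ℕ) (s : ℂ), s ∈ Metric.ball (0 : ℂ) ρ →
      ‖(kernelCoeff ν p.1 p.2 : ℂ) *
        (scaledLaguerreCoeff ν s p.1 m * scaledLaguerreCoeff ν s p.2 n)‖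
      ≤ majorant ν ρ 1 (p.1, m) * majorant ν ρ 1 (p.2, n) := by
    intro p s hs
    have := norm_kernelMoment_term_le hν (mem_ball_zero_iff.mp hs).le 1 1 (R := 1) (by simp) (by simp)
      p.1 p.2 m n
    simpa using this
  have htmem : t ∈ Metric.ball (0 : ℂ) ρ := mem_ball_zero_iff.mpr hρ1
  have hdiff : ∀ p : ℕ × ℕ, DifferentiableOn ℂ (fun t => (kernelCoeff ν p.1 p.2 : ℂ) *
      (scaledLaguerreCoeff ν t p.1 m * scaledLaguerreCoeff ν t p.2 n)) (Metric.ball (0 : ℂ) ρ) :=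
    fun p s _ => (hd p s).differentiableAt.differentiableWithinAt
  have h1 := Complex.hasSum_deriv_of_summable_norm hu hdiff Metric.isOpen_ball hbound htmem
  have h2 := Complex.differentiableOn_tsum_of_summable_norm hu hdiff Metric.isOpen_ball hbound
  have h3 := (h2.differentiableAt (Metric.isOpen_ball.mem_nhds htmem)).hasDerivAt
  refine h3.congr_deriv (h1.unique ?_)
  simp only [(hd _ _).deriv]
  exact (((summable_kernelMoment_term hν ht (m + 1) n).hasSum.mul_left _).add
    ((summable_kernelMoment_term hν ht m (n + 1)).hasSum.mul_left _)).neg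

lemma kernelMoment_zero (hν : -1 < ν) (m n : ℕ) :
    kernelMoment ν m n 0 = (kernelCoeff ν m n : ℂ) := by
  have h0 : ∀ i k : ℕ, scaledLaguerreCoeff ν 0 i k = if i = k then 1 else 0 := by
    intro i k
    rcases lt_trichotomy i k with h | h | h
    · rw [scaledLaguerreCoeff_of_lt _ h, if_neg h.ne]
    · subst h; rw [scaledLaguerreCoeff_self hν, if_pos rfl]
    · rw [scaledLaguerreCoeff, neg_zero, zero_pow (by omega), zero_mul, if_neg h.ne']
  rw [kernelMoment, tsum_eq_single (m, n)]
  · simp [h0]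
  · rintro ⟨i, j⟩ hij
    simp only [h0]
    by_cases h1 : i = m
    · have h2 : j ≠ n := fun h => hij (by rw [h1, h])
      simp [h2]
    · simp [h1]

end KernelMoment

/-! ### Operator calculus with exponentials on Taylor coefficients. -/

/-- The Taylor coefficients of `exp (c w) * ∑ x i w ^ i`. -/
noncomputable def expConv (c : ℂ) (x : ℕ → ℂ) (m : ℕ) : ℂ :=
  ∑ p ∈ Finset.HasAntidiagonal.antidiagonal m, x p.1 * (c ^ p.2 / (p.2 ! : ℂ))

/-- The Taylor coefficients of `w * ∑ x i w ^ i`. -/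
def shiftSeq (x : ℕ → ℂ) : ℕ → ℂ
  | 0 => 0
  | m + 1 => x m

/-- The Taylor coefficients of `exp (c z + d u) * ∑ s i j z ^ i u ^ j`. -/
noncomputable def expConv₂ (c d : ℂ) (s : ℕ → ℕ → ℂ) (m n : ℕ) : ℂ :=
  expConv c (fun i => expConv d (s i) n) m

/-- `s` is the array of Taylor coefficients of a solution `f(z, u)` of `(B_z + B_u) f = (z + u) f`
where `B_z = z ∂² + (ν + 1) ∂`. -/
def IsBoostSolution (ν : ℝ) (s : ℕ → ℕ → ℂ) : Prop :=
  ∀ m n : ℕ, (m + 1) * (m + 1 + ν) * s (m + 1) n + (n + 1) * (n + 1 + ν) * s m (n + 1)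
    = shiftSeq (fun i => s i n) m + shiftSeq (s m) n

section ExpConv

lemma expConv_add (c : ℂ) (x y : ℕ → ℂ) (m : ℕ) :
    expConv c (fun i => x i + y i) m = expConv c x m + expConv c y m := by
  simp only [expConv, ← Finset.sum_add_distrib, add_mul]

lemma expConv_const_mul (c a : ℂ) (x : ℕ → ℂ) (m : ℕ) :
    expConv c (fun i => a * x i) m = a * expConv c x m := by
  simp only [expConv, Finset.mul_sum, mul_assoc]

lemma expConv_zero (c : ℂ) (x : ℕ → ℂ) : expConv c x 0 = x 0 := by simp [expConv]

lemma expConv_shiftSeq (c : ℂ) (x : ℕ → ℂ) (m : ℕ) :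
    expConv c (shiftSeq x) m = shiftSeq (expConv c x) m := by
  cases m with
  | zero => simp [expConv, shiftSeq]
  | succ m => simp [expConv, shiftSeq, Finset.Nat.sum_antidiagonal_succ]

/-- Leibniz rule for the Euler operator `w∂` applied to `e^{cw} f`. -/
lemma natCast_mul_expConv (c : ℂ) (x : ℕ → ℂ) (m : ℕ) :
    (m : ℂ) * expConv c x m
      = expConv c (fun i => (i : ℂ) * x i) m + c * shiftSeq (expConv c x) m := by
  cases m with
  | zero => simp [expConv, shiftSeq]
  | succ m =>
    have h1 : ((m + 1 : ℕ) : ℂ) * expConv c x (m + 1)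
        = expConv c (fun i => (i : ℂ) * x i) (m + 1)
          + ∑ p ∈ Finset.HasAntidiagonal.antidiagonal (m + 1), x p.1 * (p.2 * (c ^ p.2 / (p.2 ! : ℂ))) := by
      simp only [expConv, Finset.mul_sum, ← Finset.sum_add_distrib]
      refine Finset.sum_congr rfl fun p hp => ?_
      rw [← Finset.HasAntidiagonal.mem_antidiagonal.mp hp]
      push_cast
      ring
    rw [h1, Finset.Nat.sum_antidiagonal_succ']
    simp only [shiftSeq, expConv, Finset.mul_sum, Nat.cast_zero, zero_mul, mul_zero, zero_add]
    congr 1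
    refine Finset.sum_congr rfl fun p _ => ?_
    have h2 : (p.2 ! : ℂ) ≠ 0 := by exact_mod_cast Nat.factorial_ne_zero _
    have h3 : (p.2 : ℂ) + 1 ≠ 0 := Nat.cast_add_one_ne_zero _
    rw [Nat.factorial_succ]
    push_cast
    field_simp
    ring

lemma expConv_natCast_mul (c : ℂ) (x : ℕ → ℂ) (m : ℕ) :
    expConv c (fun i => (i : ℂ) * x i) m
      = shiftSeq (expConv c fun i => (i + 1) * x (i + 1)) m := by
  rw [← expConv_shiftSeq]
  congr 1
  funext i
  cases i <;> simp [shiftSeq]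

/-- In terms of functions, `B(e^{cw} f) = e^{cw} Bf - c² w e^{cw} f + c(2w∂ + 1 + ν)(e^{cw} f)`. The
sign of `c²` is negative because `w∂` acts on the whole product. -/
lemma mul_expConv_succ (ν : ℝ) (c : ℂ) (x : ℕ → ℂ) (m : ℕ) :
    (m + 1) * (m + 1 + ν) * expConv c x (m + 1)
      = expConv c (fun i => (i + 1) * (i + 1 + ν) * x (i + 1)) m
        - c ^ 2 * shiftSeq (expConv c x) m + c * (2 * m + 1 + ν) * expConv c x m := by
  set y : ℕ → ℂ := fun i => (i + 1) * x (i + 1) with hy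
  have h1 := natCast_mul_expConv c x (m + 1)
  rw [expConv_natCast_mul] at h1
  simp only [shiftSeq] at h1
  have h2 := natCast_mul_expConv c x m
  rw [expConv_natCast_mul] at h2
  have h3 := natCast_mul_expConv c y m
  have h4 : expConv c (fun i => (i + 1) * (i + 1 + ν) * x (i + 1)) m
      = expConv c (fun i => (i : ℂ) * y i) m + (1 + ν) * expConv c y m := by
    rw [← expConv_const_mul, ← expConv_add]
    congr 1
    funext i
    simp only [hy]
    ring
  rw [h4]
  push_cast at h1
  linear_combination (m + 1 + ν : ℂ) * h1 + h3 - c * h2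

lemma expConv₂_comm (c d : ℂ) (s : ℕ → ℕ → ℂ) (m n : ℕ) :
    expConv₂ c d s m n = expConv₂ d c (fun j i => s i j) n m := by
  simp only [expConv₂, expConv, Finset.sum_mul]
  rw [Finset.sum_comm]
  refine Finset.sum_congr rfl fun _ _ => Finset.sum_congr rfl fun _ _ => ?_
  ring

lemma expConv₂_add (c d : ℂ) (s s' : ℕ → ℕ → ℂ) (m n : ℕ) :
    expConv₂ c d (fun i j => s i j + s' i j) m n = expConv₂ c d s m n + expConv₂ c d s' m n := by
  simp only [expConv₂, expConv_add]

lemma expConv₂_shift_left (c d : ℂ) (s : ℕ → ℕ → ℂ) (m n : ℕ) :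
    expConv₂ c d (fun i j => shiftSeq (fun i => s i j) i) m n
      = shiftSeq (fun i => expConv₂ c d s i n) m := by
  have h : (fun i => expConv d (fun j => shiftSeq (fun i => s i j) i) n)
      = shiftSeq fun i => expConv d (s i) n := by
    funext i
    cases i <;> simp [shiftSeq, expConv]
  simp only [expConv₂]
  rw [h, expConv_shiftSeq]

lemma expConv₂_shift_right (c d : ℂ) (s : ℕ → ℕ → ℂ) (m n : ℕ) :
    expConv₂ c d (fun i => shiftSeq (s i)) m n = shiftSeq (expConv₂ c d s m) n := by
  rw [expConv₂_comm, expConv₂_shift_left d c (fun j i => s i j)]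
  simp only [← expConv₂_comm c d s]

lemma mul_expConv₂_succ_left (ν : ℝ) (c d : ℂ) (s : ℕ → ℕ → ℂ) (m n : ℕ) :
    (m + 1) * (m + 1 + ν) * expConv₂ c d s (m + 1) n
      = expConv₂ c d (fun i j => (i + 1) * (i + 1 + ν) * s (i + 1) j) m n
        - c ^ 2 * shiftSeq (fun i => expConv₂ c d s i n) m
        + c * (2 * m + 1 + ν) * expConv₂ c d s m n := by
  have h : (fun i : ℕ => ((i : ℂ) + 1) * (i + 1 + ν) * expConv d (s (i + 1)) n)
      = fun i : ℕ => expConv d (fun j => ((i : ℂ) + 1) * (i + 1 + ν) * s (i + 1) j) n := by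
    funext i
    rw [expConv_const_mul]
  simp only [expConv₂]
  rw [mul_expConv_succ, h]

lemma mul_expConv₂_succ_right (ν : ℝ) (c d : ℂ) (s : ℕ → ℕ → ℂ) (m n : ℕ) :
    (n + 1) * (n + 1 + ν) * expConv₂ c d s m (n + 1)
      = expConv₂ c d (fun i j => (j + 1) * (j + 1 + ν) * s i (j + 1)) m n
        - d ^ 2 * shiftSeq (expConv₂ c d s m) n
        + d * (2 * n + 1 + ν) * expConv₂ c d s m n := by
  have h := mul_expConv₂_succ_left ν d c (fun j i => s i j) n m
  simp only [← expConv₂_comm c d s] at h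
  rw [h, expConv₂_comm c d (fun i j => ((j : ℂ) + 1) * (j + 1 + ν) * s i (j + 1))]

/-- Apart from `(1 - c²)(z + u)`, only a scaling by the total degree `m + n` remains. At `c = -t`
this is exactly what differentiating `(1-t²)^(-(ν+1+m+n)) e^{-t(z+u)}` in `t` produces. -/
lemma IsBoostSolution.expConv₂_rec {ν : ℝ} {s : ℕ → ℕ → ℂ} (hs : IsBoostSolution ν s) (c : ℂ)
    (m n : ℕ) :
    (m + 1) * (m + 1 + ν) * expConv₂ c c s (m + 1) n
        + (n + 1) * (n + 1 + ν) * expConv₂ c c s m (n + 1)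
      = (1 - c ^ 2) * (shiftSeq (fun i => expConv₂ c c s i n) m + shiftSeq (expConv₂ c c s m) n)
        + c * (2 * (m + n + 1 + ν)) * expConv₂ c c s m n := by
  have h : expConv₂ c c (fun i j => (i + 1) * (i + 1 + ν) * s (i + 1) j) m n
      + expConv₂ c c (fun i j => (j + 1) * (j + 1 + ν) * s i (j + 1)) m n
      = shiftSeq (fun i => expConv₂ c c s i n) m + shiftSeq (expConv₂ c c s m) n := by
    rw [← expConv₂_add, ← expConv₂_shift_left, ← expConv₂_shift_right, ← expConv₂_add]
    congr 1
    funext i j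
    exact hs i j
  rw [mul_expConv₂_succ_left, mul_expConv₂_succ_right]
  linear_combination h

lemma hasDerivAt_expConv {x : ℂ → ℕ → ℂ} {x' : ℕ → ℂ} {t : ℂ}
    (hx : ∀ i, HasDerivAt (fun t => x t i) (x' i) t) (m : ℕ) :
    HasDerivAt (fun t => expConv (-t) (x t) m)
      (expConv (-t) x' m - shiftSeq (expConv (-t) (x t)) m) t := by
  have h0 : ∀ k : ℕ, HasDerivAt (fun t : ℂ => (-t) ^ k / (k ! : ℂ))
      (-shiftSeq (fun k => (-t) ^ k / (k ! : ℂ)) k) t := by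
    intro k
    cases k with
    | zero => simpa [shiftSeq] using hasDerivAt_const t (1 : ℂ)
    | succ k =>
      have h1 := ((hasDerivAt_neg t).pow (k + 1)).div_const ((k + 1)! : ℂ)
      refine h1.congr_deriv ?_
      have h2 : (k ! : ℂ) ≠ 0 := by exact_mod_cast Nat.factorial_ne_zero _
      have h3 : (k : ℂ) + 1 ≠ 0 := Nat.cast_add_one_ne_zero _
      rw [Nat.factorial_succ, shiftSeq]
      push_cast
      field_simp
  have h1 : HasDerivAt (fun t => expConv (-t) (x t) m)
      (∑ p ∈ Finset.HasAntidiagonal.antidiagonal m, (x' p.1 * ((-t) ^ p.2 / (p.2 ! : ℂ))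
        + x t p.1 * -shiftSeq (fun k => (-t) ^ k / (k ! : ℂ)) p.2)) t :=
    HasDerivAt.fun_sum fun p _ => (hx p.1).mul (h0 p.2)
  refine h1.congr_deriv ?_
  rw [Finset.sum_add_distrib, sub_eq_add_neg]
  congr 1
  cases m with
  | zero => simp [shiftSeq]
  | succ m =>
    rw [Finset.Nat.sum_antidiagonal_succ']
    simp [shiftSeq, expConv]

lemma hasDerivAt_expConv₂ (s : ℕ → ℕ → ℂ) (m n : ℕ) (t : ℂ) :
    HasDerivAt (fun t => expConv₂ (-t) (-t) s m n)
      (-(shiftSeq (fun i => expConv₂ (-t) (-t) s i n) m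
        + shiftSeq (expConv₂ (-t) (-t) s m) n)) t := by
  have h1 : ∀ i, HasDerivAt (fun t => expConv (-t) (s i) n)
      (-shiftSeq (expConv (-t) (s i)) n) t := by
    intro i
    have := hasDerivAt_expConv (x := fun _ => s i) (fun j => hasDerivAt_const t (s i j)) n
    refine this.congr_deriv ?_
    simp [expConv]
  have h2 := hasDerivAt_expConv (x := fun t i => expConv (-t) (s i) n) h1 m
  refine h2.congr_deriv ?_
  have h3 : expConv (-t) (fun i => -shiftSeq (expConv (-t) (s i)) n) m
      = -shiftSeq (expConv₂ (-t) (-t) s m) n := by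
    rw [← expConv₂_shift_right]
    simp only [expConv₂, expConv_shiftSeq, ← neg_one_mul (shiftSeq _ _), expConv_const_mul]
    ring
  rw [h3]
  simp only [expConv₂]
  ring

end ExpConv

/-! ### Explicit solution of the flow in `t`. -/

section HeatFlow

variable {ν : ℝ}

/-- The system expresses each derivative at `0` through lower derivatives of other members, so by
induction all vanish there; holomorphy on the disc does the rest. No growth condition in `m`, `n` is
needed. -/
lemma heat_unique {d : ℕ → ℕ → ℂ → ℂ}
    (hd : ∀ m n : ℕ, ∀ t : ℂ, ‖t‖ < 1 → HasDerivAt (d m n)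
      (-((m + 1) * (m + 1 + ν) * d (m + 1) n t + (n + 1) * (n + 1 + ν) * d m (n + 1) t)) t)
    (h0 : ∀ m n, d m n 0 = 0) (m n : ℕ) {t : ℂ} (ht : ‖t‖ < 1) : d m n t = 0 := by
  have hmem : ∀ {s : ℂ}, s ∈ Metric.ball (0 : ℂ) 1 → ‖s‖ < 1 := fun h => mem_ball_zero_iff.mp h
  have hdiff : ∀ m n, DifferentiableOn ℂ (d m n) (Metric.ball 0 1) := fun m n s hs =>
    (hd m n s (hmem hs)).differentiableAt.differentiableWithinAt
  have hcd : ∀ m n (k : ℕ), ContDiffAt ℂ k (d m n) 0 := fun m n k =>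
    ((hdiff m n).contDiffOn Metric.isOpen_ball).contDiffAt
      (Metric.isOpen_ball.mem_nhds (by simp))
  have key : ∀ k m n, iteratedDeriv k (d m n) 0 = 0 := by
    intro k
    induction k with
    | zero => simpa using h0
    | succ k ih =>
      intro m n
      have he : deriv (d m n) =ᶠ[𝓝 0] fun t =>
          (-((m + 1) * (m + 1 + ν)) * d (m + 1) n t) + (-((n + 1) * (n + 1 + ν))) * d m (n + 1) t := by
        filter_upwards [Metric.isOpen_ball.mem_nhds (Metric.mem_ball_self one_pos)] with s hs
        rw [(hd m n s (hmem hs)).deriv]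
        ring
      rw [iteratedDeriv_succ', he.iteratedDeriv_eq,
        iteratedDeriv_fun_add (contDiffAt_const.mul (hcd _ _ _)) (contDiffAt_const.mul (hcd _ _ _)),
        iteratedDeriv_const_mul_field, iteratedDeriv_const_mul_field, ih, ih]
      simp
  have h1 := Complex.hasSum_taylorSeries_on_ball (hdiff m n) (mem_ball_zero_iff.mpr ht)
  refine h1.unique ?_
  simp only [key, smul_zero]
  exact hasSum_zero

/-- Inside each triangle the recursion `(k+1)(k+1+ν) a_{k+1} = a_{k-1}` matches the two sides; along
the diagonal the two triangles cancel by their opposite signs. -/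
lemma isBoostSolution_kernelCoeff (hν : -1 < ν) :
    IsBoostSolution ν fun i j => (kernelCoeff ν i j : ℂ) := by
  intro m n
  have key : ((m : ℝ) + 1) * (m + 1 + ν) * kernelCoeff ν (m + 1) n
      + (n + 1) * (n + 1 + ν) * kernelCoeff ν m (n + 1)
      = (if m = 0 then 0 else kernelCoeff ν (m - 1) n)
        + (if n = 0 then 0 else kernelCoeff ν m (n - 1)) := by
    have ha : ∀ k : ℕ, k ≠ 0 → ((k : ℝ) + 1) * (k + 1 + ν) * skewCoeff ν (k + 1)
        = skewCoeff ν (k - 1) := by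
      intro k hk
      obtain ⟨k, rfl⟩ := Nat.exists_eq_succ_of_ne_zero hk
      have := skewCoeff_rec hν k
      simp only [Nat.succ_eq_add_one, Nat.add_sub_cancel]
      push_cast
      linear_combination this
    have kA : ∀ i j : ℕ, i % 2 = 1 → j % 2 = 0 → j < i →
        kernelCoeff ν i j = skewCoeff ν i * skewCoeff ν j := fun i j h1 h2 h3 =>
      if_pos ⟨Nat.odd_iff.mpr h1, Nat.even_iff.mpr h2, h3⟩
    have kB : ∀ i j : ℕ, i % 2 = 0 → j % 2 = 1 → i < j →
        kernelCoeff ν i j = -(skewCoeff ν i * skewCoeff ν j) := fun i j h1 h2 h3 => by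
      rw [kernelCoeff, if_neg (fun h => by omega), if_pos ⟨Nat.even_iff.mpr h1, Nat.odd_iff.mpr h2, h3⟩]
    have kZ : ∀ i j : ℕ, ¬ (i % 2 = 1 ∧ j % 2 = 0 ∧ j < i) → ¬ (i % 2 = 0 ∧ j % 2 = 1 ∧ i < j) →
        kernelCoeff ν i j = 0 := fun i j h1 h2 => by
      rw [← Nat.odd_iff, ← Nat.even_iff] at h1 h2
      rw [kernelCoeff, if_neg h1, if_neg h2]
    have kL : ¬ ((m - 1) % 2 = 1 ∧ n % 2 = 0 ∧ n < m - 1) →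
        ¬ (m ≠ 0 ∧ (m - 1) % 2 = 0 ∧ n % 2 = 1 ∧ m - 1 < n) →
        (if m = 0 then 0 else kernelCoeff ν (m - 1) n) = 0 := fun h1 h2 => by
      split_ifs with h
      · rfl
      · exact kZ _ _ h1 fun h3 => h2 ⟨h, h3⟩
    have kR : ¬ (n ≠ 0 ∧ m % 2 = 1 ∧ (n - 1) % 2 = 0 ∧ n - 1 < m) →
        ¬ (m % 2 = 0 ∧ (n - 1) % 2 = 1 ∧ m < n - 1) →
        (if n = 0 then 0 else kernelCoeff ν m (n - 1)) = 0 := fun h1 h2 => by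
      split_ifs with h
      · rfl
      · exact kZ _ _ (fun h3 => h1 ⟨h, h3⟩) h2
    rcases Nat.mod_two_eq_zero_or_one m with hm | hm <;>
      rcases Nat.mod_two_eq_zero_or_one n with hn | hn
    · rcases lt_trichotomy m n with hmn | rfl | hmn
      · rw [kZ (m + 1) n (by omega) (by omega), kB m (n + 1) (by omega) (by omega) (by omega),
          kL (by omega) (by omega), if_neg (by omega), kB m (n - 1) (by omega) (by omega) (by omega),
          ← ha n (by omega)]
        ring
      · rw [kA (m + 1) m (by omega) (by omega) (by omega), kB m (m + 1) (by omega) (by omega) (by omega),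
          kL (by omega) (by omega), kR (by omega) (by omega)]
        ring
      · rw [kA (m + 1) n (by omega) (by omega) (by omega), kZ m (n + 1) (by omega) (by omega),
          kR (by omega) (by omega), if_neg (by omega), kA (m - 1) n (by omega) (by omega) (by omega),
          ← ha m (by omega)]
        ring
    · rw [kZ (m + 1) n (by omega) (by omega), kZ m (n + 1) (by omega) (by omega),
        kL (by omega) (by omega), kR (by omega) (by omega)]
      ring
    · rw [kZ (m + 1) n (by omega) (by omega), kZ m (n + 1) (by omega) (by omega),
        kL (by omega) (by omega), kR (by omega) (by omega)]
      ring
    · rcases lt_trichotomy m n with hmn | rfl | hmn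
      · rw [kB (m + 1) n (by omega) (by omega) (by omega), kZ m (n + 1) (by omega) (by omega),
          kR (by omega) (by omega), if_neg (by omega), kB (m - 1) n (by omega) (by omega) (by omega),
          ← ha m (by omega)]
        ring
      · rw [kZ (m + 1) m (by omega) (by omega), kZ m (m + 1) (by omega) (by omega), if_neg (by omega),
          if_neg (by omega), kB (m - 1) m (by omega) (by omega) (by omega),
          kA m (m - 1) (by omega) (by omega) (by omega)]
        ring
      · rw [kZ (m + 1) n (by omega) (by omega), kA m (n + 1) (by omega) (by omega) (by omega),
          kL (by omega) (by omega), if_neg (by omega), kA m (n - 1) (by omega) (by omega) (by omega),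
          ← ha n (by omega)]
        ring
  have key2 := congrArg (fun x : ℝ => (x : ℂ)) key
  rcases m with _ | m <;> rcases n with _ | n <;>
    simpa [shiftSeq] using key2

lemma kernelMoment_eq (hν : -1 < ν) (m n : ℕ) {t : ℂ} (ht : ‖t‖ < 1) :
    kernelMoment ν m n t = (1 - t ^ 2) ^ (-(ν + 1 + (m + n)) : ℂ) *
      expConv₂ (-t) (-t) (fun i j => (kernelCoeff ν i j : ℂ)) m n := by
  set s : ℕ → ℕ → ℂ := fun i j => (kernelCoeff ν i j : ℂ) with hs
  -- The coefficient of `z^m u^n` in the explicit solution: rescaling both variables by `1/(1-t²)`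
  -- adds `m + n` to the exponent.
  set g : ℕ → ℕ → ℂ → ℂ := fun m n t => (1 - t ^ 2) ^ (-(ν + 1 + (m + n)) : ℂ) *
    expConv₂ (-t) (-t) s m n with hg
  -- The base has positive real part, so its principal powers are holomorphic in `t`.
  have hw : ∀ {t : ℂ}, ‖t‖ < 1 → 1 - t ^ 2 ∈ Complex.slitPlane := by
    intro t ht
    refine Or.inl ?_
    have h1 : (t ^ 2).re ≤ ‖t ^ 2‖ := Complex.re_le_norm _
    have h2 : ‖t ^ 2‖ < 1 := by
      rw [norm_pow]
      nlinarith [norm_nonneg t]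
    rw [Complex.sub_re, Complex.one_re]
    linarith
  have hder : ∀ m n : ℕ, ∀ t : ℂ, ‖t‖ < 1 → HasDerivAt (g m n)
      (-((m + 1) * (m + 1 + ν) * g (m + 1) n t + (n + 1) * (n + 1 + ν) * g m (n + 1) t)) t := by
    intro m n t ht
    have hw0 := Complex.slitPlane_ne_zero (hw ht)
    have h1 := (((hasDerivAt_pow 2 t).const_sub 1).cpow_const
      (c := (-(ν + 1 + (m + n)) : ℂ)) (hw ht)).mul (hasDerivAt_expConv₂ s m n t)
    refine h1.congr_deriv ?_
    have h2 := (isBoostSolution_kernelCoeff hν).expConv₂_rec (-t) m n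
    rw [← hs] at h2
    have e0 : (1 - t ^ 2) ^ (-(ν + 1 + (m + n)) : ℂ)
        = (1 - t ^ 2) * (1 - t ^ 2) ^ (-(ν + 1 + (m + n)) - 1 : ℂ) := by
      rw [Complex.cpow_sub _ _ hw0, Complex.cpow_one]
      field_simp
    have e1 : (-(ν + 1 + ((m + 1 : ℕ) + n)) : ℂ) = -(ν + 1 + (m + n)) - 1 := by push_cast; ring
    have e2 : (-(ν + 1 + (m + (n + 1 : ℕ))) : ℂ) = -(ν + 1 + (m + n)) - 1 := by push_cast; ring
    simp only [hg]
    rw [e1, e2, e0]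
    push_cast
    linear_combination ((1 - t ^ 2) ^ (-(ν + 1 + (m + n)) - 1 : ℂ)) * h2
  have h := heat_unique (ν := ν) (d := fun m n t => kernelMoment ν m n t - g m n t)
    (fun m n t ht => ((hasDerivAt_kernelMoment hν m n ht).sub (hder m n t ht)).congr_deriv (by ring))
    (fun m n => ?_) m n ht
  · exact sub_eq_zero.mp h
  · have e3 : ∀ (x : ℕ → ℂ) m, expConv 0 x m = x m := by
      intro x m
      cases m with
      | zero => simp [expConv]
      | succ m =>
        rw [expConv, Finset.Nat.sum_antidiagonal_succ']
        simp
    simp only [hg, kernelMoment_zero hν, neg_zero, expConv₂, e3, hs]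
    simp

end HeatFlow

/-! ### Summing Cauchy products with exponential series. -/

section CauchyProduct

lemma norm_expConv_le {c : ℂ} {C : ℝ} (hc : ‖c‖ ≤ C) {x : ℕ → ℂ} {X : ℕ → ℝ}
    (hx : ∀ i, ‖x i‖ ≤ X i) (m : ℕ) :
    ‖expConv c x m‖ ≤ ∑ p ∈ Finset.HasAntidiagonal.antidiagonal m, X p.1 * (C ^ p.2 / (p.2 ! : ℝ)) := by
  refine (norm_sum_le _ _).trans (Finset.sum_le_sum fun p _ => ?_)
  rw [norm_mul, norm_div, norm_pow, Complex.norm_natCast]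
  have : 0 ≤ X p.1 := (norm_nonneg _).trans (hx _)
  gcongr
  exact hx _

/-- The bound is phrased as the norm of another convolution so that `summable_norm_expConv₂` applies
to it. -/
lemma norm_expConv₂_le {c d : ℂ} {C D : ℝ} (hc : ‖c‖ ≤ C) (hd : ‖d‖ ≤ D) {s : ℕ → ℕ → ℂ}
    {S : ℕ → ℕ → ℝ} (hs : ∀ i j, ‖s i j‖ ≤ S i j) (m n : ℕ) :
    ‖expConv₂ c d s m n‖ ≤ ‖expConv₂ (C : ℂ) (D : ℂ) (fun i j => (S i j : ℂ)) m n‖ := by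
  have h1 := norm_expConv_le hc (fun i => norm_expConv_le hd (hs i) n) m
  refine h1.trans ((Real.le_norm_self _).trans ?_)
  rw [← Complex.norm_real]
  refine le_of_eq (congrArg _ ?_)
  simp [expConv₂, expConv]

lemma hasSum_exp_series (c : ℂ) : HasSum (fun q : ℕ => c ^ q / (q ! : ℂ)) (Complex.exp c) := by
  rw [Complex.exp_eq_exp_ℂ]
  exact NormedSpace.expSeries_div_hasSum_exp c

lemma summable_norm_exp_series (c : ℂ) : Summable fun q : ℕ => ‖c ^ q / (q ! : ℂ)‖ :=
  NormedSpace.norm_expSeries_div_summable c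

variable {ι : Type*}

/-- The index in `ι` is a spectator; a two-variable product is handled by using this once in each
variable. -/
lemma summable_norm_expConv (c : ℂ) {f : ℕ → ι → ℂ}
    (hf : Summable fun p : ι × ℕ => ‖f p.2 p.1‖) :
    Summable fun p : ι × ℕ => ‖expConv c (fun i => f i p.1) p.2‖ := by
  have hb : ∀ b, Summable fun i => ‖f i b‖ := fun b => hf.prod_factor b
  rw [summable_prod_of_nonneg fun _ => norm_nonneg _]
  refine ⟨fun b => summable_norm_sum_mul_antidiagonal_of_summable_norm (f := fun i => f i b)
    (g := fun q => c ^ q / (q ! : ℂ)) (hb b) (summable_norm_exp_series c), ?_⟩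
  refine Summable.of_nonneg_of_le (fun _ => tsum_nonneg fun _ => norm_nonneg _) (fun b => ?_)
    (hf.prod.mul_right (∑' q : ℕ, ‖c ^ q / (q ! : ℂ)‖))
  have hn1 : Summable fun i => ‖‖f i b‖‖ := by simpa using hb b
  have hn2 : Summable fun q : ℕ => ‖‖c ^ q / (q ! : ℂ)‖‖ := by
    simpa only [norm_norm] using summable_norm_exp_series c
  rw [tsum_mul_tsum_eq_tsum_sum_antidiagonal_of_summable_norm (f := fun i => ‖f i b‖)
    (g := fun q : ℕ => ‖c ^ q / (q ! : ℂ)‖) hn1 hn2]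
  refine Summable.tsum_le_tsum (fun m => (norm_sum_le _ _).trans (Finset.sum_le_sum fun p _ =>
    (norm_mul _ _).le)) (summable_norm_sum_mul_antidiagonal_of_summable_norm (f := fun i => f i b)
    (g := fun q => c ^ q / (q ! : ℂ)) (hb b) (summable_norm_exp_series c)) ?_
  exact (summable_norm_sum_mul_antidiagonal_of_summable_norm (f := fun i => ‖f i b‖)
    (g := fun q : ℕ => ‖c ^ q / (q ! : ℂ)‖) hn1 hn2).of_norm

lemma tsum_expConv (c : ℂ) {f : ℕ → ι → ℂ} (hf : Summable fun p : ι × ℕ => ‖f p.2 p.1‖) :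
    ∑' p : ι × ℕ, expConv c (fun i => f i p.1) p.2
      = Complex.exp c * ∑' p : ι × ℕ, f p.2 p.1 := by
  have hb : ∀ b, Summable fun i => ‖f i b‖ := fun b => hf.prod_factor b
  have h1 : Summable fun p : ι × ℕ => expConv c (fun i => f i p.1) p.2 :=
    (summable_norm_expConv c hf).of_norm
  have h2 : Summable fun p : ι × ℕ => f p.2 p.1 := hf.of_norm
  have h3 : ∀ b, ∑' m, expConv c (fun i => f i b) m = Complex.exp c * ∑' i, f i b := by
    intro b
    have h4 := tsum_mul_tsum_eq_tsum_sum_antidiagonal_of_summable_norm (f := fun i => f i b)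
      (g := fun q => c ^ q / (q ! : ℂ)) (hb b) (summable_norm_exp_series c)
    rw [(hasSum_exp_series c).tsum_eq] at h4
    exact h4.symm.trans (mul_comm _ _)
  calc ∑' p : ι × ℕ, expConv c (fun i => f i p.1) p.2
      = ∑' b, ∑' m, expConv c (fun i => f i b) m := h1.tsum_prod
    _ = ∑' b, Complex.exp c * ∑' i, f i b := tsum_congr h3
    _ = Complex.exp c * ∑' b, ∑' i, f i b := tsum_mul_left
    _ = Complex.exp c * ∑' p : ι × ℕ, f p.2 p.1 := congrArg _ h2.tsum_prod.symm

variable {s : ℕ → ℕ → ℂ}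

lemma summable_norm_expConv₂ (c d : ℂ) (hs : Summable fun p : ℕ × ℕ => ‖s p.1 p.2‖) :
    Summable fun p : ℕ × ℕ => ‖expConv₂ c d s p.1 p.2‖ := by
  have h1 : Summable fun p : ℕ × ℕ => ‖expConv d (s p.1) p.2‖ :=
    summable_norm_expConv d (f := fun j i => s i j) hs
  have h3 : Summable fun p : ℕ × ℕ => ‖expConv₂ c d s p.2 p.1‖ :=
    summable_norm_expConv c (f := fun i n => expConv d (s i) n) h1.prod_symm
  exact h3.prod_symm

lemma tsum_expConv₂ (c d : ℂ) (hs : Summable fun p : ℕ × ℕ => ‖s p.1 p.2‖) :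
    ∑' p : ℕ × ℕ, expConv₂ c d s p.1 p.2
      = Complex.exp c * (Complex.exp d * ∑' p : ℕ × ℕ, s p.1 p.2) := by
  have h1 : Summable fun p : ℕ × ℕ => ‖expConv d (s p.1) p.2‖ :=
    summable_norm_expConv d (f := fun j i => s i j) hs
  have h2 : ∑' p : ℕ × ℕ, expConv d (s p.1) p.2 = Complex.exp d * ∑' p : ℕ × ℕ, s p.1 p.2 :=
    tsum_expConv d (f := fun j i => s i j) hs
  have h3 : ∑' p : ℕ × ℕ, expConv₂ c d s p.2 p.1
      = Complex.exp c * ∑' p : ℕ × ℕ, expConv d (s p.2) p.1 :=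
    tsum_expConv c (f := fun i n => expConv d (s i) n) h1.prod_symm
  have h4 := (Equiv.prodComm ℕ ℕ).tsum_eq fun p : ℕ × ℕ => expConv₂ c d s p.1 p.2
  have h5 := (Equiv.prodComm ℕ ℕ).tsum_eq fun p : ℕ × ℕ => expConv d (s p.1) p.2
  simp only [Equiv.prodComm_apply, Prod.fst_swap, Prod.snd_swap] at h4 h5
  rw [← h4, h3, h5, h2]

lemma expConv_mul_pow (c w : ℂ) (x : ℕ → ℂ) (m : ℕ) :
    expConv c x m * w ^ m = expConv (c * w) (fun i => x i * w ^ i) m := by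
  rw [expConv, expConv, Finset.sum_mul]
  refine Finset.sum_congr rfl fun p hp => ?_
  rw [← Finset.HasAntidiagonal.mem_antidiagonal.mp hp]
  ring

lemma expConv₂_mul_pow (c d z u : ℂ) (s : ℕ → ℕ → ℂ) (m n : ℕ) :
    expConv₂ c d s m n * (z ^ m * u ^ n)
      = expConv₂ (c * z) (d * u) (fun i j => s i j * (z ^ i * u ^ j)) m n := by
  have h : ∀ i, expConv (d * u) (fun j => s i j * (z ^ i * u ^ j)) n
      = (u ^ n * expConv d (s i) n) * z ^ i := by
    intro i
    rw [mul_comm (u ^ n), expConv_mul_pow, mul_comm _ (z ^ i), ← expConv_const_mul]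
    congr 1
    funext j
    ring
  simp only [expConv₂, h]
  rw [← expConv_mul_pow, expConv_const_mul]
  ring

end CauchyProduct

/-! ### Reduction of the kernel to its value at `t = 0`. -/

section ClosedForm

variable {ν : ℝ}

lemma summable_kernelCoeff_mul_pow (hν : -1 < ν) (z u : ℂ) :
    Summable fun p : ℕ × ℕ => ‖(kernelCoeff ν p.1 p.2 : ℂ) * (z ^ p.1 * u ^ p.2)‖ := by
  have h : ∀ w : ℂ, Summable fun i => ‖(skewCoeff ν i : ℂ) * w ^ i‖ := by
    intro w
    refine Summable.of_nonneg_of_le (fun _ => norm_nonneg _) (fun i => ?_)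
      (summable_rowMajorant hν le_rfl one_pos (norm_nonneg w))
    -- At `t = 0` the polynomial `p_i` is the monomial `z^i`, so the Laguerre bound controls the
    -- plain power series.
    have h1 := norm_eval_monicLaguerre_le hν (t := 0) (ρ := 0) (by simp) one_pos (z := w) le_rfl i
    rwa [eval_monicLaguerre, Finset.sum_eq_single_of_mem i (by simp), scaledLaguerreCoeff_self hν,
      one_mul] at h1
    intro k hk hki
    have : i - k ≠ 0 := by
      have := Finset.mem_range.mp hk
      omega
    rw [scaledLaguerreCoeff, neg_zero, zero_pow this, zero_mul, zero_mul]
  exact summable_kernelCoeff hν (h z) (h u)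

lemma laguerreKernel_eq_tsum_kernelCoeff {τ : ℝ} (hν : -1 < ν) (hτ0 : 0 < τ) (hτ1 : τ < 1)
    (z u : ℂ) :
    laguerreKernel ν τ z u = (1 - (τ : ℂ) ^ 2) ^ (-(ν + 1) : ℂ) *
      (Complex.exp (-τ * (z / (1 - (τ : ℂ) ^ 2))) * (Complex.exp (-τ * (u / (1 - (τ : ℂ) ^ 2))) *
        ∑' p : ℕ × ℕ, (kernelCoeff ν p.1 p.2 : ℂ) *
          ((z / (1 - (τ : ℂ) ^ 2)) ^ p.1 * (u / (1 - (τ : ℂ) ^ 2)) ^ p.2))) := by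
  have ht : ‖(τ : ℂ)‖ < 1 := by rwa [Complex.norm_real, Real.norm_of_nonneg hτ0.le]
  have hw : (1 - (τ : ℂ) ^ 2) ≠ 0 := by
    have : (1 - τ ^ 2 : ℝ) ≠ 0 := by nlinarith
    exact_mod_cast this
  rw [laguerreKernel_eq_tsum_kernelMoment hν hτ0 hτ1]
  simp only [fun m n => kernelMoment_eq hν m n ht]
  generalize (1 - (τ : ℂ) ^ 2) = w at hw
  rw [← tsum_expConv₂ _ _ (s := fun i j => (kernelCoeff ν i j : ℂ) * ((z / w) ^ i * (u / w) ^ j))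
    (summable_kernelCoeff_mul_pow hν _ _), ← tsum_mul_left]
  refine tsum_congr fun p => ?_
  rw [← expConv₂_mul_pow, neg_add, Complex.cpow_add _ _ hw, Complex.cpow_neg _ ((p.1 : ℂ) + p.2),
    Complex.cpow_add _ _ hw, Complex.cpow_natCast, Complex.cpow_natCast, div_pow, div_pow]
  generalize expConv₂ _ _ _ _ _ = E
  field_simp

end ClosedForm

/-! ### Integrals of `sin^ν` times odd powers of `cos`. -/

section SinePower

variable {ν : ℝ}

/-- For `ν ≤ 0`, Jordan's inequality `sin α ≥ 2α/π` compares with the integrable `α^ν`; for `ν ≥ 0`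
the integrand is at most `1`. -/
lemma intervalIntegrable_sin_rpow (hν : -1 < ν) :
    IntervalIntegrable (fun α => Real.sin α ^ ν) volume 0 (Real.pi / 2) := by
  have hpi := Real.pi_pos
  have hg : IntervalIntegrable (fun α : ℝ => (2 / Real.pi) ^ ν * α ^ ν + 1) volume 0 (Real.pi / 2) :=
    ((intervalIntegral.intervalIntegrable_rpow' hν).const_mul _).add intervalIntegrable_const
  refine hg.mono_fun' ?_ ?_
  · exact (Real.measurable_sin.pow_const ν).aestronglyMeasurable
  · rw [Set.uIoc_of_le (by positivity)]
    refine (ae_restrict_iff' measurableSet_Ioc).mpr (Eventually.of_forall fun α hα => ?_)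
    have h1 := Real.mul_le_sin hα.1.le hα.2
    have h0 : 0 < 2 / Real.pi * α := by have := hα.1; positivity
    have hs : 0 < Real.sin α := h0.trans_le h1
    change ‖Real.sin α ^ ν‖ ≤ (2 / Real.pi) ^ ν * α ^ ν + 1
    rw [Real.norm_of_nonneg (by positivity), ← Real.mul_rpow (by positivity) hα.1.le]
    rcases le_total ν 0 with h | h
    · have := Real.rpow_le_rpow_of_nonpos h0 h1 h
      linarith
    · have := Real.rpow_le_one hs.le (Real.sin_le_one α) h
      have : 0 ≤ (2 / Real.pi * α) ^ ν := by positivity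
      linarith

lemma intervalIntegrable_sin_rpow_mul (hν : -1 < ν) {g : ℝ → ℂ} (hg : Continuous g) :
    IntervalIntegrable (fun α => ((Real.sin α ^ ν : ℝ) : ℂ) * g α) volume 0 (Real.pi / 2) := by
  have h := intervalIntegrable_sin_rpow hν
  exact IntervalIntegrable.mul_continuousOn ⟨h.1.ofReal, h.2.ofReal⟩ hg.continuousOn

/-- Integration by parts for `sin ^ (ν + 1) * cos ^ (2 k)`. -/
lemma integral_sin_rpow_mul_cos_pow_parts (hν : -1 < ν) (k : ℕ) :
    ∫ α in (0 : ℝ)..(Real.pi / 2), ((ν + 1 + 2 * k) * (Real.sin α ^ ν * Real.cos α ^ (2 * k + 1))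
        - 2 * k * (Real.sin α ^ ν * Real.cos α ^ (2 * k - 1)))
      = if k = 0 then 1 else 0 := by
  have hpi := Real.pi_pos
  have hint : ∀ j : ℕ, IntervalIntegrable (fun α => Real.sin α ^ ν * Real.cos α ^ j) volume 0
      (Real.pi / 2) := fun j =>
    (intervalIntegrable_sin_rpow hν).mul_continuousOn (by fun_prop)
  -- Since `ν + 1 > 0`, the primitive is continuous at `0` even where its derivative blows up.
  have hcont : ContinuousOn (fun α => Real.sin α ^ (ν + 1) * Real.cos α ^ (2 * k))
      (Set.Icc 0 (Real.pi / 2)) := by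
    refine ContinuousOn.mul (Real.continuous_sin.continuousOn.rpow_const fun _ _ => Or.inr ?_)
      (by fun_prop)
    linarith
  rw [intervalIntegral.integral_eq_sub_of_hasDerivAt_of_le (by positivity) hcont (fun α hα => ?_)
    (((hint _).const_mul _).sub ((hint _).const_mul _))]
  · rw [Real.sin_pi_div_two, Real.cos_pi_div_two, Real.sin_zero, Real.zero_rpow (by linarith)]
    -- For `k = 0` the truncated exponent `2k - 1` has coefficient zero, and the boundary term at
    -- `π/2` is `1` instead of `0`.
    rcases Nat.eq_zero_or_pos k with rfl | hk
    · simp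
    · rw [if_neg hk.ne', zero_pow (by omega)]
      simp
  · have hs : 0 < Real.sin α := Real.sin_pos_of_pos_of_lt_pi hα.1 (by linarith [hα.2])
    have h1 := (((Real.hasDerivAt_sin α).rpow_const (p := ν + 1) (Or.inl hs.ne')).mul
      ((Real.hasDerivAt_cos α).pow (2 * k)))
    refine h1.congr_deriv ?_
    rw [add_sub_cancel_right, Real.rpow_add_one hs.ne']
    have h2 := Real.sin_sq_add_cos_sq α
    rcases Nat.eq_zero_or_pos k with rfl | hk
    · simp
      ring
    · obtain ⟨j, rfl⟩ := Nat.exists_eq_add_of_le' hk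
      rw [show 2 * (j + 1) - 1 = 2 * j + 1 by omega]
      push_cast
      have h3 : Real.sin α ^ 2 = 1 - Real.cos α ^ 2 := by linarith
      simp only [Pi.pow_apply]
      linear_combination (-(2 * (j : ℝ) + 2) * Real.sin α ^ ν * Real.cos α ^ (2 * j + 1)) * h3

/-- Integration by parts gives `(ν+1+2k) I_k = 2k I_{k-1}` for `k > 0` and `(ν+1) I_0 = 1`, the
recursion of the right side. -/
lemma integral_sin_rpow_mul_cos_pow (hν : -1 < ν) (k : ℕ) :
    (ν + 1) * ∫ α in (0 : ℝ)..(Real.pi / 2), Real.sin α ^ ν * Real.cos α ^ (2 * k + 1)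
      = skewCoeff ν (2 * k + 1) * ((2 * k + 1)! : ℝ) := by
  have hint : ∀ j : ℕ, IntervalIntegrable (fun α => Real.sin α ^ ν * Real.cos α ^ j) volume 0
      (Real.pi / 2) := fun j =>
    (intervalIntegrable_sin_rpow hν).mul_continuousOn (by fun_prop)
  induction k with
  | zero =>
    have h := integral_sin_rpow_mul_cos_pow_parts hν 0
    simp only [Nat.cast_zero, mul_zero, zero_mul, sub_zero, add_zero, if_true,
      intervalIntegral.integral_const_mul] at h
    simpa [skewCoeff] using h
  | succ k ih =>
    have h := integral_sin_rpow_mul_cos_pow_parts hν (k + 1)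
    rw [intervalIntegral.integral_sub ((hint _).const_mul _) ((hint _).const_mul _),
      intervalIntegral.integral_const_mul, intervalIntegral.integral_const_mul,
      if_neg (Nat.succ_ne_zero k), show 2 * (k + 1) - 1 = 2 * k + 1 by omega] at h
    have h2 := skewCoeff_rec hν (2 * k + 1)
    have h3 : ((2 * (k + 1) + 1)! : ℝ) = (2 * k + 3) * ((2 * k + 2) * ((2 * k + 1)! : ℝ)) := by
      rw [show 2 * (k + 1) + 1 = 2 * k + 1 + 1 + 1 by ring, Nat.factorial_succ, Nat.factorial_succ]
      push_cast
      ring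
    have h4 : ν + 1 + 2 * (k + 1) ≠ 0 := by
      have : (0 : ℝ) ≤ k := k.cast_nonneg
      linarith
    apply mul_left_cancel₀ h4
    rw [h3]
    rw [show 2 * k + 1 + 2 = 2 * (k + 1) + 1 by ring] at h2
    push_cast at h h2
    linear_combination (ν + 1) * h + (2 * (k : ℝ) + 2) * ih
      - ((2 * k + 1)! : ℝ) * (2 * (k : ℝ) + 2) * h2

end SinePower

/-! ### The integral representation at `t = 0`, on Taylor coefficients. -/

/-- The Taylor coefficients of `∑ (x z u) ^ n / (n! Γ(n + ν + 1))`. -/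
noncomputable def besselDiag (ν : ℝ) (x : ℂ) (i j : ℕ) : ℂ :=
  if i = j then x ^ i / ((i ! : ℂ) * ((Real.Gamma (i + ν + 1) : ℝ) : ℂ)) else 0

/-- The Taylor coefficients of
`sinh ((z - u) cos α) * ∑ (z u sin² α) ^ n / (n! Γ(n + ν + 1))`. -/
noncomputable def kernelDensity (ν : ℝ) (m n : ℕ) (α : ℝ) : ℂ :=
  (expConv₂ (Real.cos α : ℂ) (-(Real.cos α : ℂ)) (besselDiag ν ((Real.sin α ^ 2 : ℝ) : ℂ)) m n
    - expConv₂ (-(Real.cos α : ℂ)) (Real.cos α : ℂ)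
      (besselDiag ν ((Real.sin α ^ 2 : ℝ) : ℂ)) m n) / 2

section Density

variable {ν : ℝ}

/-- Bessel's equation in the form `B_z F(xzu) = x u F(xzu)`. -/
lemma mul_besselDiag_succ_left (hν : -1 < ν) (x : ℂ) (i j : ℕ) :
    (i + 1) * (i + 1 + ν) * besselDiag ν x (i + 1) j = x * shiftSeq (besselDiag ν x i) j := by
  cases j with
  | zero => simp [besselDiag, shiftSeq]
  | succ j =>
    rw [shiftSeq, besselDiag, besselDiag]
    by_cases h : i = j
    · subst h
      rw [if_pos rfl, if_pos rfl, Nat.factorial_succ, gamma_nat_succ hν]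
      have h1 : (i ! : ℂ) ≠ 0 := by exact_mod_cast Nat.factorial_ne_zero _
      have h2 : ((Real.Gamma (i + ν + 1) : ℝ) : ℂ) ≠ 0 := by
        exact_mod_cast (gamma_nat_pos hν i).ne'
      have h3 : (i : ℂ) + 1 ≠ 0 := Nat.cast_add_one_ne_zero _
      have h4 : (i : ℂ) + ν + 1 ≠ 0 := by
        have : (i : ℝ) + ν + 1 ≠ 0 := by
          have : (0 : ℝ) ≤ i := i.cast_nonneg
          linarith
        exact_mod_cast this
      push_cast
      generalize (((Real.Gamma (i + ν + 1) : ℝ) : ℂ)) = G at h2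
      field_simp
      ring
    · rw [if_neg (by omega), if_neg h]
      simp

lemma besselDiag_comm (ν : ℝ) (x : ℂ) (i j : ℕ) : besselDiag ν x i j = besselDiag ν x j i := by
  unfold besselDiag
  by_cases h : i = j
  · rw [h]
  · rw [if_neg h, if_neg (Ne.symm h)]

lemma expConv₂_const_mul (c d a : ℂ) (s : ℕ → ℕ → ℂ) (m n : ℕ) :
    expConv₂ c d (fun i j => a * s i j) m n = a * expConv₂ c d s m n := by
  simp only [expConv₂, expConv_const_mul]

lemma natCast_mul_expConv₂_left (c d : ℂ) (s : ℕ → ℕ → ℂ) (m n : ℕ) :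
    (m : ℂ) * expConv₂ c d s m n
      = expConv₂ c d (fun i j => (i : ℂ) * s i j) m n
        + c * shiftSeq (fun i => expConv₂ c d s i n) m := by
  simp only [expConv₂, expConv_const_mul]
  exact natCast_mul_expConv _ _ _

lemma natCast_mul_expConv₂_right (c d : ℂ) (s : ℕ → ℕ → ℂ) (m n : ℕ) :
    (n : ℂ) * expConv₂ c d s m n
      = expConv₂ c d (fun i j => (j : ℂ) * s i j) m n + d * shiftSeq (expConv₂ c d s m) n := by
  have h := natCast_mul_expConv₂_left d c (fun j i => s i j) n m
  simp only [← expConv₂_comm c d s] at h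
  rw [h, expConv₂_comm c d (fun i j => (j : ℂ) * s i j)]

/-- Applied to `e^{c(z-u)} F(xzu)`, the operator `B_z + B_u` gives `x(z+u)` from `F` and `c²(z+u)`
from the exponential. The cross term `2c(z∂_z - u∂_u)F` vanishes as `F` depends on `zu` only, and
the `ν + 1` terms cancel by opposite exponents. -/
lemma isBoostSolution_expConv₂_besselDiag (hν : -1 < ν) {c x : ℂ} (h : x + c ^ 2 = 1) :
    IsBoostSolution ν (expConv₂ c (-c) (besselDiag ν x)) := by
  intro m n
  set d := besselDiag ν x with hd
  have h1 : expConv₂ c (-c) (fun i j => (i + 1) * (i + 1 + ν) * d (i + 1) j) m n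
      = x * shiftSeq (expConv₂ c (-c) d m) n := by
    rw [← expConv₂_shift_right, ← expConv₂_const_mul]
    congr 1
    funext i j
    exact mul_besselDiag_succ_left hν x i j
  have h2 : expConv₂ c (-c) (fun i j => (j + 1) * (j + 1 + ν) * d i (j + 1)) m n
      = x * shiftSeq (fun i => expConv₂ c (-c) d i n) m := by
    rw [← expConv₂_shift_left, ← expConv₂_const_mul]
    congr 1
    funext i j
    simp only [hd, besselDiag_comm ν x i, besselDiag_comm ν x _ j]
    exact mul_besselDiag_succ_left hν x j i
  have h3 : expConv₂ c (-c) (fun i j => (i : ℂ) * d i j) m n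
      = expConv₂ c (-c) (fun i j => (j : ℂ) * d i j) m n := by
    congr 1
    funext i j
    by_cases hij : i = j
    · rw [hij]
    · simp [hd, besselDiag, hij]
  have h4 := natCast_mul_expConv₂_left c (-c) d m n
  have h5 := natCast_mul_expConv₂_right c (-c) d m n
  rw [mul_expConv₂_succ_left, mul_expConv₂_succ_right, h1, h2]
  linear_combination (2 * c) * (h4 - h5 + h3)
    + (shiftSeq (fun i => expConv₂ c (-c) d i n) m + shiftSeq (expConv₂ c (-c) d m) n) * h

/-- The equation can be solved for `s m (n+1)`, since `(n+1)(n+1+ν) ≠ 0`; so the restriction to `u =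
0` determines every later column. -/
lemma IsBoostSolution.eq_of_eq_zero (hν : -1 < ν) {s s' : ℕ → ℕ → ℂ} (hs : IsBoostSolution ν s)
    (hs' : IsBoostSolution ν s') (h0 : ∀ m, s m 0 = s' m 0) (m n : ℕ) : s m n = s' m n := by
  induction n using Nat.strong_induction_on generalizing m with
  | _ n ih =>
    cases n with
    | zero => exact h0 m
    | succ n =>
      have hl : ((n : ℂ) + 1) * (n + 1 + ν) ≠ 0 := by
        have hn : (0 : ℝ) ≤ n := n.cast_nonneg
        have : ((n : ℝ) + 1) * (n + 1 + ν) ≠ 0 := by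
          apply mul_ne_zero <;> linarith
        exact_mod_cast this
      have e1 : ∀ i, s i n = s' i n := fun i => ih n (Nat.lt_succ_self n) i
      have e2 : shiftSeq (s m) n = shiftSeq (s' m) n := by
        cases n with
        | zero => rfl
        | succ n => exact ih n (by omega) m
      have h1 := hs m n
      have h2 := hs' m n
      simp only [e1, e2] at h1
      exact mul_left_cancel₀ hl (by linear_combination h1 - h2)

lemma continuous_expConv₂ {c d : ℝ → ℂ} (hc : Continuous c) (hd : Continuous d)
    {s : ℝ → ℕ → ℕ → ℂ} (hs : ∀ i j, Continuous fun α => s α i j) (m n : ℕ) :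
    Continuous fun α => expConv₂ (c α) (d α) (s α) m n := by
  unfold expConv₂ expConv
  fun_prop

lemma continuous_kernelDensity (m n : ℕ) : Continuous (kernelDensity ν m n) := by
  have hs : ∀ i j, Continuous fun α : ℝ => besselDiag ν ((Real.sin α ^ 2 : ℝ) : ℂ) i j := by
    intro i j
    unfold besselDiag
    split_ifs <;> fun_prop
  unfold kernelDensity
  exact ((continuous_expConv₂ (by fun_prop) (by fun_prop) hs m n).sub
    (continuous_expConv₂ (by fun_prop) (by fun_prop) hs m n)).div_const 2

lemma isBoostSolution_kernelDensity (hν : -1 < ν) (α : ℝ) :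
    IsBoostSolution ν fun m n => kernelDensity ν m n α := by
  intro m n
  have h1 := isBoostSolution_expConv₂_besselDiag hν (c := (Real.cos α : ℂ))
    (x := ((Real.sin α ^ 2 : ℝ) : ℂ)) (by exact_mod_cast Real.sin_sq_add_cos_sq α) m n
  have h2 := isBoostSolution_expConv₂_besselDiag hν (c := -(Real.cos α : ℂ))
    (x := ((Real.sin α ^ 2 : ℝ) : ℂ))
    (by rw [neg_sq]; exact_mod_cast Real.sin_sq_add_cos_sq α) m n
  rw [neg_neg] at h2
  have h3 : ∀ (f g : ℕ → ℂ) k, shiftSeq (fun i => (f i - g i) / 2) k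
      = (shiftSeq f k - shiftSeq g k) / 2 := by
    intro f g k
    cases k <;> simp [shiftSeq]
  simp only [kernelDensity]
  rw [h3, h3]
  linear_combination (h1 - h2) / 2

lemma kernelDensity_zero_right (m : ℕ) (α : ℝ) :
    kernelDensity ν m 0 α = if Odd m then
      ((Real.cos α ^ m / ((m ! : ℝ) * Real.Gamma (ν + 1)) : ℝ) : ℂ) else 0 := by
  have h : ∀ c d x : ℂ, expConv₂ c d (besselDiag ν x) m 0
      = c ^ m / ((m ! : ℂ) * ((Real.Gamma (ν + 1) : ℝ) : ℂ)) := by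
    intro c d x
    rw [expConv₂, expConv, Finset.sum_eq_single_of_mem (0, m) (by simp)]
    · rw [expConv_zero, besselDiag, if_pos rfl]
      simp [div_eq_mul_inv]
      ring
    · rintro ⟨i, j⟩ hij hne
      rw [expConv_zero, besselDiag, if_neg, zero_mul]
      rintro rfl
      apply hne
      have := Finset.HasAntidiagonal.mem_antidiagonal.mp hij
      simp_all
  rw [kernelDensity, h, h]
  split_ifs with hm
  · rw [hm.neg_pow]
    push_cast
    ring
  · rw [(Nat.not_odd_iff_even.mp hm).neg_pow]
    simp

/-- Both sides solve the same linear equation, which passes under the integral. At `u = 0` only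
`sinh(z cos α)/Γ(ν+1)` is left, and `integral_sin_rpow_mul_cos_pow` finishes. -/
lemma kernelCoeff_eq_integral (hν : -1 < ν) (m n : ℕ) :
    (kernelCoeff ν m n : ℂ) = ((Real.Gamma (ν + 2) : ℝ) : ℂ) *
      ∫ α in (0 : ℝ)..(Real.pi / 2), ((Real.sin α ^ ν : ℝ) : ℂ) * kernelDensity ν m n α := by
  refine (isBoostSolution_kernelCoeff hν).eq_of_eq_zero hν (s' := fun m n =>
    ((Real.Gamma (ν + 2) : ℝ) : ℂ) *
      ∫ α in (0 : ℝ)..(Real.pi / 2), ((Real.sin α ^ ν : ℝ) : ℂ) * kernelDensity ν m n α)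
    (fun m n => ?_) (fun m => ?_) m n
  · have hi : ∀ m n, IntervalIntegrable
        (fun α => ((Real.sin α ^ ν : ℝ) : ℂ) * kernelDensity ν m n α) volume 0 (Real.pi / 2) :=
      fun m n => intervalIntegrable_sin_rpow_mul hν (continuous_kernelDensity m n)
    have hsh : ∀ (G : ℂ) (f : ℕ → ℝ → ℂ) k,
        shiftSeq (fun i => G * ∫ α in (0 : ℝ)..(Real.pi / 2), f i α) k
        = G * ∫ α in (0 : ℝ)..(Real.pi / 2), shiftSeq (fun i => f i α) k := by
      intro G f k
      cases k <;> simp [shiftSeq]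
    have hshi : ∀ (f : ℕ → ℝ → ℂ), (∀ k, IntervalIntegrable (f k) volume 0 (Real.pi / 2)) →
        ∀ k, IntervalIntegrable (fun α => shiftSeq (fun i => f i α) k) volume 0 (Real.pi / 2) := by
      intro f hf k
      cases k with
      | zero => exact intervalIntegrable_const
      | succ k => exact hf k
    have hmul : ∀ (a : ℂ) (f : ℕ → ℂ) k, shiftSeq (fun i => a * f i) k = a * shiftSeq f k := by
      intro a f k
      cases k <;> simp [shiftSeq]
    change _ * (_ * ∫ α in (0 : ℝ)..(Real.pi / 2), _) + _ * (_ * ∫ α in (0 : ℝ)..(Real.pi / 2), _)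
      = shiftSeq (fun i => ((Real.Gamma (ν + 2) : ℝ) : ℂ) * ∫ α in (0 : ℝ)..(Real.pi / 2),
          ((Real.sin α ^ ν : ℝ) : ℂ) * kernelDensity ν i n α) m
        + shiftSeq (fun j => ((Real.Gamma (ν + 2) : ℝ) : ℂ) * ∫ α in (0 : ℝ)..(Real.pi / 2),
          ((Real.sin α ^ ν : ℝ) : ℂ) * kernelDensity ν m j α) n
    rw [hsh _ (fun i α => ((Real.sin α ^ ν : ℝ) : ℂ) * kernelDensity ν i n α),
      hsh _ (fun j α => ((Real.sin α ^ ν : ℝ) : ℂ) * kernelDensity ν m j α),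
      mul_left_comm, mul_left_comm (((n : ℂ) + 1) * (n + 1 + ν)), ← mul_add, ← mul_add,
      ← intervalIntegral.integral_const_mul, ← intervalIntegral.integral_const_mul,
      ← intervalIntegral.integral_add ((hi _ _).const_mul _) ((hi _ _).const_mul _),
      ← intervalIntegral.integral_add (hshi _ (fun i => hi i n) m) (hshi _ (fun j => hi m j) n)]
    congr 1
    refine intervalIntegral.integral_congr fun α _ => ?_
    simp only [hmul]
    linear_combination ((Real.sin α ^ ν : ℝ) : ℂ) * isBoostSolution_kernelDensity hν α m n
  · have hG : Real.Gamma (ν + 2) = (ν + 1) * Real.Gamma (ν + 1) := by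
      rw [← Real.Gamma_add_one (s := ν + 1) (by linarith)]
      ring_nf
    have hG0 : Real.Gamma (ν + 1) ≠ 0 := (Real.Gamma_pos_of_pos (by linarith)).ne'
    simp only [kernelDensity_zero_right]
    by_cases hm : Odd m
    · obtain ⟨k, rfl⟩ := hm
      have hk : Odd (2 * k + 1) := ⟨k, rfl⟩
      have hc : kernelCoeff ν (2 * k + 1) 0 = skewCoeff ν (2 * k + 1) := by
        rw [kernelCoeff, if_pos ⟨hk, Even.zero, Nat.succ_pos _⟩, skewCoeff, mul_one]
      rw [hc]
      simp only [hk, if_true]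
      have h1 : ∀ α : ℝ, ((Real.sin α ^ ν : ℝ) : ℂ) *
          ((Real.cos α ^ (2 * k + 1) / (((2 * k + 1)! : ℝ) * Real.Gamma (ν + 1)) : ℝ) : ℂ)
          = (((Real.sin α ^ ν * Real.cos α ^ (2 * k + 1))
            / (((2 * k + 1)! : ℝ) * Real.Gamma (ν + 1)) : ℝ) : ℂ) := by
        intro α
        push_cast
        ring
      simp only [h1]
      rw [intervalIntegral.integral_ofReal, intervalIntegral.integral_div, ← Complex.ofReal_mul]
      congr 1
      have h2 := integral_sin_rpow_mul_cos_pow hν k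
      have h3 : ((2 * k + 1)! : ℝ) ≠ 0 := by exact_mod_cast Nat.factorial_ne_zero _
      rw [hG]
      field_simp
      linear_combination -h2
    · simp [hm, kernelCoeff]

end Density

/-! ### Resummation and passage to the Bessel function. -/

/-- The entire function `∑ w ^ n / (n! Γ(n + ν + 1))` underlying the Bessel function `I_ν`. -/
noncomputable def besselSeries (ν : ℝ) (w : ℂ) : ℂ :=
  ∑' n : ℕ, w ^ n / ((n ! : ℂ) * ((Real.Gamma (n + ν + 1) : ℝ) : ℂ))

section BesselSeries

variable {ν : ℝ}

lemma summable_norm_besselSeries (hν : -1 < ν) (w : ℂ) :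
    Summable fun n : ℕ => ‖w ^ n / ((n ! : ℂ) * ((Real.Gamma (n + ν + 1) : ℝ) : ℂ))‖ := by
  refine Summable.of_nonneg_of_le (fun _ => norm_nonneg _) (fun n => ?_)
    (summable_factorial_div_gamma hν 0 (norm_nonneg w))
  have hG := gamma_nat_pos hν n
  have h1 : (1 : ℝ) ≤ ((n + 0)! : ℝ) := by exact_mod_cast Nat.factorial_pos _
  rw [norm_div, norm_pow, norm_mul, Complex.norm_natCast, Complex.norm_real,
    Real.norm_of_nonneg hG.le, div_eq_mul_inv, mul_comm]
  refine mul_le_mul_of_nonneg_right ?_ (by positivity)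
  rw [← one_div]
  gcongr

lemma besselDiag_mul_pow (x z u : ℂ) (n : ℕ) :
    besselDiag ν x n n * (z ^ n * u ^ n)
      = (x * (z * u)) ^ n / ((n ! : ℂ) * ((Real.Gamma (n + ν + 1) : ℝ) : ℂ)) := by
  rw [besselDiag, if_pos rfl, mul_pow, mul_pow]
  ring

lemma diag_injective : Function.Injective fun n : ℕ => (n, n) := fun a b h => by
  simpa using h

lemma besselDiag_of_notMem (x : ℂ) {p : ℕ × ℕ} (hp : p ∉ Set.range fun n : ℕ => (n, n)) :
    besselDiag ν x p.1 p.2 = 0 := by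
  rw [besselDiag, if_neg]
  intro h
  exact hp ⟨p.1, Prod.ext rfl h⟩

lemma summable_besselDiag (hν : -1 < ν) (x z u : ℂ) :
    Summable fun p : ℕ × ℕ => ‖besselDiag ν x p.1 p.2 * (z ^ p.1 * u ^ p.2)‖ := by
  rw [← diag_injective.summable_iff fun p hp => by
    rw [besselDiag_of_notMem x hp, zero_mul, norm_zero]]
  refine (summable_norm_besselSeries hν (x * (z * u))).congr fun n => ?_
  rw [Function.comp, besselDiag_mul_pow]

lemma tsum_besselDiag (x z u : ℂ) :
    ∑' p : ℕ × ℕ, besselDiag ν x p.1 p.2 * (z ^ p.1 * u ^ p.2) = besselSeries ν (x * (z * u)) := by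
  rw [← diag_injective.tsum_eq, besselSeries]
  · exact tsum_congr fun n => besselDiag_mul_pow x z u n
  · intro p hp
    by_contra h
    exact hp (by simp only [besselDiag_of_notMem x h, zero_mul])

lemma continuous_besselSeries_sin_sq (hν : -1 < ν) (w : ℂ) :
    Continuous fun α : ℝ => besselSeries ν (((Real.sin α ^ 2 : ℝ) : ℂ) * w) := by
  refine continuous_tsum (fun n => by fun_prop) (summable_norm_besselSeries hν w) fun n α => ?_
  rw [norm_div, norm_div, norm_pow, norm_pow, norm_mul, Complex.norm_real,
    Real.norm_of_nonneg (sq_nonneg _)]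
  gcongr
  exact mul_le_of_le_one_left (norm_nonneg _) (Real.sin_sq_le_one α)

lemma kernelDensity_mul_pow (m n : ℕ) (α : ℝ) (z u : ℂ) :
    kernelDensity ν m n α * (z ^ m * u ^ n)
      = (expConv₂ (Real.cos α * z) (-Real.cos α * u)
          (fun i j => besselDiag ν ((Real.sin α ^ 2 : ℝ) : ℂ) i j * (z ^ i * u ^ j)) m n
        - expConv₂ (-Real.cos α * z) (Real.cos α * u)
          (fun i j => besselDiag ν ((Real.sin α ^ 2 : ℝ) : ℂ) i j * (z ^ i * u ^ j)) m n) / 2 := by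
  rw [← expConv₂_mul_pow, ← expConv₂_mul_pow, kernelDensity]
  ring

lemma hasSum_kernelDensity (hν : -1 < ν) (z u : ℂ) (α : ℝ) :
    HasSum (fun p : ℕ × ℕ => kernelDensity ν p.1 p.2 α * (z ^ p.1 * u ^ p.2))
      (Complex.sinh ((z - u) * (Real.cos α : ℂ)) *
        besselSeries ν (((Real.sin α ^ 2 : ℝ) : ℂ) * (z * u))) := by
  have hs := summable_besselDiag hν ((Real.sin α ^ 2 : ℝ) : ℂ) z u
  have h : ∀ c d : ℂ, HasSum (fun p : ℕ × ℕ => expConv₂ c d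
      (fun i j => besselDiag ν ((Real.sin α ^ 2 : ℝ) : ℂ) i j * (z ^ i * u ^ j)) p.1 p.2)
      (Complex.exp c * (Complex.exp d *
        besselSeries ν (((Real.sin α ^ 2 : ℝ) : ℂ) * (z * u)))) := by
    intro c d
    have h1 := (summable_norm_expConv₂ c d (s := fun i j =>
      besselDiag ν ((Real.sin α ^ 2 : ℝ) : ℂ) i j * (z ^ i * u ^ j)) hs).of_norm.hasSum
    rwa [tsum_expConv₂ c d (s := fun i j =>
      besselDiag ν ((Real.sin α ^ 2 : ℝ) : ℂ) i j * (z ^ i * u ^ j)) hs, tsum_besselDiag] at h1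
  simp only [kernelDensity_mul_pow]
  have h2 := ((h (Real.cos α * z) (-Real.cos α * u)).sub
    (h (-Real.cos α * z) (Real.cos α * u))).div_const 2
  refine (congrArg (HasSum _) ?_).mpr h2
  have h3 := Complex.two_sinh ((z - u) * (Real.cos α : ℂ))
  rw [show (z - u) * (Real.cos α : ℂ) = Real.cos α * z + -Real.cos α * u by ring,
    neg_add, Complex.exp_add, Complex.exp_add, neg_mul, neg_neg] at h3
  rw [show (z - u) * (Real.cos α : ℂ) = Real.cos α * z + -Real.cos α * u by ring, neg_mul, neg_mul]
  linear_combination h3 * besselSeries ν (((Real.sin α ^ 2 : ℝ) : ℂ) * (z * u)) / 2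

/-- Bounding `|cos α|` and `sin²α` by `1` inside the convolutions gives a majorant uniform in `α`,
as dominated convergence requires. -/
lemma exists_kernelDensity_bound (hν : -1 < ν) (z u : ℂ) :
    ∃ B : ℕ × ℕ → ℝ, Summable B ∧ ∀ p α,
      ‖kernelDensity ν p.1 p.2 α * (z ^ p.1 * u ^ p.2)‖ ≤ B p := by
  set S : ℕ → ℕ → ℝ := fun i j => ‖besselDiag ν 1 i j * (z ^ i * u ^ j)‖ with hS
  refine ⟨fun p => ‖expConv₂ (‖z‖ : ℂ) (‖u‖ : ℂ) (fun i j => (S i j : ℂ)) p.1 p.2‖,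
    summable_norm_expConv₂ _ _ ?_, fun p α => ?_⟩
  · refine (summable_besselDiag hν 1 z u).congr fun p => ?_
    rw [Complex.norm_real, hS, norm_norm]
  · have hc : ‖(Real.cos α : ℂ)‖ ≤ 1 := by
      rw [Complex.norm_real]
      exact Real.abs_cos_le_one α
    have hc' : ‖-(Real.cos α : ℂ)‖ ≤ 1 := by rwa [norm_neg]
    have hm : ∀ c w : ℂ, ‖c‖ ≤ 1 → ‖c * w‖ ≤ ‖w‖ := fun c w h => by
      rw [norm_mul]
      exact mul_le_of_le_one_left (norm_nonneg _) h
    have hs : ∀ i j, ‖besselDiag ν ((Real.sin α ^ 2 : ℝ) : ℂ) i j * (z ^ i * u ^ j)‖ ≤ S i j := by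
      intro i j
      change _ ≤ ‖besselDiag ν 1 i j * (z ^ i * u ^ j)‖
      rw [norm_mul, norm_mul (besselDiag ν 1 i j)]
      refine mul_le_mul_of_nonneg_right ?_ (norm_nonneg _)
      unfold besselDiag
      split_ifs
      · rw [norm_div, norm_div, norm_pow, norm_pow, Complex.norm_real,
          Real.norm_of_nonneg (sq_nonneg _), norm_one]
        gcongr
        exact Real.sin_sq_le_one α
      · simp
    rw [kernelDensity_mul_pow, norm_div, Complex.norm_ofNat, div_le_iff₀ two_pos]
    refine (norm_sub_le _ _).trans ?_
    have h1 := norm_expConv₂_le (hm _ z hc) (hm _ u hc') hs p.1 p.2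
    have h2 := norm_expConv₂_le (hm _ z hc') (hm _ u hc) hs p.1 p.2
    linarith

lemma tsum_kernelCoeff_eq_integral (hν : -1 < ν) (z u : ℂ) :
    ∑' p : ℕ × ℕ, (kernelCoeff ν p.1 p.2 : ℂ) * (z ^ p.1 * u ^ p.2)
      = ((Real.Gamma (ν + 2) : ℝ) : ℂ) * ∫ α in (0 : ℝ)..(Real.pi / 2),
        ((Real.sin α ^ ν : ℝ) : ℂ) * (Complex.sinh ((z - u) * (Real.cos α : ℂ)) *
          besselSeries ν (((Real.sin α ^ 2 : ℝ) : ℂ) * (z * u))) := by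
  obtain ⟨B, hB, hBle⟩ := exists_kernelDensity_bound hν z u
  have hpos : ∀ α ∈ Set.uIoc 0 (Real.pi / 2), 0 ≤ Real.sin α := by
    intro α hα
    rw [Set.uIoc_of_le (by positivity)] at hα
    exact Real.sin_nonneg_of_nonneg_of_le_pi hα.1.le (by linarith [hα.2, Real.pi_pos])
  have h := intervalIntegral.hasSum_integral_of_dominated_convergence (μ := volume) (a := 0)
    (b := Real.pi / 2)
    (F := fun (p : ℕ × ℕ) α => ((Real.sin α ^ ν : ℝ) : ℂ) *
      (kernelDensity ν p.1 p.2 α * (z ^ p.1 * u ^ p.2)))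
    (f := fun α => ((Real.sin α ^ ν : ℝ) : ℂ) * (Complex.sinh ((z - u) * (Real.cos α : ℂ)) *
          besselSeries ν (((Real.sin α ^ 2 : ℝ) : ℂ) * (z * u))))
    (fun p α => Real.sin α ^ ν * B p) (fun p => ?_) (fun p => ?_) ?_ ?_ ?_
  · rw [← h.tsum_eq, ← tsum_mul_left]
    refine tsum_congr fun p => ?_
    rw [kernelCoeff_eq_integral hν, mul_assoc, ← intervalIntegral.integral_mul_const]
    simp only [mul_assoc]
  · exact (intervalIntegrable_sin_rpow_mul hν
      ((continuous_kernelDensity p.1 p.2).mul continuous_const)).aestronglyMeasurable_restrict_uIoc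
  · refine Eventually.of_forall fun α hα => ?_
    have := hpos α hα
    rw [norm_mul, Complex.norm_real, Real.norm_of_nonneg (by positivity)]
    exact mul_le_mul_of_nonneg_left (hBle p α) (by positivity)
  · exact Eventually.of_forall fun α _ => hB.mul_left _
  · simp only [tsum_mul_left]
    exact (intervalIntegrable_sin_rpow hν).mul_const _
  · exact Eventually.of_forall fun α _ => (hasSum_kernelDensity hν z u α).mul_left _

/-- The principal root `w^(1/2)` has argument in `(-π/2, π/2]`, so its power `ν` is the principal
`w^(ν/2)`; the positive factor `r` does not change the argument. -/
lemma besselI_two_mul_sqrt {r : ℝ} (hr : 0 < r) {w : ℂ} (hw : w ≠ 0) :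
    besselI ν (2 * (w ^ (1 / 2 : ℂ) * (r : ℂ)))
      = ((r ^ ν : ℝ) : ℂ) * w ^ ((ν : ℂ) / 2) * besselSeries ν (((r ^ 2 : ℝ) : ℂ) * w) := by
  have hq : w ^ (1 / 2 : ℂ) ≠ 0 := by
    rw [Ne, Complex.cpow_eq_zero_iff]
    exact fun h => hw h.1
  have h1 : ((r : ℂ) * w ^ (1 / 2 : ℂ)) ^ (ν : ℂ) = ((r ^ ν : ℝ) : ℂ) * w ^ ((ν : ℂ) / 2) := by
    have hr0 : (r : ℂ) ≠ 0 := by exact_mod_cast hr.ne'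
    rw [Complex.cpow_def_of_ne_zero (mul_ne_zero hr0 hq), Complex.log_ofReal_mul hr hq, add_mul,
      Complex.exp_add, ← Complex.cpow_def_of_ne_zero hq, Complex.ofReal_cpow hr.le,
      Complex.cpow_def_of_ne_zero hr0, Complex.ofReal_log hr.le]
    congr 1
    have him : (Complex.log w * (1 / 2 : ℂ)).im = (Complex.log w).im / 2 := by
      rw [show (1 / 2 : ℂ) = ((1 / 2 : ℝ) : ℂ) by push_cast; rfl, Complex.im_mul_ofReal]
      ring
    have hpi := Real.pi_pos
    have b1 := Complex.neg_pi_lt_log_im w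
    have b2 := Complex.log_im_le_pi w
    rw [← Complex.cpow_mul _ (by rw [him]; linarith) (by rw [him]; linarith)]
    congr 1
    ring
  have h2 : (w ^ (1 / 2 : ℂ)) ^ 2 = w := by
    rw [sq, ← Complex.cpow_add _ _ hw]
    norm_num
  rw [besselI, besselSeries, show 2 * (w ^ (1 / 2 : ℂ) * (r : ℂ)) / 2 = r * w ^ (1 / 2 : ℂ) by ring,
    h1]
  congr 1
  refine tsum_congr fun n => ?_
  rw [pow_mul, mul_pow, h2, Complex.ofReal_pow]

lemma laguerreKernelIntegrand_eq {τ : ℝ} (hτ0 : 0 < τ) (hτ1 : τ < 1) {z u : ℂ} (hzu : z * u ≠ 0)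
    {α : ℝ} (hα : 0 < Real.sin α) :
    laguerreKernelIntegrand ν τ z u α
      = (((1 - τ ^ 2) ^ (-ν) : ℝ) : ℂ) * (z * u) ^ ((ν : ℂ) / 2) * (((Real.sin α ^ ν : ℝ) : ℂ) *
        (Complex.sinh ((z / (1 - (τ : ℂ) ^ 2) - u / (1 - (τ : ℂ) ^ 2)) * (Real.cos α : ℂ)) *
          besselSeries ν (((Real.sin α ^ 2 : ℝ) : ℂ) *
            (z / (1 - (τ : ℂ) ^ 2) * (u / (1 - (τ : ℂ) ^ 2)))))) := by
  have hδ : 0 < 1 - τ ^ 2 := by nlinarith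
  have h1 : 2 * (z * u) ^ (1 / 2 : ℂ) * (Real.sin α : ℂ) / ((1 - τ ^ 2 : ℝ) : ℂ)
      = 2 * ((z * u) ^ (1 / 2 : ℂ) * ((Real.sin α / (1 - τ ^ 2) : ℝ) : ℂ)) := by
    push_cast
    ring
  rw [laguerreKernelIntegrand, h1, besselI_two_mul_sqrt (div_pos hα hδ) hzu,
    Real.div_rpow hα.le hδ.le, Real.rpow_neg hδ.le]
  have h2 : (z - u) * (Real.cos α : ℂ) / ((1 - τ ^ 2 : ℝ) : ℂ)
      = (z / (1 - (τ : ℂ) ^ 2) - u / (1 - (τ : ℂ) ^ 2)) * (Real.cos α : ℂ) := by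
    push_cast
    ring
  have h3 : (((Real.sin α / (1 - τ ^ 2)) ^ 2 : ℝ) : ℂ) * (z * u)
      = ((Real.sin α ^ 2 : ℝ) : ℂ) * (z / (1 - (τ : ℂ) ^ 2) * (u / (1 - (τ : ℂ) ^ 2))) := by
    push_cast
    ring
  rw [h2, h3]
  push_cast
  ring

lemma intervalIntegrable_laguerreKernelIntegrand {τ : ℝ} (hν : -1 < ν) (hτ0 : 0 < τ) (hτ1 : τ < 1)
    {z u : ℂ} (hzu : z * u ≠ 0) :
    IntervalIntegrable (laguerreKernelIntegrand ν τ z u) volume 0 (Real.pi / 2) := by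
  have h1 := (intervalIntegrable_sin_rpow_mul hν (g := fun α =>
    Complex.sinh ((z / (1 - (τ : ℂ) ^ 2) - u / (1 - (τ : ℂ) ^ 2)) * (Real.cos α : ℂ)) *
      besselSeries ν (((Real.sin α ^ 2 : ℝ) : ℂ) *
        (z / (1 - (τ : ℂ) ^ 2) * (u / (1 - (τ : ℂ) ^ 2)))))
    ((Complex.continuous_sinh.comp (by fun_prop)).mul
      (continuous_besselSeries_sin_sq hν _))).const_mul
    ((((1 - τ ^ 2) ^ (-ν) : ℝ) : ℂ) * (z * u) ^ ((ν : ℂ) / 2))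
  refine h1.congr fun α hα => ?_
  rw [Set.uIoc_of_le (by positivity)] at hα
  exact (laguerreKernelIntegrand_eq hτ0 hτ1 hzu
    (Real.sin_pos_of_pos_of_lt_pi hα.1 (by linarith [hα.2, Real.pi_pos]))).symm

lemma laguerreKernel_eq_integral {τ : ℝ} (hν : -1 < ν) (hτ0 : 0 < τ) (hτ1 : τ < 1)
    {z u : ℂ} (hzu : z * u ≠ 0) :
    laguerreKernel ν τ z u =
      ((Real.Gamma (ν + 2) : ℝ) : ℂ) *
          Complex.exp (-((τ : ℂ) / ((1 - τ ^ 2 : ℝ) : ℂ)) * (z + u)) /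
          (((1 - τ ^ 2 : ℝ) : ℂ) * (z * u) ^ ((ν : ℂ) / 2)) *
        ∫ α in (0 : ℝ)..(Real.pi / 2), laguerreKernelIntegrand ν τ z u α := by
  have hδ : 0 < 1 - τ ^ 2 := by nlinarith
  have hδ0 : ((1 - τ ^ 2 : ℝ) : ℂ) ≠ 0 := by exact_mod_cast hδ.ne'
  have hI : ∫ α in (0 : ℝ)..(Real.pi / 2), laguerreKernelIntegrand ν τ z u α
      = (((1 - τ ^ 2) ^ (-ν) : ℝ) : ℂ) * (z * u) ^ ((ν : ℂ) / 2) *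
        ∫ α in (0 : ℝ)..(Real.pi / 2), ((Real.sin α ^ ν : ℝ) : ℂ) *
        (Complex.sinh ((z / (1 - (τ : ℂ) ^ 2) - u / (1 - (τ : ℂ) ^ 2)) * (Real.cos α : ℂ)) *
          besselSeries ν (((Real.sin α ^ 2 : ℝ) : ℂ) *
            (z / (1 - (τ : ℂ) ^ 2) * (u / (1 - (τ : ℂ) ^ 2))))) := by
    rw [← intervalIntegral.integral_const_mul]
    refine intervalIntegral.integral_congr_ae (Eventually.of_forall fun α hα => ?_)
    rw [Set.uIoc_of_le (by positivity)] at hα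
    exact laguerreKernelIntegrand_eq hτ0 hτ1 hzu
      (Real.sin_pos_of_pos_of_lt_pi hα.1 (by linarith [hα.2, Real.pi_pos]))
  have hp : (z * u) ^ ((ν : ℂ) / 2) ≠ 0 := by
    rw [Ne, Complex.cpow_eq_zero_iff]
    exact fun h => hzu h.1
  have hw : (1 - (τ : ℂ) ^ 2) = ((1 - τ ^ 2 : ℝ) : ℂ) := by push_cast; rfl
  -- The factor `(1-τ²)^(-ν)` is the one coming from the Bessel argument in `hI`; the remaining
  -- `1/(1-τ²)` is the prefactor of the formula.
  have h1 : ((1 - τ ^ 2 : ℝ) : ℂ) ^ (-(ν + 1) : ℂ)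
      = (((1 - τ ^ 2) ^ (-ν) : ℝ) : ℂ) / ((1 - τ ^ 2 : ℝ) : ℂ) := by
    rw [Complex.ofReal_cpow hδ.le, neg_add, Complex.cpow_add _ _ hδ0, Complex.cpow_neg_one,
      Complex.ofReal_neg]
    rfl
  rw [laguerreKernel_eq_tsum_kernelCoeff hν hτ0 hτ1, tsum_kernelCoeff_eq_integral hν, hI]
  generalize (∫ α in (0 : ℝ)..(Real.pi / 2), _ : ℂ) = J
  rw [hw, h1]
  generalize (((1 - τ ^ 2) ^ (-ν) : ℝ) : ℂ) = A
  generalize (z * u) ^ ((ν : ℂ) / 2) = Q at hp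
  generalize ((1 - τ ^ 2 : ℝ) : ℂ) = w at hδ0
  rw [show -((τ : ℂ) / w) * (z + u) = -τ * (z / w) + -τ * (u / w) by ring, Complex.exp_add]
  field_simp

end BesselSeries

theorem mainTheorem3 (ν τ : ℝ) (hν : -1 < ν) (hτ0 : 0 < τ) (hτ1 : τ < 1) :
    -- skew-orthogonal polynomials for the weight exist
    (∃ (q : ℕ → Polynomial ℂ) (r : ℕ → ℝ),
      IsSkewOrthogonalFamily (chiralEllipticMeasure ν τ) q r ∧ ∀ n : ℕ, (q n).Monic) ∧
    -- the pre-kernel, its Laguerre form, and its convergence, for every choice of them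
    (∀ (q : ℕ → Polynomial ℂ) (r : ℕ → ℝ),
      IsSkewOrthogonalFamily (chiralEllipticMeasure ν τ) q r →
        (∀ (N : ℕ) (z u : ℂ),
          preKernel q r N z u = ∑ k ∈ Finset.range N, laguerreKernelTerm ν τ k z u) ∧
        (∀ C : Set (ℂ × ℂ), IsCompact C →
          TendstoUniformlyOn (fun (N : ℕ) (p : ℂ × ℂ) => preKernel q r N p.1 p.2)
            (fun p : ℂ × ℂ => laguerreKernel ν τ p.1 p.2) atTop C)) ∧
    -- the limit as an absolutely convergent double sum, continuous in both variables
    (∀ z u : ℂ, Summable fun k : ℕ => laguerreKernelTerm ν τ k z u) ∧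
    Continuous (fun p : ℂ × ℂ => laguerreKernel ν τ p.1 p.2) ∧
    -- the limit in closed form
    (∀ z u : ℂ, z * u ≠ 0 →
      IntervalIntegrable (laguerreKernelIntegrand ν τ z u) volume 0 (Real.pi / 2) ∧
      laguerreKernel ν τ z u =
        ((Real.Gamma (ν + 2) : ℝ) : ℂ) *
            Complex.exp (-((τ : ℂ) / ((1 - τ ^ 2 : ℝ) : ℂ)) * (z + u)) /
            (((1 - τ ^ 2 : ℝ) : ℂ) * (z * u) ^ ((ν : ℂ) / 2)) *
          ∫ α in (0 : ℝ)..(Real.pi / 2), laguerreKernelIntegrand ν τ z u α) := by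
  refine ⟨⟨skewFamily ν τ, _, isSkewOrthogonalFamily_skewFamily hν hτ0 hτ1,
    fun n => (skewFamily_monic_degree hν τ n).1⟩, fun q r hq =>
    ⟨preKernel_eq_sum hν hτ0 hτ1 hq, fun C hC => ?_⟩, summable_laguerreKernelTerm hν hτ0 hτ1,
    continuous_laguerreKernel hν hτ0 hτ1, fun z u hzu =>
    ⟨intervalIntegrable_laguerreKernelIntegrand hν hτ0 hτ1 hzu,
      laguerreKernel_eq_integral hν hτ0 hτ1 hzu⟩⟩
  simp only [preKernel_eq_sum hν hτ0 hτ1 hq]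
  exact tendstoUniformlyOn_laguerreKernel hν hτ0 hτ1 hC
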